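/- **Setting.** Let $\mathbb P=\mathbb R^2\times(0,\infty)\times\mathbb R$ be the affine Poincaré group, with group law $(b,a,\vartheta)(b',a',\vartheta')=(b+a\Lambda_\vartheta b',aa',\vartheta+\vartheta')$, where $\Lambda_\vartheta=\begin{pmatrix}\cosh\vartheta&\sinh\vartheta\\ \sinh\vartheta&\cosh\vartheta\end{pmatrix}$, left Haar measure $d\mu=\frac{db\,da\,d\vartheta}{a^3}$ and modular function $\Delta(b,a,\vartheta)=a^{-2}$; $L^2(\mathbb P)=L^2(\mathbb P,\mu)$. Put $\langle x;y\rangle=x_1y_1-x_2y_2$ on $\mathbb R^2$, and let $C_1^1,C_2^1=\{x_1^2>x_2^2,\ \pm x_1>0\}$ and $C_1^2,C_2^2=\{x_1^2<x_2^2,\ \pm x_2>0\}$. For $i,j\in\{1,2\}$ let $\pi_i^j$ be the unitary representation $(\pi_i^j(b,a,\vartheta)\varphi)(x)=a\,e^{i\langle x;b\rangle}\varphi(a\Lambda_{-\vartheta}x)$ on $L^2(C_i^j)$ and $D_i^j$ the unbounded operator of multiplication by $\frac1{2\pi}|\langle x;x\rangle|^{1/2}$ on its maximal domain. For $f\in L^2(\mathbb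 P)$, $\widehat f(\pi_i^j)$ is the bounded (indeed Hilbert–Schmidt) operator with $\widehat f(\pi_i^j)\varphi=\int_{\mathbb P}f(g)\,\pi_i^j(g)D_i^j\varphi\,d\mu(g)$ (weakly) for $\varphi$ in the domain of $D_i^j$. A symbol $\sigma$ assigns to each $g\in\mathbb P$ and each $(i,j)$ a Hilbert–Schmidt operator $\sigma(g,\pi_i^j)$ on $L^2(C_i^j)$, and $$(T_\sigma f)(g)=\Delta(g)^{-1/2}\sum_{i,j=1}^2\operatorname{Tr}\big[D_i^j\sigma(g,\pi_i^j)\widehat f(\pi_i^j)\pi_i^j(g)^*\big],\qquad f\in L^2(\mathbb P).$$ Assume that $\sum_{i,j}\int_{\mathbb P}\|\sigma(g,\pi_i^j)\|_{S_2}^2\,d\mu(g)<\infty$, and that $g\mapsto\pi_i^j(g)^*D_i^j\sigma(g,\pi_i^j)$ is a well-defined, weakly continuous map from $\mathbb P$ to the Hilbert space $S_2(C_i^j)$ of Hilbert–Schmidt operators, for all $i,j$. (That $T_\sigma$ is trace class on $L^2(\mathbb P)$ means that $T_\sigma f$ equals $Sf$ almost everywhere, for all $f\in L^2(\mathbb P)$,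 for a bounded trace class operator $S$ on $L^2(\mathbb P)$.) Let $\mathcal F^{-1}\varphi(x)=\frac1{2\pi}\int_{\mathbb R^2}e^{-i\langle\xi;x\rangle}\varphi(\xi)\,d\xi$, extended to $L^2$; a subscript $1$ or $2$ means that it acts in the first or second variable only. For $\tau\in L^2(\mathbb R^2\times\mathbb R^2)$ let $W_\tau$ be the Weyl transform on $L^2(\mathbb R^2)$, $$\langle W_\tau u,v\rangle=\frac1{(2\pi)^2}\int_{\mathbb R^2}\int_{\mathbb R^2}\tau(x,\xi)\int_{\mathbb R^2}e^{-i\xi\cdot q}u\big(x+\tfrac q2\big)\overline{v\big(x-\tfrac q2\big)}\,dq\,dx\,d\xi .$$ For $\beta\in L^2(\mathbb P)$ and $g=(b,a,\vartheta)\in\mathbb P$ set $$K_{g,\beta}(x,\xi)=\frac{2\pi}{a}\,\frac{|\langle x;x\rangle|^{1/2}}{|\langle\xi;\xi\rangle|}\,(\mathcal F_1^{-1}\beta)(x,a',\vartheta'),\qquad \xi=a'\Lambda_{-\vartheta'}x,$$ if $x,\xi$ lie in the same cone $C_i^j$ (the pair $(a',\vartheta')$ is then unique), and $K_{g,\beta}(x,\xi)=0$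 otherwise. Further set $(TK)(x,t)=K(x+\frac t2,x-\frac t2)$ and $\tau_{g,\beta}(x,\xi)=(\mathcal F_2^{-1}TK_{g,\beta})(x,(-\xi_1,\xi_2))$. **Theorem (trace class pseudo-differential operators).** $T_\sigma$ is a trace class operator on $L^2(\mathbb P)$ if and only if there is a weakly continuous map $\alpha:\mathbb P\to L^2(\mathbb P)$ with $\int_{\mathbb P}\|\alpha(g)\|_{L^2(\mathbb P)}^2\,d\mu(g)<\infty$ such that, for all $g\in\mathbb P$ and all $i,j$, $$\pi_i^j(g)^*D_i^j\sigma(g,\pi_i^j)=W_{\tau_{g,\alpha(g)}}\quad\text{on }L^2(C_i^j)\subset L^2(\mathbb R^2),$$ and there are jointly measurable $k_1,k_2:\mathbb P\to L^2(\mathbb P)$ with $\int_{\mathbb P}\|k_i(g)\|^2_{L^2(\mathbb P)}\,d\mu(g)<\infty$ $(i=1,2)$ such that, for almost every $g\in\mathbb P$ and all $h\in\mathbb P$ (for a suitable representative of $\alpha(g)$), $$\alpha(g)(h)=\int_{\mathbb P}k_1(g)(w)\,k_2(w)(h)\,d\mu(w).$$ Furthermore, if $T_\sigma$ is trace class, then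 for all such $\alpha,k_1,k_2$ the function $g\mapsto\alpha(g)(g)$ is integrable and $$\operatorname{Tr}(T_\sigma)=\int_{\mathbb P}\alpha(b,a,\vartheta)(b,a,\vartheta)\,\frac{db\,da\,d\vartheta}{a^3}.$$ -/

import Mathlib

open MeasureTheory
open scoped ENNReal FourierTransform InnerProduct ComplexConjugate

noncomputable section

namespace AffinePoincare

/-! ### Hilbert–Schmidt and trace class operators on a complex Hilbert space -/

section Operators

variable {H : Type} [NormedAddCommGroup H] [InnerProductSpace ℂ H] [CompleteSpace H]

/-- The index set of a chosen orthonormal basis of `H`. -/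
def basisIndex (H : Type) [NormedAddCommGroup H] [InnerProductSpace ℂ H] [CompleteSpace H] :
    Set H :=
  Classical.choose (exists_hilbertBasis ℂ H)

/-- A chosen orthonormal (Hilbert) basis of `H`. The quantities defined with it below do not
depend on the choice. -/
def chosenBasis (H : Type) [NormedAddCommGroup H] [InnerProductSpace ℂ H] [CompleteSpace H] :
    HilbertBasis (basisIndex H) ℂ H :=
  Classical.choose (Classical.choose_spec (exists_hilbertBasis ℂ H))

/-- The square of the Hilbert–Schmidt norm, `∑ ‖T eₙ‖²`. -/
def hsNormSq (T : H →L[ℂ] H) : ℝ≥0∞ :=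
  ∑' n, ‖T (chosenBasis H n)‖ₑ ^ 2

/-- `T` belongs to the Hilbert–Schmidt class `S₂`. -/
def IsHilbertSchmidt (T : H →L[ℂ] H) : Prop :=
  hsNormSq T < ∞

/-- `T` is of trace class: `∑ ⟨|T| eₙ, eₙ⟩ < ∞`, where `|T| = (T* T)^{1/2}`. -/
def IsTraceClass (T : H →L[ℂ] H) : Prop :=
  Summable fun n => (inner ℂ (chosenBasis H n) (CFC.abs T (chosenBasis H n))).re

/-- The trace `∑ ⟨T eₙ, eₙ⟩` (for trace class `T`). -/
def opTrace (T : H →L[ℂ] H) : ℂ :=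
  ∑' n, inner ℂ (chosenBasis H n) (T (chosenBasis H n))

end Operators

/-! ### The group, its Haar measure and the cones -/

/-- The plane `ℝ²`. -/
abbrev Plane : Type := EuclideanSpace ℝ (Fin 2)

/-- The underlying space `ℝ² × (0, ∞) × ℝ` of the affine Poincaré group, with points
`(b, a, ϑ)`. -/
abbrev Grp : Type := Plane × Set.Ioi (0 : ℝ) × ℝ

/-- The dilation parameter `a` of `(b, a, ϑ)`. -/
def dilPar (g : Grp) : ℝ := (g.2.1 : ℝ)

lemma dilPar_pos (g : Grp) : 0 < dilPar g := g.2.1.2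

/-- The measure `da dϑ / a³` on the pairs `(a, ϑ)`. -/
def haarA : Measure (Set.Ioi (0 : ℝ) × ℝ) :=
  (((volume : Measure ℝ).comap (Subtype.val : Set.Ioi (0 : ℝ) → ℝ)).prod
    (volume : Measure ℝ)).withDensity fun q => ENNReal.ofReal (1 / (q.1 : ℝ) ^ 3)

/-- The left Haar measure `db da dϑ / a³`. -/
def haarL : Measure Grp := (volume : Measure Plane).prod haarA

/-- The modular function `Δ(b, a, ϑ) = 1 / a²`. -/
def modular (g : Grp) : ℝ := 1 / dilPar g ^ 2

/-- `L²` of the group with respect to left Haar measure. -/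
abbrev L2Grp : Type := Lp ℂ 2 haarL

/-- `L²(ℝ²)`. -/
abbrev L2Plane : Type := Lp ℂ 2 (volume : Measure Plane)

/-- The Minkowski form `⟨x; y⟩ = x₁ y₁ - x₂ y₂`. -/
def mink (x y : Plane) : ℝ := x 0 * y 0 - x 1 * y 1

/-- The hyperbolic rotation `Λ_ϑ`. -/
def boost (t : ℝ) : Plane →ₗ[ℝ] Plane :=
  Matrix.toEuclideanLin !![Real.cosh t, Real.sinh t; Real.sinh t, Real.cosh t]

/-- The four open cones. Indices are `0, 1` instead of `1, 2`: the upper index `j` selects the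
dominating coordinate (`j = 0`: `x₁² > x₂²`, `j = 1`: `x₁² < x₂²`; in `Fin 2`, `j + 1` is the
other index), and the lower index `i` selects the sign of that coordinate (`i = 0`: positive,
`i = 1`: negative). -/
def cone (i j : Fin 2) : Set Plane :=
  {x | x (j + 1) ^ 2 < x j ^ 2 ∧ 0 < (-1 : ℝ) ^ (i : ℕ) * x j}

/-- `L²` of a cone, with Lebesgue measure. -/
abbrev L2Cone (i j : Fin 2) : Type := Lp ℂ 2 ((volume : Measure Plane).restrict (cone i j))

lemma measurableSet_cone (i j : Fin 2) : MeasurableSet (cone i j) := by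
  have h1 : IsOpen {x : Plane | x (j + 1) ^ 2 < x j ^ 2} :=
    isOpen_lt (by fun_prop) (by fun_prop)
  have h2 : IsOpen {x : Plane | 0 < (-1 : ℝ) ^ (i : ℕ) * x j} :=
    isOpen_lt (by fun_prop) (by fun_prop)
  exact (h1.inter h2).measurableSet

/-- Extension by zero `L²(C) → L²(ℝ²)`. -/
def extendZero {i j : Fin 2} (φ : L2Cone i j) : L2Plane :=
  ((memLp_indicator_iff_restrict (measurableSet_cone i j)).2 (Lp.memLp φ)).toLp
    ((cone i j).indicator φ)

/-! ### The representations -/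

/-- The linear map `x ↦ a Λ_{-ϑ} x`. -/
def act (g : Grp) : Plane →ₗ[ℝ] Plane := dilPar g • boost (-g.2.2)

lemma act_zero_apply (g : Grp) (x : Plane) :
    act g x 0 = dilPar g * (Real.cosh g.2.2 * x 0 - Real.sinh g.2.2 * x 1) := by
  simp [act, boost, Matrix.toLpLin_apply, dotProduct, Fin.sum_univ_two]
  ring_nf; simp

lemma act_one_apply (g : Grp) (x : Plane) :
    act g x 1 = dilPar g * (Real.cosh g.2.2 * x 1 - Real.sinh g.2.2 * x 0) := by
  simp [act, boost, Matrix.toLpLin_apply, dotProduct, Fin.sum_univ_two]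
  ring_nf; simp

lemma act_mem_cone (g : Grp) (i j : Fin 2) {x : Plane} (hx : x ∈ cone i j) :
    act g x ∈ cone i j := by
  have ha := dilPar_pos g
  obtain ⟨h1, h2⟩ := hx
  have hc := Real.cosh_sq g.2.2
  have hcp := Real.cosh_pos g.2.2
  have hlt : ∀ p q : ℝ, q ^ 2 < p ^ 2 → 0 < p →
      0 < Real.cosh g.2.2 * p - Real.sinh g.2.2 * q := by
    intro p q hpq hp
    have h3 : (Real.sinh g.2.2 * q) ^ 2 < (Real.cosh g.2.2 * p) ^ 2 := by
      nlinarith [sq_nonneg (Real.sinh g.2.2), sq_nonneg q]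
    have h4 := abs_lt_of_sq_lt_sq h3 (by positivity)
    linarith [le_abs_self (Real.sinh g.2.2 * q), h4]
  have hlt' : ∀ p q : ℝ, q ^ 2 < p ^ 2 → 0 < -p →
      0 < -(Real.cosh g.2.2 * p - Real.sinh g.2.2 * q) := by
    intro p q hpq hp
    have := hlt (-p) (-q) (by simpa using hpq) hp
    linarith
  have hsq : ∀ p q : ℝ, q ^ 2 < p ^ 2 →
      (dilPar g * (Real.cosh g.2.2 * q - Real.sinh g.2.2 * p)) ^ 2 <
        (dilPar g * (Real.cosh g.2.2 * p - Real.sinh g.2.2 * q)) ^ 2 := by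
    intro p q hpq
    have h3 : 0 < dilPar g ^ 2 * (p ^ 2 - q ^ 2) := mul_pos (pow_pos ha 2) (by linarith)
    nlinarith
  fin_cases i <;> fin_cases j <;> simp at h1 h2 <;>
    simp only [cone, Set.mem_ofPred_eq] <;> simp [act_zero_apply, act_one_apply] <;>
    refine ⟨hsq _ _ h1, ?_⟩
  · exact mul_pos ha (hlt _ _ h1 h2)
  · exact mul_pos ha (hlt _ _ h1 h2)
  · have := mul_pos ha (hlt' _ _ h1 (by linarith)); linarith
  · have := mul_pos ha (hlt' _ _ h1 (by linarith)); linarith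

lemma det_act (g : Grp) : LinearMap.det (act g) = dilPar g ^ 2 := by
  have h : LinearMap.det (boost (-g.2.2)) = 1 := by
    rw [boost, Matrix.toEuclideanLin, Matrix.toLpLin_eq_toLin, LinearMap.det_toLin,
      Matrix.det_fin_two_of]
    have := Real.cosh_sq (-g.2.2)
    nlinarith
  rw [act, LinearMap.det_smul, h]
  simp

lemma act_mem_cone_iff (g : Grp) (i j : Fin 2) (x : Plane) :
    act g x ∈ cone i j ↔ x ∈ cone i j := by
  refine ⟨fun h => ?_, act_mem_cone g i j⟩
  have hx : act (0, ⟨(dilPar g)⁻¹, inv_pos.2 (dilPar_pos g)⟩, -g.2.2) (act g x) = x := by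
    have ha := (dilPar_pos g).ne'
    have hc := Real.cosh_sq g.2.2
    ext k
    fin_cases k <;> simp only [Fin.zero_eta, Fin.mk_one, act_zero_apply, act_one_apply] <;>
      simp only [dilPar, Real.cosh_neg, Real.sinh_neg] at ha ⊢ <;> field_simp <;> ring_nf <;>
      rw [hc] <;> ring
  rw [← hx]
  exact act_mem_cone _ i j h

lemma map_act (g : Grp) (i j : Fin 2) :
    Measure.map (act g) ((volume : Measure Plane).restrict (cone i j)) =
      ENNReal.ofReal ((dilPar g ^ 2)⁻¹) • (volume : Measure Plane).restrict (cone i j) := by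
  have hd : LinearMap.det (act g) ≠ 0 := by
    rw [det_act]; exact (pow_pos (dilPar_pos g) 2).ne'
  have hm : Measurable (act g) := (LinearMap.continuous_of_finiteDimensional _).measurable
  have hp : act g ⁻¹' cone i j = cone i j := by
    ext x; exact act_mem_cone_iff g i j x
  have h := Measure.restrict_map hm (measurableSet_cone i j) (μ := volume)
  rw [hp] at h
  rw [← h, Measure.map_linearMap_addHaar_eq_smul_addHaar _ hd, det_act, Measure.restrict_smul,
    abs_of_pos (inv_pos.2 (pow_pos (dilPar_pos g) 2))]

lemma aemeasurable_act (g : Grp) (i j : Fin 2) :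
    AEMeasurable (act g) ((volume : Measure Plane).restrict (cone i j)) :=
  (LinearMap.continuous_of_finiteDimensional _).measurable.aemeasurable

lemma quasi_act (g : Grp) (i j : Fin 2) :
    Measure.QuasiMeasurePreserving (act g) ((volume : Measure Plane).restrict (cone i j))
      ((volume : Measure Plane).restrict (cone i j)) :=
  ⟨(LinearMap.continuous_of_finiteDimensional _).measurable, by
    rw [map_act]; exact Measure.smul_absolutelyContinuous⟩

/-- The function `x ↦ a e^{i⟨x; b⟩} φ(a Λ_{-ϑ} x)`. -/
def repFun (g : Grp) (φ : Plane → ℂ) (x : Plane) : ℂ :=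
  (dilPar g : ℂ) * Complex.exp (Complex.I * (mink x g.1 : ℂ)) * φ (act g x)

lemma eLpNorm_repFun (g : Grp) {i j : Fin 2} (φ : L2Cone i j) :
    eLpNorm (repFun g φ) 2 ((volume : Measure Plane).restrict (cone i j)) =
      eLpNorm φ 2 ((volume : Measure Plane).restrict (cone i j)) := by
  set ν := (volume : Measure Plane).restrict (cone i j) with hν
  have ha := dilPar_pos g
  have h1 : eLpNorm (repFun g φ) 2 ν = eLpNorm ((dilPar g : ℂ) • ((φ : Plane → ℂ) ∘ act g)) 2 ν := by
    apply eLpNorm_congr_norm_ae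
    filter_upwards with x
    simp only [repFun, norm_mul, Pi.smul_apply, smul_eq_mul, Function.comp_apply]
    rw [mul_comm Complex.I, Complex.norm_exp_ofReal_mul_I, mul_one]
  have h2 : eLpNorm ((φ : Plane → ℂ) ∘ act g) 2 ν =
      eLpNorm φ 2 (ENNReal.ofReal ((dilPar g ^ 2)⁻¹) • ν) := by
    rw [hν, ← map_act, eLpNorm_map_measure _ (aemeasurable_act g i j)]
    rw [map_act]
    exact (Lp.aestronglyMeasurable φ).smul_measure _
  rw [h1, eLpNorm_const_smul, h2, eLpNorm_smul_measure_of_ne_top (by simp), smul_eq_mul,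
    ← mul_assoc]
  have h3 : ‖(dilPar g : ℂ)‖ₑ *
      ENNReal.ofReal ((dilPar g ^ 2)⁻¹) ^ (1 / (2 : ℝ≥0∞)).toReal = 1 := by
    have e : (dilPar g ^ 2)⁻¹ = ((dilPar g)⁻¹) ^ 2 := by rw [inv_pow]
    rw [← ofReal_norm, Complex.norm_real, Real.norm_of_nonneg ha.le, e,
      ENNReal.ofReal_pow (inv_pos.2 ha).le, ← ENNReal.rpow_natCast, ← ENNReal.rpow_mul]
    simp only [one_div, ENNReal.toReal_inv, ENNReal.toReal_ofNat, Nat.cast_ofNat]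
    rw [mul_inv_cancel₀ (two_ne_zero), ENNReal.rpow_one, ← ENNReal.ofReal_mul ha.le,
      mul_inv_cancel₀ ha.ne', ENNReal.ofReal_one]
  rw [h3, one_mul]

lemma memLp_repFun (g : Grp) {i j : Fin 2} (φ : L2Cone i j) :
    MemLp (repFun g φ) 2 ((volume : Measure Plane).restrict (cone i j)) := by
  refine ⟨?_, by rw [eLpNorm_repFun]; exact Lp.eLpNorm_lt_top φ⟩
  have h : AEStronglyMeasurable (fun x => (φ : Plane → ℂ) (act g x))
      ((volume : Measure Plane).restrict (cone i j)) :=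
    (Lp.aestronglyMeasurable φ).comp_quasiMeasurePreserving (quasi_act g i j)
  refine AEStronglyMeasurable.mul (Continuous.aestronglyMeasurable ?_) h
  unfold mink
  fun_prop

/-- The representation `π_i^j` on `L²(C_i^j)`,
`(π(b, a, ϑ) φ)(x) = a e^{i⟨x; b⟩} φ(a Λ_{-ϑ} x)`. -/
def rep (i j : Fin 2) (g : Grp) : L2Cone i j →L[ℂ] L2Cone i j :=
  LinearMap.mkContinuous
    { toFun := fun φ => (memLp_repFun g φ).toLp (repFun g φ)
      map_add' := by
        intro φ ψ
        refine Eq.trans ?_ (MemLp.toLp_add (memLp_repFun g φ) (memLp_repFun g ψ))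
        rw [MemLp.toLp_eq_toLp_iff]
        filter_upwards [(quasi_act g i j).ae (Lp.coeFn_add φ ψ)] with x hx
        simp only [repFun, hx, Pi.add_apply]
        ring
      map_smul' := by
        intro c φ
        refine Eq.trans ?_ (MemLp.toLp_const_smul c (memLp_repFun g φ))
        rw [MemLp.toLp_eq_toLp_iff]
        filter_upwards [(quasi_act g i j).ae (Lp.coeFn_smul c φ)] with x hx
        simp only [repFun, hx, Pi.smul_apply, smul_eq_mul]
        ring
 }
    1 (by
      intro φ
      rw [one_mul]
      simp only [LinearMap.coe_mk, AddHom.coe_mk, Lp.norm_toLp, eLpNorm_repFun]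
      rfl)

/-- The Duflo–Moore operator `D_i^j`, an unbounded operator on `L²(C_i^j)`: multiplication by
`|⟨x; x⟩|^{1/2} / (2π)` on its maximal domain. -/
def duflo (i j : Fin 2) : L2Cone i j →ₗ.[ℂ] L2Cone i j where
  domain :=
    { carrier := {φ | MemLp (fun x => ((√|mink x x| / (2 * Real.pi) : ℝ) : ℂ) * φ x) 2
        ((volume : Measure Plane).restrict (cone i j))}
      add_mem' := by
        intro φ ψ hφ hψ
        refine MemLp.ae_eq ?_ (hφ.add hψ)
        filter_upwards [Lp.coeFn_add φ ψ] with x hx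
        simp only [hx, Pi.add_apply]
        ring
      zero_mem' := by
        refine MemLp.ae_eq ?_ (MemLp.zero (ε := ℂ))
        filter_upwards [Lp.coeFn_zero ℂ 2 ((volume : Measure Plane).restrict (cone i j))]
          with x hx
        change (0 : ℂ) = _ * ((0 : L2Cone i j) : Plane → ℂ) x
        rw [hx]
        simp
      smul_mem' := by
        intro c φ hφ
        refine MemLp.ae_eq ?_ (hφ.const_smul c)
        filter_upwards [Lp.coeFn_smul c φ] with x hx
        simp only [hx, Pi.smul_apply, smul_eq_mul]
        ring
 }
  toFun :=
    { toFun := fun φ => MemLp.toLp _ φ.2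
      map_add' := by
        intro φ ψ
        refine Eq.trans ?_ (MemLp.toLp_add φ.2 ψ.2)
        rw [MemLp.toLp_eq_toLp_iff]
        filter_upwards [Lp.coeFn_add (φ : L2Cone i j) (ψ : L2Cone i j)] with x hx
        simp only [Submodule.coe_add, hx, Pi.add_apply]
        ring
      map_smul' := by
        intro c φ
        refine Eq.trans ?_ (MemLp.toLp_const_smul c φ.2)
        rw [MemLp.toLp_eq_toLp_iff]
        filter_upwards [Lp.coeFn_smul c (φ : L2Cone i j)] with x hx
        simp only [Submodule.coe_smul, hx, Pi.smul_apply, smul_eq_mul]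
        ring
 }

/-- `A` is the (everywhere defined, bounded) operator `D S`. -/
def IsDufloComp {i j : Fin 2} (S A : L2Cone i j →L[ℂ] L2Cone i j) : Prop :=
  ∀ φ, ∃ h : S φ ∈ (duflo i j).domain, A φ = duflo i j ⟨S φ, h⟩

open Classical in
/-- The operator `D S`, if it is everywhere defined and bounded. -/
def dufloComp {i j : Fin 2} (S : L2Cone i j →L[ℂ] L2Cone i j) : L2Cone i j →L[ℂ] L2Cone i j :=
  if h : ∃ A, IsDufloComp S A then Classical.choose h else 0

/-! ### Fourier transform on the group and pseudo-differential operators -/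

/-- `A` is the Fourier transform of `f` at `π_i^j`: `A φ = ∫ f(g) π(g) D φ dμ(g)`, weakly, for `φ`
in the (dense) domain of `D`. The weak integral converges absolutely for every `f ∈ L²`, because
`g ↦ ⟨π(g) D φ, ψ⟩` is square integrable. -/
def IsGroupFourier {i j : Fin 2} (f : L2Grp) (A : L2Cone i j →L[ℂ] L2Cone i j) : Prop :=
  ∀ (φ : (duflo i j).domain) (ψ : L2Cone i j),
    Integrable (fun g => f g * inner ℂ ψ (rep i j g (duflo i j φ))) haarL ∧
    inner ℂ ψ (A φ) = ∫ g, f g * inner ℂ ψ (rep i j g (duflo i j φ)) ∂haarL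

open Classical in
/-- The Fourier transform of `f ∈ L²` at `π_i^j`, the unique bounded operator with the property
`IsGroupFourier`. -/
def groupFourier (i j : Fin 2) (f : L2Grp) : L2Cone i j →L[ℂ] L2Cone i j :=
  if h : ∃ A : L2Cone i j →L[ℂ] L2Cone i j, IsGroupFourier f A then Classical.choose h else 0

/-- Operator valued symbols: `σ g i j` is the operator `σ(g, π_i^j)` on `L²(C_i^j)`. -/
abbrev OpSymbol : Type := Grp → ∀ i j : Fin 2, L2Cone i j →L[ℂ] L2Cone i j

/-- The function
`(T_σ f)(g) = Δ(g)^{-1/2} ∑_{i,j} Tr[D_i^j σ(g, π_i^j) f̂(π_i^j) π_i^j(g)*]`. -/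
def pdo (σ : OpSymbol) (f : L2Grp) (g : Grp) : ℂ :=
  ((modular g ^ (-(1 / 2) : ℝ) : ℝ) : ℂ) *
    ∑ i, ∑ j, opTrace (dufloComp (σ g i j) ∘L groupFourier i j f ∘L (rep i j g).adjoint)

/-- The bounded operator `S` on `L²` of the group is the operator `T_σ`. -/
def IsPdo (σ : OpSymbol) (S : L2Grp →L[ℂ] L2Grp) : Prop :=
  ∀ f : L2Grp, S f =ᵐ[haarL] pdo σ f

/-- The operator `π_i^j(g)* D_i^j σ(g, π_i^j)`. -/
def twisted (σ : OpSymbol) (g : Grp) (i j : Fin 2) : L2Cone i j →L[ℂ] L2Cone i j :=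
  (rep i j g).adjoint ∘L dufloComp (σ g i j)

/-- The hypotheses on the symbol: Hilbert–Schmidt values with
`∑_{i,j} ∫ ‖σ(g, π_i^j)‖²_{S₂} dμ(g) < ∞`, and `g ↦ π_i^j(g)* D_i^j σ(g, π_i^j)` is a
well-defined map into the Hilbert space `S₂(C_i^j)` (with inner product `Tr(B* A)`) that is weakly
continuous. -/
structure IsAdmissible (σ : OpSymbol) : Prop where
  hilbertSchmidt : ∀ g i j, IsHilbertSchmidt (σ g i j)
  sqIntegrable : ∑ i, ∑ j, ∫⁻ g, hsNormSq (σ g i j) ∂haarL < ∞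
  dufloComp_exists : ∀ g i j, ∃ A, IsDufloComp (σ g i j) A
  twisted_hilbertSchmidt : ∀ g i j, IsHilbertSchmidt (twisted σ g i j)
  weaklyContinuous : ∀ i j (B : L2Cone i j →L[ℂ] L2Cone i j), IsHilbertSchmidt B →
    Continuous fun g => opTrace (B.adjoint ∘L twisted σ g i j)

/-! ### Minkowski–Fourier transform and Weyl transform -/

/-- The inverse Minkowski–Fourier transform `x ↦ (2π)⁻¹ ∫ e^{-i⟨ξ; x⟩} φ(ξ) dξ` of `φ ∈ L²(ℝ²)`.
In Mathlib's normalization `𝓕 φ (y) = ∫ e^{-2πi y·ξ} φ(ξ) dξ` it is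
`(2π)⁻¹ (𝓕 φ) (x₁ / (2π), -x₂ / (2π))`. -/
def minkFourierInv (φ : L2Plane) (x : Plane) : ℂ :=
  (2 * Real.pi : ℂ)⁻¹ * (𝓕 φ : L2Plane) !₂[x 0 / (2 * Real.pi), -(x 1) / (2 * Real.pi)]

/-- `F` is the partial inverse Minkowski–Fourier transform of `h ∈ L²(Y × ℝ²)` in the plane
variable: `F ∈ L²(Y × ℝ²)` and `F(y, ·) = 𝓕⁻¹(h(y, ·))` for almost every `y`. -/
def IsPartialInv {Y : Type} [MeasurableSpace Y] (ν : Measure Y) (h F : Y → Plane → ℂ) : Prop :=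
  MemLp (Function.uncurry F) 2 (ν.prod volume) ∧
    ∀ᵐ y ∂ν, ∃ hy : MemLp (h y) 2 volume, F y =ᵐ[volume] minkFourierInv (hy.toLp (h y))

open Classical in
/-- The partial inverse Minkowski–Fourier transform in the plane variable, for `h ∈ L²(Y × ℝ²)`
(unique up to null sets). -/
def partialInv {Y : Type} [MeasurableSpace Y] (ν : Measure Y) (h : Y → Plane → ℂ) :
    Y → Plane → ℂ :=
  if H : ∃ F, IsPartialInv ν h F then Classical.choose H else 0

/-- The partial inverse Minkowski–Fourier transform `𝓕₁⁻¹ β` of `β ∈ L²` of the group, in the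
translation variable, as a function of `(x, a, ϑ)`. -/
def partialInvGrp (β : Grp → ℂ) (g : Grp) : ℂ :=
  partialInv haarA (fun q b => β (b, q)) g.2 g.1

/-- The Wigner transform
`W(u, v)(x, ξ) = (2π)⁻¹ ∫ e^{-i ξ·q} u(x + q/2) conj(v(x - q/2)) dq`. -/
def wigner (u v : L2Plane) (x ξ : Plane) : ℂ :=
  (2 * Real.pi : ℂ)⁻¹ * ∫ q : Plane, Complex.exp (-(Complex.I * (inner ℝ ξ q : ℂ))) *
    u (x + (1 / 2 : ℝ) • q) * conj (v (x - (1 / 2 : ℝ) • q))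

/-- `W` is the Weyl transform with symbol `τ ∈ L²(ℝ² × ℝ²)`:
`⟨W u, v⟩ = (2π)⁻¹ ∫∫ τ(x, ξ) W(u, v)(x, ξ) dx dξ`. -/
def IsWeyl (τ : Plane → Plane → ℂ) (W : L2Plane →L[ℂ] L2Plane) : Prop :=
  MemLp (Function.uncurry τ) 2 (volume : Measure (Plane × Plane)) ∧
    ∀ u v : L2Plane, inner ℂ v (W u) =
      (2 * Real.pi : ℂ)⁻¹ * ∫ p : Plane × Plane, τ p.1 p.2 * wigner u v p.1 p.2

/-- The twisting operator `(T K)(x, t) = K(x + t/2, x - t/2)`. -/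
def twist (K : Plane → Plane → ℂ) (x t : Plane) : ℂ :=
  K (x + (1 / 2 : ℝ) • t) (x - (1 / 2 : ℝ) • t)

/-- Two points lie in one and the same cone. -/
def SameCone (x y : Plane) : Prop := ∃ i j, x ∈ cone i j ∧ y ∈ cone i j

lemma SameCone.mink_ratio_pos {x y : Plane} (h : SameCone x y) :
    0 < mink x y / mink x x := by
  obtain ⟨i, j, ⟨h1, h2⟩, h3, h4⟩ := h
  have key : ∀ p q r t : ℝ, q ^ 2 < p ^ 2 → t ^ 2 < r ^ 2 → 0 < p * r → q * t < p * r := by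
    intro p q r t hp hr hpr
    have h5 : (q * t) ^ 2 < (p * r) ^ 2 := by
      nlinarith [sq_nonneg q, sq_nonneg t, sq_nonneg p, sq_nonneg r]
    exact lt_of_le_of_lt (le_abs_self _) (abs_lt_of_sq_lt_sq h5 hpr.le)
  fin_cases i <;> fin_cases j <;> simp at h1 h2 h3 h4
  · exact div_pos (by have := key _ _ _ _ h1 h3 (by nlinarith); unfold mink; linarith)
      (by unfold mink; nlinarith)
  · exact div_pos_of_neg_of_neg
      (by have := key _ _ _ _ h1 h3 (by nlinarith); unfold mink; linarith)
      (by unfold mink; nlinarith)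
  · exact div_pos (by have := key _ _ _ _ h1 h3 (by nlinarith); unfold mink; linarith)
      (by unfold mink; nlinarith)
  · exact div_pos_of_neg_of_neg
      (by have := key _ _ _ _ h1 h3 (by nlinarith); unfold mink; linarith)
      (by unfold mink; nlinarith)

lemma SameCone.ratio_pos {x y : Plane} (h : SameCone x y) : 0 < mink y y / mink x x := by
  obtain ⟨i, j, ⟨h1, h2⟩, h3, h4⟩ := h
  fin_cases j <;> simp at h1 h3
  · exact div_pos (by unfold mink; nlinarith) (by unfold mink; nlinarith)
  · exact div_pos_of_neg_of_neg (by unfold mink; nlinarith) (by unfold mink; nlinarith)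

/-- For `x, y` in the same cone, `y = a Λ_{-ϑ} x` for exactly one pair `(a, ϑ)`. This is
`a = (⟨y; y⟩ / ⟨x; x⟩)^{1/2}`. -/
def dilOf (x y : Plane) : ℝ := √(mink y y / mink x x)

/-- The angle `ϑ` with `y = a Λ_{-ϑ} x`: `cosh ϑ = ⟨x; y⟩ / (a ⟨x; x⟩)`, with the sign of `ϑ` fixed
by `sinh ϑ = (x₂ y₁ - x₁ y₂) / (a ⟨x; x⟩)`. -/
def angleOf (x y : Plane) : ℝ :=
  Real.arsinh ((x 1 * y 0 - x 0 * y 1) / (dilOf x y * mink x x))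

lemma SameCone.dilOf_pos {x y : Plane} (h : SameCone x y) : 0 < dilOf x y :=
  Real.sqrt_pos.2 h.ratio_pos

/-- The group element `(x, a, ϑ)` with `y = a Λ_{-ϑ} x`. -/
def transport {x y : Plane} (h : SameCone x y) : Grp :=
  (x, ⟨dilOf x y, h.dilOf_pos⟩, angleOf x y)

lemma cosh_angleOf {x y : Plane} (h : SameCone x y) :
    Real.cosh (angleOf x y) = mink x y / (dilOf x y * mink x x) := by
  have ha := h.dilOf_pos
  have hq : mink x x ≠ 0 := by
    intro h0
    have := h.ratio_pos
    simp [h0] at this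
  have hsq : dilOf x y ^ 2 * mink x x = mink y y := by
    rw [dilOf, Real.sq_sqrt h.ratio_pos.le]
    field_simp
  have hc : 0 < mink x y / (dilOf x y * mink x x) := by
    have := div_pos h.mink_ratio_pos ha
    rwa [div_div, mul_comm] at this
  refine (pow_left_inj₀ (Real.cosh_pos _).le hc.le two_ne_zero).1 ?_
  rw [Real.cosh_sq, angleOf, Real.sinh_arsinh, div_pow, div_pow, div_add_one (by positivity)]
  congr 1
  have e : (dilOf x y * mink x x) ^ 2 = mink y y * mink x x := by rw [← hsq]; ring
  rw [e]
  unfold mink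
  ring

lemma act_transport {x y : Plane} (h : SameCone x y) : act (transport h) x = y := by
  have ha := h.dilOf_pos.ne'
  have hq : mink x x ≠ 0 := by
    intro h0
    have := h.ratio_pos
    simp [h0] at this
  have hs : Real.sinh (angleOf x y) = (x 1 * y 0 - x 0 * y 1) / (dilOf x y * mink x x) := by
    rw [angleOf, Real.sinh_arsinh]
  have hc := cosh_angleOf h
  ext k
  fin_cases k <;> simp only [Fin.zero_eta, Fin.mk_one, act_zero_apply, act_one_apply] <;>
    simp only [transport, dilPar, hs, hc] <;> field_simp <;> unfold mink <;> ring

open Classical in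
/-- The kernel `K_{α(g)}`, for `β = α(g)` and `g = (b, a, ϑ)`. It is
`(2π / a) |⟨x; x⟩|^{1/2} / |⟨ξ; ξ⟩| (𝓕₁⁻¹ β)(x, a', ϑ')` with `ξ = a' Λ_{-ϑ'} x` if `x` and `ξ` lie
in the same cone, and zero otherwise. -/
def symKernel (g : Grp) (β : Grp → ℂ) (x ξ : Plane) : ℂ :=
  if h : SameCone x ξ then
    ((2 * Real.pi / dilPar g * (√|mink x x| / |mink ξ ξ|) : ℝ) : ℂ) *
      partialInvGrp β (transport h)
  else 0

/-- The Weyl symbol `τ_{α(g)}(x, ξ) = (𝓕₂⁻¹ T K_{α(g)})(x, (-ξ₁, ξ₂))`, for `β = α(g)`. -/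
def weylSymbol (g : Grp) (β : Grp → ℂ) (x ξ : Plane) : ℂ :=
  partialInv volume (twist (symKernel g β)) x !₂[-(ξ 0), ξ 1]

/-- `π_i^j(g)* D_i^j σ(g, π_i^j) = W_{τ_{α(g)}}` on `L²(C_i^j)`, for all `i, j` and all `g`. Here
`L²(C_i^j)` is viewed as a subspace of `L²(ℝ²)`. -/
def HasWeylForm (σ : OpSymbol) (α : Grp → Grp → ℂ) : Prop :=
  ∀ g, ∃ W, IsWeyl (weylSymbol g (α g)) W ∧
    ∀ (i j : Fin 2) (φ : L2Cone i j), W (extendZero φ) = extendZero (twisted σ g i j φ)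

/-- `α` is a weakly continuous map from the group to its `L²`, with `∫ ‖α(g)‖² dμ(g) < ∞`. -/
structure IsWeaklyContSqInt (α : Grp → Grp → ℂ) : Prop where
  memLp : ∀ g, MemLp (α g) 2 haarL
  weaklyContinuous : ∀ ψ : L2Grp, Continuous fun g => inner ℂ ψ ((memLp g).toLp (α g))
  sqIntegrable : ∫⁻ g, eLpNorm (α g) 2 haarL ^ 2 ∂haarL < ∞

/-- `k` is a (jointly measurable) map from the group to its `L²`, with
`∫ ‖k(g)‖² dμ(g) < ∞`. -/
structure IsSqInt (k : Grp → Grp → ℂ) : Prop where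
  aestronglyMeasurable : AEStronglyMeasurable (Function.uncurry k) (haarL.prod haarL)
  memLp : ∀ g, MemLp (k g) 2 haarL
  sqIntegrable : ∫⁻ g, eLpNorm (k g) 2 haarL ^ 2 ∂haarL < ∞

/-- `α`, `k₁`, `k₂` represent the symbol `σ`: the Weyl form with `α`, and
`α(g)(h) = ∫ k₁(g)(w) k₂(w)(h) dμ(w)` for almost every `g` and all `h`. For almost every `g` this
fixes the value `α(g)(g)` on the diagonal. -/
structure IsTraceRepr (σ : OpSymbol) (α k₁ k₂ : Grp → Grp → ℂ) : Prop where
  weaklyContSqInt : IsWeaklyContSqInt α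
  weylForm : HasWeylForm σ α
  sqInt_left : IsSqInt k₁
  sqInt_right : IsSqInt k₂
  factor : ∀ᵐ g ∂haarL, ∀ h, α g h = ∫ w, k₁ g w * k₂ w h ∂haarL

end AffinePoincare

end

open MeasureTheory
open scoped ENNReal FourierTransform InnerProduct ComplexConjugate

noncomputable section

namespace AffinePoincare

set_option linter.unusedSectionVars false

/-! ### Hilbert–Schmidt operators between Hilbert spaces -/

section HilbertSchmidt

variable {H K L : Type} [NormedAddCommGroup H] [InnerProductSpace ℂ H] [CompleteSpace H]
  [NormedAddCommGroup K] [InnerProductSpace ℂ K] [CompleteSpace K]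
  [NormedAddCommGroup L] [InnerProductSpace ℂ L] [CompleteSpace L]
  {ι κ : Type*}

/-! Two facts carry the theorem: `T_σ` is the integral operator with kernel `(g, h) ↦ α(g)(h)`, and
an operator on `L²` is of trace class exactly when it is a product of two integral operators with
square integrable kernels.

For the first fact, the pairs `(a, ϑ)` act simply transitively on each cone, so `(a, ϑ, x) ↦ (x, a
Λ_{-ϑ} x)` turns functions on the group, after a partial Fourier transform in `b`, into kernels on
`C × C`. With the factor supplied by the Duflo–Moore operator this change of variables is unitary
(`isWeighted_cone`), and `f̂(π)` is the integral operator with the resulting kernel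
(`groupFourier_eq`). The four cones fill the plane up to a null set. Hence `f ↦ f̂` is a unitary map
of `L²` of the group onto the sum of the four Hilbert–Schmidt spaces (`sum_inner_fourierKer`,
`exists_fourierKer_eq`).

A Weyl operator whose symbol is built from a kernel `K` is the integral operator with the transposed
kernel divided by `2π` (`isWeyl_kerOp`). The kernel `K_{g,β}` is `2π/a` times the complex conjugate
of the Fourier kernel of `conj β`. The Weyl condition therefore says that `π(g)* D σ(g, π)` is `a⁻¹`
times the adjoint of the Fourier transform of `conj (α g)` (`hasWeylForm_iff`). Inserted into the
definition of `T_σ`, the representation drops out by unitarity, `Δ^{-1/2} = a` cancels `a⁻¹`, and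
Plancherel gives `(T_σ f)(g) = ⟨conj (α g), f⟩` (`HasFourierForm.pdo_eq`). Every admissible symbol
has such an `α`, and it is weakly continuous (`exists_hasFourierForm`).

The second fact combines `IsTraceClass.exists_comp`, `isTraceClass_comp` and `exists_kerOp_eq`. The
trace of the product is the integral of `k₁(g)(w) k₂(w)(g)` over both variables
(`hasSum_inner_kerOp_comp`). Since the factorization of `α(g)` holds at every `h`, it may be
evaluated at `h = g`, and this integral is that of `α(g)(g)`. -/

lemma tsum_enorm_inner_sq (b : HilbertBasis ι ℂ H) (x : H) :
    ∑' n, ‖inner ℂ (b n) x‖ₑ ^ 2 = ‖x‖ₑ ^ 2 := by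
  have h := b.hasSum_inner_mul_inner x x
  have h' : HasSum (fun n => ‖inner ℂ (b n) x‖ ^ 2) (‖x‖ ^ 2) := by
    rw [inner_self_eq_norm_sq_to_K] at h
    have h2 := Complex.hasSum_re h
    convert h2 using 1
    · ext n
      rw [← inner_conj_symm x (b n), mul_comm, Complex.mul_conj, Complex.normSq_eq_norm_sq]
      exact (Complex.ofReal_re _).symm
    · rw [← Complex.ofReal_re (‖x‖ ^ 2)]; push_cast; rfl
  have e : ∀ y : ℝ, 0 ≤ y → ENNReal.ofReal (y ^ 2) = ENNReal.ofReal y ^ 2 :=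
    fun y hy => ENNReal.ofReal_pow hy 2
  simp only [← ofReal_norm]
  rw [← e _ (norm_nonneg _), ← h'.tsum_eq, ENNReal.ofReal_tsum_of_nonneg (fun _ => by positivity)
    h'.summable]
  simp only [e _ (norm_nonneg _)]

/-- Both sides sum the squared matrix entries `|⟨c m, A (b n)⟩|²`, once by columns and once by rows.
With values in `ℝ≥0∞` the exchange needs no convergence. -/
lemma tsum_enorm_adjoint (A : H →L[ℂ] K) (b : HilbertBasis ι ℂ H) (c : HilbertBasis κ ℂ K) :
    ∑' n, ‖A (b n)‖ₑ ^ 2 = ∑' m, ‖A.adjoint (c m)‖ₑ ^ 2 := by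
  simp only [← tsum_enorm_inner_sq b, ← tsum_enorm_inner_sq c]
  rw [ENNReal.tsum_comm]
  refine tsum_congr fun m => tsum_congr fun n => ?_
  rw [ContinuousLinearMap.adjoint_inner_right, ← inner_conj_symm, RCLike.enorm_conj]

/-- The square of the Hilbert–Schmidt norm of an operator between two Hilbert spaces. -/
def hsNorm2 (A : H →L[ℂ] K) : ℝ≥0∞ := ∑' n, ‖A (chosenBasis H n)‖ₑ ^ 2

/-- Independence of the basis: both sums equal the same sum for the adjoint, which does not involve
the basis of `H`. -/
lemma hsNorm2_eq (A : H →L[ℂ] K) (b : HilbertBasis ι ℂ H) :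
    hsNorm2 A = ∑' n, ‖A (b n)‖ₑ ^ 2 := by
  rw [hsNorm2, tsum_enorm_adjoint A _ (chosenBasis K), tsum_enorm_adjoint A b (chosenBasis K)]

lemma isHilbertSchmidt_iff (A : H →L[ℂ] H) : IsHilbertSchmidt A ↔ hsNorm2 A < ∞ := Iff.rfl

lemma hsNorm2_adjoint (A : H →L[ℂ] K) : hsNorm2 A.adjoint = hsNorm2 A :=
  (tsum_enorm_adjoint A _ _).symm

lemma hsNorm2_comp_left (B : K →L[ℂ] L) (A : H →L[ℂ] K) :
    hsNorm2 (B ∘L A) ≤ ‖B‖ₑ ^ 2 * hsNorm2 A := by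
  rw [hsNorm2, hsNorm2, ← ENNReal.tsum_mul_left]
  refine ENNReal.tsum_le_tsum fun n => ?_
  rw [← mul_pow]
  gcongr
  exact B.le_opENorm _

lemma hsNorm2_comp_left_lt_top (B : K →L[ℂ] L) {A : H →L[ℂ] K} (hA : hsNorm2 A < ∞) :
    hsNorm2 (B ∘L A) < ∞ :=
  (hsNorm2_comp_left B A).trans_lt (ENNReal.mul_lt_top (by simp) hA)

lemma summable_sq_of_tsum_enorm {ι : Type*} {f : ι → ℂ} (h : ∑' n, ‖f n‖ₑ ^ 2 < ∞) :
    Summable fun n => ‖f n‖ ^ 2 := by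
  have := ENNReal.summable_toReal h.ne
  simpa using this

lemma summable_inner_sq {A : H →L[ℂ] K} (hA : hsNorm2 A < ∞)
    (b : HilbertBasis ι ℂ H) (c : HilbertBasis κ ℂ K) :
    Summable fun p : ι × κ => ‖inner ℂ (c p.2) (A (b p.1))‖ ^ 2 := by
  refine summable_sq_of_tsum_enorm ?_
  rw [ENNReal.tsum_prod (f := fun n m => ‖inner ℂ (c m) (A (b n))‖ₑ ^ 2)]
  simpa only [tsum_enorm_inner_sq, ← hsNorm2_eq] using hA

lemma summable_inner_mul_inner {A B : H →L[ℂ] K} (hA : hsNorm2 A < ∞) (hB : hsNorm2 B < ∞)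
    (b : HilbertBasis ι ℂ H) (c : HilbertBasis κ ℂ K) :
    Summable fun p : ι × κ => inner ℂ (A (b p.1)) (c p.2) * inner ℂ (c p.2) (B (b p.1)) := by
  refine Summable.of_norm_bounded ((summable_inner_sq hA b c).add (summable_inner_sq hB b c))
    fun p => ?_
  rw [norm_mul, norm_inner_symm]
  generalize ‖inner ℂ (c p.2) (A (b p.1))‖ = r
  generalize ‖inner ℂ (c p.2) (B (b p.1))‖ = t
  nlinarith [sq_nonneg (r - t), sq_nonneg r, sq_nonneg t]

/-- `∑ ⟨A eₙ, B eₙ⟩ = ∑ ⟨B* cₘ, A* cₘ⟩` for Hilbert–Schmidt operators. -/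
lemma exists_hasSum_inner_adjoint {A B : H →L[ℂ] K} (hA : hsNorm2 A < ∞) (hB : hsNorm2 B < ∞)
    (b : HilbertBasis ι ℂ H) (c : HilbertBasis κ ℂ K) :
    ∃ s : ℂ, HasSum (fun n => inner ℂ (A (b n)) (B (b n))) s ∧
      HasSum (fun m => inner ℂ (B.adjoint (c m)) (A.adjoint (c m))) s := by
  -- The two sums are iterated sums of one absolutely convergent double series.
  obtain ⟨s, hs⟩ := summable_inner_mul_inner hA hB b c
  have hs' : HasSum (fun q : κ × ι => inner ℂ (B.adjoint (c q.1)) (b q.2) *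
      inner ℂ (b q.2) (A.adjoint (c q.1))) s := by
    refine ((Equiv.prodComm κ ι).hasSum_iff.2 hs).congr_fun fun q => ?_
    simp only [Function.comp_apply, Equiv.prodComm_apply, Prod.fst_swap, Prod.snd_swap,
      ContinuousLinearMap.adjoint_inner_right, ContinuousLinearMap.adjoint_inner_left]
    ring
  exact ⟨s, hs.prod_fiberwise fun n => c.hasSum_inner_mul_inner (A (b n)) (B (b n)),
    hs'.prod_fiberwise fun m => b.hasSum_inner_mul_inner (B.adjoint (c m)) (A.adjoint (c m))⟩

end HilbertSchmidt

/-! ### Trace class operators -/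

section TraceClass

variable {H K L : Type} [NormedAddCommGroup H] [InnerProductSpace ℂ H] [CompleteSpace H]
  [NormedAddCommGroup K] [InnerProductSpace ℂ K] [CompleteSpace K]
  [NormedAddCommGroup L] [InnerProductSpace ℂ L] [CompleteSpace L]

/-- If `‖T x‖ ≤ ‖S x‖` for all `x`, then `T` factors through `S`. -/
lemma exists_comp_eq_of_norm_le (T : H →L[ℂ] L) (S : H →L[ℂ] K) (h : ∀ x, ‖T x‖ ≤ ‖S x‖) :
    ∃ V : K →L[ℂ] L, T = V ∘L S := by
  -- On the range of `S` the map `S x ↦ T x` is well defined and contractive. It extends by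
  -- continuity to the closure `U` and is then precomposed with the orthogonal projection onto `U`.
  let U : Submodule ℂ K := (LinearMap.range (S : H →ₗ[ℂ] K)).topologicalClosure
  have hmem : ∀ x, S x ∈ U := fun x => Submodule.le_topologicalClosure _ ⟨x, rfl⟩
  let e : H →ₗ[ℂ] U := (S : H →ₗ[ℂ] K).codRestrict U hmem
  have hd : DenseRange e := by
    rw [DenseRange, Subtype.dense_iff]
    intro y hy
    refine closure_mono ?_ hy
    rintro _ ⟨x, rfl⟩
    exact ⟨e x, ⟨x, rfl⟩, rfl⟩
  have hn : ∃ C, ∀ x, ‖(T : H →ₗ[ℂ] L) x‖ ≤ C * ‖e x‖ := ⟨1, fun x => by rw [one_mul]; exact h x⟩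
  have : CompleteSpace U := (Submodule.isClosed_topologicalClosure _).completeSpace_coe
  refine ⟨((T : H →ₗ[ℂ] L).extendOfNorm e) ∘L U.orthogonalProjectionOnto, ?_⟩
  ext x
  have e2 : U.orthogonalProjectionOnto (S x) = e x :=
    Submodule.orthogonalProjectionOnto_mem_subspace_eq_self (e x)
  rw [ContinuousLinearMap.comp_apply, ContinuousLinearMap.comp_apply, e2,
    LinearMap.extendOfNorm_eq hd hn]
  rfl

/-- `‖A x‖²` depends only on `A* A`, and `|T|² = T* T`. Through `exists_comp_eq_of_norm_le` this
replaces the polar decomposition, in both directions. -/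
lemma norm_abs_apply (T : H →L[ℂ] H) (x : H) : ‖CFC.abs T x‖ = ‖T x‖ := by
  have h1 : ∀ A : H →L[ℂ] H, ‖A x‖ ^ 2 = RCLike.re (inner ℂ x ((A.adjoint * A) x)) := by
    intro A
    rw [mul_apply_eq_comp, ContinuousLinearMap.adjoint_inner_right,
      inner_self_eq_norm_sq]
  have h2 : (CFC.abs T).adjoint * CFC.abs T = T.adjoint * T := by
    have h3 : (CFC.abs T).adjoint = CFC.abs T := (IsSelfAdjoint.of_nonneg (CFC.abs_nonneg T)).star_eq
    rw [h3, CFC.abs_mul_abs]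
    rfl
  rw [← pow_left_inj₀ (norm_nonneg _) (norm_nonneg _) two_ne_zero, h1, h1, h2]

/-- A trace class operator is a product of two Hilbert–Schmidt operators. -/
lemma IsTraceClass.exists_comp {T : H →L[ℂ] H} (hT : IsTraceClass T) :
    ∃ A B : H →L[ℂ] H, hsNorm2 A < ∞ ∧ hsNorm2 B < ∞ ∧ T = A ∘L B := by
  -- `R = |T|^{1/2}` is Hilbert–Schmidt because `‖R e‖² = ⟨e, |T| e⟩`. With `T = V |T|` the factors
  -- are `V R` and `R`.
  set R := CFC.sqrt (CFC.abs T) with hR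
  have hRR : R * R = CFC.abs T := CFC.sqrt_mul_sqrt_self _ (CFC.abs_nonneg T)
  have hRa : R.adjoint = R := (IsSelfAdjoint.of_nonneg (CFC.sqrt_nonneg _)).star_eq
  have hRh : hsNorm2 R < ∞ := by
    have e : ∀ x, RCLike.re (inner ℂ x (CFC.abs T x)) = ‖R x‖ ^ 2 := by
      intro x
      rw [← hRR, mul_apply_eq_comp]
      nth_rewrite 1 [← hRa]
      rw [ContinuousLinearMap.adjoint_inner_right, inner_self_eq_norm_sq]
    have h1 : Summable fun n => ‖R (chosenBasis H n)‖ ^ 2 := by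
      refine hT.congr fun n => ?_
      exact e _
    have h2 := h1.tsum_ofReal_lt_top
    refine lt_of_eq_of_lt (tsum_congr fun n => ?_) h2
    rw [ENNReal.ofReal_pow (norm_nonneg _), ofReal_norm]
  obtain ⟨V, hV⟩ := exists_comp_eq_of_norm_le T (CFC.abs T) fun x => (norm_abs_apply T x).ge
  refine ⟨V ∘L R, R, hsNorm2_comp_left_lt_top _ hRh, hRh, ?_⟩
  rw [hV, ← hRR]
  rfl

/-- A product of two Hilbert–Schmidt operators is of trace class. -/
lemma isTraceClass_comp {A : K →L[ℂ] H} {B : H →L[ℂ] K} (hA : hsNorm2 A < ∞) (hB : hsNorm2 B < ∞) :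
    IsTraceClass (A ∘L B) := by
  -- Writing `|A B| = V A B`, the diagonal entries of `|A B|` become `⟨(V A)* e, B e⟩`, a summable
  -- pairing of two Hilbert–Schmidt operators.
  obtain ⟨V, hV⟩ := exists_comp_eq_of_norm_le (CFC.abs (A ∘L B)) (A ∘L B)
    fun x => (norm_abs_apply _ x).le
  have h1 : hsNorm2 (V ∘L A).adjoint < ∞ := by
    rw [hsNorm2_adjoint]; exact hsNorm2_comp_left_lt_top _ hA
  obtain ⟨s, hs, -⟩ := exists_hasSum_inner_adjoint h1 hB (chosenBasis H) (chosenBasis K)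
  refine (Complex.hasSum_re hs).summable.congr fun n => ?_
  rw [hV, ContinuousLinearMap.adjoint_inner_left]
  rfl

end TraceClass

/-! ### Tensor products and integral kernels in `L²` -/

section Kernels

variable {X Y : Type} [MeasurableSpace X] [MeasurableSpace Y] {μ : Measure X} {ν : Measure Y}

instance separableSpace_L2 [SFinite μ] [MeasurableSpace.CountablyGenerated X] :
    TopologicalSpace.SeparableSpace (Lp ℂ 2 μ) :=
  have : Fact ((2 : ℝ≥0∞) ≠ ∞) := ⟨by simp⟩
  inferInstance

lemma eLpNorm_two_sq_eq (f : X → ℂ) : eLpNorm f 2 μ ^ 2 = ∫⁻ x, ‖f x‖ₑ ^ 2 ∂μ := by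
  rw [eLpNorm_eq_lintegral_rpow_enorm_toReal (by simp) (by simp), ← ENNReal.rpow_natCast,
    ← ENNReal.rpow_mul]
  simp

lemma inner_toLp {f g : X → ℂ} (hf : MemLp f 2 μ) (hg : MemLp g 2 μ) :
    inner ℂ (hf.toLp f) (hg.toLp g) = ∫ x, conj (f x) * g x ∂μ := by
  rw [L2.inner_def]
  refine integral_congr_ae ?_
  filter_upwards [hf.coeFn_toLp, hg.coeFn_toLp] with x h1 h2
  rw [h1, h2, RCLike.inner_apply, mul_comm]

lemma inner_eq_integral (f g : Lp ℂ 2 μ) : inner ℂ f g = ∫ x, conj (f x) * g x ∂μ := by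
  rw [L2.inner_def]
  exact integral_congr_ae (.of_forall fun x => by simp [RCLike.inner_apply, mul_comm])

lemma integrable_conj_mul {f g : X → ℂ} (hf : MemLp f 2 μ) (hg : MemLp g 2 μ) :
    Integrable (fun x => conj (f x) * g x) μ :=
  hf.star.integrable_mul hg

/-- Functions measurable on a product agree almost everywhere if almost all their sections do. -/
lemma ae_eq_prod_of_ae_ae [SFinite ν] {f g : X × Y → ℂ} (hf : AEStronglyMeasurable f (μ.prod ν))
    (hg : AEStronglyMeasurable g (μ.prod ν))
    (h : ∀ᵐ x ∂μ, ∀ᵐ y ∂ν, f (x, y) = g (x, y)) : f =ᵐ[μ.prod ν] g := by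
  have hm : AEMeasurable (fun p => ‖f p - g p‖ₑ) (μ.prod ν) := (hf.sub hg).enorm
  have h0 : ∫⁻ p, ‖f p - g p‖ₑ ∂(μ.prod ν) = 0 := by
    rw [lintegral_prod _ hm]
    refine (lintegral_congr_ae ?_).trans lintegral_zero
    filter_upwards [h] with x hx
    refine (lintegral_congr_ae ?_).trans lintegral_zero
    filter_upwards [hx] with y hy
    simp [hy]
  filter_upwards [(lintegral_eq_zero_iff' hm).1 h0] with p hp
  simpa [sub_eq_zero] using hp

/-! #### Complex conjugation -/

lemma inner_star_star (f g : Lp ℂ 2 μ) : inner ℂ (star f) (star g) = inner ℂ g f := by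
  rw [inner_eq_integral, inner_eq_integral]
  refine integral_congr_ae ?_
  filter_upwards [Lp.coeFn_star f, Lp.coeFn_star g] with x h1 h2
  simp [h1, h2, mul_comm]

lemma star_add_L2 (f g : Lp ℂ 2 μ) : star (f + g) = star f + star g := by
  apply Lp.ext
  filter_upwards [Lp.coeFn_star (f + g), Lp.coeFn_add f g, Lp.coeFn_add (star f) (star g),
    Lp.coeFn_star f, Lp.coeFn_star g] with x h1 h2 h3 h4 h5
  rw [h1, Pi.star_apply, h2, h3, Pi.add_apply, Pi.add_apply, h4, h5, star_add]
  rfl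

lemma star_smul_L2 (c : ℂ) (f : Lp ℂ 2 μ) : star (c • f) = conj c • star f := by
  apply Lp.ext
  filter_upwards [Lp.coeFn_star (c • f), Lp.coeFn_smul c f, Lp.coeFn_smul (conj c) (star f),
    Lp.coeFn_star f] with x h1 h2 h3 h4
  simp [h1, h2, h3, h4]

lemma norm_star_L2 (f : Lp ℂ 2 μ) : ‖star f‖ = ‖f‖ := by
  rw [← pow_left_inj₀ (norm_nonneg _) (norm_nonneg _) two_ne_zero,
    ← inner_self_eq_norm_sq (𝕜 := ℂ), ← inner_self_eq_norm_sq (𝕜 := ℂ), inner_star_star]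

lemma continuous_star_L2 : Continuous (star : Lp ℂ 2 μ → Lp ℂ 2 μ) := by
  refine (AddMonoidHomClass.isometry_of_norm
    (⟨⟨star, ?_⟩, star_add_L2⟩ : Lp ℂ 2 μ →+ Lp ℂ 2 μ) norm_star_L2).continuous
  simpa using star_smul_L2 (0 : ℂ) (0 : Lp ℂ 2 μ)

lemma eq_zero_of_basis {H : Type} [NormedAddCommGroup H] [InnerProductSpace ℂ H] {ι : Type*}
    (b : HilbertBasis ι ℂ H) {x : H} (h : ∀ i, inner ℂ (b i) x = 0) : x = 0 := by
  apply b.repr.injective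
  ext i
  rw [b.repr_apply_apply, h i]
  simp

/-- The complex conjugate of an orthonormal basis. -/
def starBasis {ι : Type*} (b : HilbertBasis ι ℂ (Lp ℂ 2 μ)) : HilbertBasis ι ℂ (Lp ℂ 2 μ) :=
  HilbertBasis.mkOfOrthogonalEqBot (v := fun i => star (b i))
    (by
      classical
      rw [orthonormal_iff_ite]
      intro i j
      rw [inner_star_star, orthonormal_iff_ite.1 b.orthonormal]
      simp only [eq_comm])
    (by
      rw [Submodule.eq_bot_iff]
      intro x hx
      rw [Submodule.mem_orthogonal] at hx
      have : star x = 0 := by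
        refine eq_zero_of_basis b fun i => ?_
        rw [← inner_star_star, star_star, ← inner_conj_symm, hx _ (Submodule.subset_span ⟨i, rfl⟩),
          map_zero]
      rw [← norm_eq_zero, ← norm_star_L2, this, norm_zero])

lemma starBasis_apply {ι : Type*} (b : HilbertBasis ι ℂ (Lp ℂ 2 μ)) (i : ι) :
    starBasis b i = star (b i) := by
  simp [starBasis]

/-! #### The tensor product of two functions -/

lemma memLp_mul_prod {u : X → ℂ} {v : Y → ℂ} (hu : MemLp u 2 μ) (hv : MemLp v 2 ν) [SFinite ν] :
    MemLp (fun p : X × Y => u p.1 * v p.2) 2 (μ.prod ν) := by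
  have hm : AEStronglyMeasurable (fun p : X × Y => u p.1 * v p.2) (μ.prod ν) :=
    hu.1.comp_fst.mul hv.1.comp_snd
  rw [memLp_two_iff_integrable_sq_norm hm]
  refine (((memLp_two_iff_integrable_sq_norm hu.1).1 hu).mul_prod
    ((memLp_two_iff_integrable_sq_norm hv.1).1 hv)).congr (.of_forall fun p => ?_)
  simp [mul_pow]

variable [SFinite μ] [SFinite ν]

/-- The function `u ⊗ v : (x, y) ↦ u x * v y`. -/
def tmul (u : Lp ℂ 2 μ) (v : Lp ℂ 2 ν) : Lp ℂ 2 (μ.prod ν) :=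
  (memLp_mul_prod (Lp.memLp u) (Lp.memLp v)).toLp (fun p : X × Y => u p.1 * v p.2)

lemma coeFn_tmul (u : Lp ℂ 2 μ) (v : Lp ℂ 2 ν) :
    tmul u v =ᵐ[μ.prod ν] fun p : X × Y => u p.1 * v p.2 :=
  MemLp.coeFn_toLp _

lemma inner_tmul_eq (u : Lp ℂ 2 μ) (v : Lp ℂ 2 ν) (k : Lp ℂ 2 (μ.prod ν)) :
    inner ℂ (tmul u v) k = ∫ p, conj (u p.1 * v p.2) * k p ∂(μ.prod ν) := by
  rw [inner_eq_integral]
  refine integral_congr_ae ?_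
  filter_upwards [coeFn_tmul u v] with p hp
  rw [hp]

lemma inner_tmul_tmul (u u' : Lp ℂ 2 μ) (v v' : Lp ℂ 2 ν) :
    inner ℂ (tmul u v) (tmul u' v') = inner ℂ u u' * inner ℂ v v' := by
  rw [inner_tmul_eq, inner_eq_integral u, inner_eq_integral v, ← integral_prod_mul]
  refine integral_congr_ae ?_
  filter_upwards [coeFn_tmul u' v'] with p hp
  rw [hp, map_mul]
  ring

lemma norm_tmul (u : Lp ℂ 2 μ) (v : Lp ℂ 2 ν) : ‖tmul u v‖ = ‖u‖ * ‖v‖ := by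
  rw [← pow_left_inj₀ (norm_nonneg _) (by positivity) two_ne_zero]
  have h := inner_tmul_tmul u u v v
  rw [inner_self_eq_norm_sq_to_K, inner_self_eq_norm_sq_to_K, inner_self_eq_norm_sq_to_K] at h
  rw [mul_pow]
  exact_mod_cast h

lemma ae_fst {p : X → Prop} (h : ∀ᵐ x ∂μ, p x) : ∀ᵐ z ∂(μ.prod ν), p z.1 :=
  Measure.quasiMeasurePreserving_fst.ae h

lemma ae_snd {p : Y → Prop} (h : ∀ᵐ y ∂ν, p y) : ∀ᵐ z ∂(μ.prod ν), p z.2 :=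
  Measure.quasiMeasurePreserving_snd.ae h

/-- The tensor product as a bounded bilinear map. -/
def tmulB : Lp ℂ 2 μ →L[ℂ] Lp ℂ 2 ν →L[ℂ] Lp ℂ 2 (μ.prod ν) :=
  LinearMap.mkContinuous₂
    (LinearMap.mk₂ ℂ tmul
      (by
        intro u u' v
        apply Lp.ext
        filter_upwards [coeFn_tmul (u + u') v, Lp.coeFn_add (tmul u v) (tmul u' v),
          coeFn_tmul u v, coeFn_tmul u' v, ae_fst (ν := ν) (Lp.coeFn_add u u')]
          with p h1 h2 h3 h4 h5
        rw [h1, h2, Pi.add_apply, h3, h4, h5, Pi.add_apply, add_mul])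
      (by
        intro c u v
        apply Lp.ext
        filter_upwards [coeFn_tmul (c • u) v, Lp.coeFn_smul c (tmul u v),
          coeFn_tmul u v, ae_fst (ν := ν) (Lp.coeFn_smul c u)] with p h1 h2 h3 h4
        rw [h1, h2, Pi.smul_apply, h3, h4, Pi.smul_apply, smul_eq_mul, smul_eq_mul, mul_assoc])
      (by
        intro u v v'
        apply Lp.ext
        filter_upwards [coeFn_tmul u (v + v'), Lp.coeFn_add (tmul u v) (tmul u v'),
          coeFn_tmul u v, coeFn_tmul u v', ae_snd (μ := μ) (Lp.coeFn_add v v')]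
          with p h1 h2 h3 h4 h5
        rw [h1, h2, Pi.add_apply, h3, h4, h5, Pi.add_apply, mul_add])
      (by
        intro c u v
        apply Lp.ext
        filter_upwards [coeFn_tmul u (c • v), Lp.coeFn_smul c (tmul u v),
          coeFn_tmul u v, ae_snd (μ := μ) (Lp.coeFn_smul c v)] with p h1 h2 h3 h4
        rw [h1, h2, Pi.smul_apply, h3, h4, Pi.smul_apply, smul_eq_mul, smul_eq_mul,
          mul_left_comm]))
    1 (fun u v => by
      rw [LinearMap.mk₂_apply, norm_tmul, one_mul])

@[simp] lemma tmulB_apply (u : Lp ℂ 2 μ) (v : Lp ℂ 2 ν) : tmulB u v = tmul u v := rfl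

/-- The partial inner product `x ↦ ⟨u, k(x, ·)⟩`, as an element of `L²`. -/
def partialInner (u : Lp ℂ 2 ν) (k : Lp ℂ 2 (μ.prod ν)) : Lp ℂ 2 μ := (tmulB.flip u).adjoint k

lemma inner_partialInner (v : Lp ℂ 2 μ) (u : Lp ℂ 2 ν) (k : Lp ℂ 2 (μ.prod ν)) :
    inner ℂ v (partialInner u k) = inner ℂ (tmul v u) k := by
  rw [partialInner, ContinuousLinearMap.adjoint_inner_right]
  rfl

/-! #### Sections -/

lemma lintegral_eLpNorm_sq {k : X × Y → ℂ} (hk : AEStronglyMeasurable k (μ.prod ν)) :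
    ∫⁻ x, eLpNorm (fun y => k (x, y)) 2 ν ^ 2 ∂μ = eLpNorm k 2 (μ.prod ν) ^ 2 := by
  simp only [eLpNorm_two_sq_eq]
  rw [lintegral_prod _ (hk.enorm.pow_const 2)]

lemma ae_memLp_section {k : X × Y → ℂ} (hk : MemLp k 2 (μ.prod ν)) :
    ∀ᵐ x ∂μ, MemLp (fun y => k (x, y)) 2 ν := by
  have h1 : ∫⁻ x, ∫⁻ y, ‖k (x, y)‖ₑ ^ 2 ∂ν ∂μ ≠ ∞ := by
    rw [← lintegral_prod _ (hk.1.enorm.pow_const 2), ← eLpNorm_two_sq_eq]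
    exact ENNReal.pow_ne_top hk.2.ne
  filter_upwards [hk.1.prodMk_left, ae_lt_top' (hk.1.enorm.pow_const 2).lintegral_prod_right' h1]
    with x hx1 hx2
  refine ⟨hx1, ?_⟩
  rw [← eLpNorm_two_sq_eq] at hx2
  exact (ENNReal.pow_lt_top_iff.1 hx2).resolve_right (by simp)

open Classical in
/-- The section `k(x, ·)` as an element of `L²` (zero if it is not square integrable). -/
def slice (ν : Measure Y) (k : X × Y → ℂ) (x : X) : Lp ℂ 2 ν :=
  if h : MemLp (fun y => k (x, y)) 2 ν then h.toLp _ else 0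

lemma slice_of_memLp {k : X × Y → ℂ} {x : X} (h : MemLp (fun y => k (x, y)) 2 ν) :
    slice ν k x = h.toLp _ := dif_pos h

lemma ae_coeFn_slice {k : X × Y → ℂ} (hk : MemLp k 2 (μ.prod ν)) :
    ∀ᵐ x ∂μ, slice ν k x =ᵐ[ν] fun y => k (x, y) := by
  filter_upwards [ae_memLp_section hk] with x hx
  rw [slice_of_memLp hx]
  exact hx.coeFn_toLp

lemma ae_slice_congr {k l : X × Y → ℂ} (h : k =ᵐ[μ.prod ν] l) :
    ∀ᵐ x ∂μ, slice ν k x = slice ν l x := by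
  filter_upwards [Measure.ae_ae_of_ae_prod h] with x hx
  replace hx : (fun y => k (x, y)) =ᵐ[ν] fun y => l (x, y) := hx
  by_cases hk : MemLp (fun y => k (x, y)) 2 ν
  · have hl : MemLp (fun y => l (x, y)) 2 ν := hk.ae_eq hx
    rw [slice_of_memLp hk, slice_of_memLp hl, MemLp.toLp_eq_toLp_iff]
    exact hx
  · have hl : ¬ MemLp (fun y => l (x, y)) 2 ν := fun hl => hk (hl.ae_eq hx.symm)
    rw [slice, slice, dif_neg hk, dif_neg hl]

/-- Cauchy–Schwarz in each section and Tonelli bound the norm. Measurability is obtained from the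
parametric integral that represents the inner product almost everywhere. -/
lemma memLp_inner_slice (u : Lp ℂ 2 ν) {k : X × Y → ℂ} (hk : MemLp k 2 (μ.prod ν)) :
    MemLp (fun x => inner ℂ u (slice ν k x)) 2 μ := by
  have hm : AEStronglyMeasurable (fun x => ∫ y, conj (u y) * k (x, y) ∂ν) μ :=
    ((Lp.aestronglyMeasurable u).comp_snd.star.mul hk.1).integral_prod_right'
  have he : (fun x => ∫ y, conj (u y) * k (x, y) ∂ν) =ᵐ[μ] fun x => inner ℂ u (slice ν k x) := by
    filter_upwards [ae_coeFn_slice hk] with x hx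
    rw [inner_eq_integral]
    refine integral_congr_ae ?_
    filter_upwards [hx] with y hy
    rw [hy]
  refine ⟨hm.congr he, ?_⟩
  have h2 : eLpNorm (fun x => inner ℂ u (slice ν k x)) 2 μ ^ 2 < ∞ := by
    rw [eLpNorm_two_sq_eq]
    calc ∫⁻ x, ‖inner ℂ u (slice ν k x)‖ₑ ^ 2 ∂μ
        ≤ ∫⁻ x, ‖u‖ₑ ^ 2 * eLpNorm (fun y => k (x, y)) 2 ν ^ 2 ∂μ := by
          refine lintegral_mono_ae ?_
          filter_upwards [ae_memLp_section hk] with x hx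
          have e : ‖slice ν k x‖ₑ = eLpNorm (fun y => k (x, y)) 2 ν := by
            rw [slice_of_memLp hx, Lp.enorm_toLp]
          rw [← mul_pow, ← e]
          gcongr
          rw [← ofReal_norm, ← ofReal_norm, ← ofReal_norm, ← ENNReal.ofReal_mul (norm_nonneg _)]
          exact ENNReal.ofReal_le_ofReal (norm_inner_le_norm _ _)
      _ = ‖u‖ₑ ^ 2 * eLpNorm k 2 (μ.prod ν) ^ 2 := by
          rw [lintegral_const_mul'' _ ?_, lintegral_eLpNorm_sq hk.1]
          simp only [eLpNorm_two_sq_eq]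
          exact (hk.1.enorm.pow_const 2).lintegral_prod_right'
      _ < ∞ := ENNReal.mul_lt_top (by simp) (ENNReal.pow_lt_top hk.2)
  exact (ENNReal.pow_lt_top_iff.1 h2).resolve_right (by simp)

/-- As an adjoint, `partialInner` has no pointwise formula by definition. Pairing with an arbitrary
`v` and applying Fubini supplies one. -/
lemma coeFn_partialInner (u : Lp ℂ 2 ν) (k : Lp ℂ 2 (μ.prod ν)) :
    partialInner u k =ᵐ[μ] fun x => inner ℂ u (slice ν k x) := by
  have hk := Lp.memLp k
  have h : partialInner u k = (memLp_inner_slice u hk).toLp _ := by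
    refine ext_inner_left ℂ fun v => ?_
    rw [inner_partialInner, inner_tmul_eq, inner_eq_integral, integral_prod]
    · refine integral_congr_ae ?_
      filter_upwards [(memLp_inner_slice u hk).coeFn_toLp, ae_coeFn_slice hk] with x h1 h2
      rw [h1, inner_eq_integral, ← integral_const_mul]
      refine integral_congr_ae ?_
      filter_upwards [h2] with y hy
      rw [hy, map_mul, mul_assoc]
    · exact integrable_conj_mul (memLp_mul_prod (Lp.memLp v) (Lp.memLp u)) hk
  rw [h]
  exact MemLp.coeFn_toLp _

variable [MeasurableSpace.CountablyGenerated Y]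

/-- The exceptional null set depends on `u`. Separability of `L²` leaves only countably many `u`,
and continuity of the inner product recovers the others. -/
lemma eq_of_ae_forall_inner {f g : X → Lp ℂ 2 ν}
    (h : ∀ u, (fun x => inner ℂ u (f x)) =ᵐ[μ] fun x => inner ℂ u (g x)) : f =ᵐ[μ] g := by
  have h1 : ∀ᵐ x ∂μ, ∀ n, inner ℂ (TopologicalSpace.denseSeq (Lp ℂ 2 ν) n) (f x) =
      inner ℂ (TopologicalSpace.denseSeq (Lp ℂ 2 ν) n) (g x) :=
    ae_all_iff.2 fun n => h _
  filter_upwards [h1] with x hx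
  have h2 := (TopologicalSpace.denseRange_denseSeq (Lp ℂ 2 ν)).equalizer
    (g := fun u => inner ℂ u (f x)) (h := fun u => inner ℂ u (g x)) (by fun_prop) (by fun_prop)
    (funext hx)
  exact ext_inner_left ℂ fun v => congrFun h2 v

/-- All partial inner products vanish, so almost every section is orthogonal to everything and hence
zero. -/
lemma tmul_total {k : Lp ℂ 2 (μ.prod ν)} (h : ∀ v u, inner ℂ (tmul v u) k = 0) : k = 0 := by
  have hk := Lp.memLp k
  have h1 : ∀ u, partialInner u k = 0 := fun u =>
    ext_inner_left ℂ fun v => by rw [inner_partialInner, h, inner_zero_right]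
  have h2 : slice ν k =ᵐ[μ] fun _ => 0 := by
    refine eq_of_ae_forall_inner fun u => ?_
    filter_upwards [coeFn_partialInner u k, Lp.coeFn_zero ℂ 2 μ] with x hx h0
    rw [← hx, h1, h0, inner_zero_right]
    rfl
  apply Lp.ext
  refine (ae_eq_prod_of_ae_ae hk.1 aestronglyMeasurable_const (g := fun _ => 0) ?_).trans
    (Lp.coeFn_zero ℂ 2 _).symm
  filter_upwards [h2, ae_coeFn_slice hk] with x h3 h4
  rw [h3] at h4
  filter_upwards [h4, Lp.coeFn_zero ℂ 2 ν] with y h5 h6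
  rw [← h5, h6]
  rfl

/-- The orthonormal basis `cₘ ⊗ eₙ` of `L²` of a product. -/
def tensorBasis {ι κ : Type*} (c : HilbertBasis ι ℂ (Lp ℂ 2 μ)) (e : HilbertBasis κ ℂ (Lp ℂ 2 ν)) :
    HilbertBasis (ι × κ) ℂ (Lp ℂ 2 (μ.prod ν)) :=
  HilbertBasis.mkOfOrthogonalEqBot (v := fun p => tmul (c p.1) (e p.2))
    (by
      classical
      rw [orthonormal_iff_ite]
      rintro ⟨i, i'⟩ ⟨j, j'⟩
      rw [inner_tmul_tmul, orthonormal_iff_ite.1 c.orthonormal, orthonormal_iff_ite.1 e.orthonormal]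
      simp only [Prod.mk.injEq]
      split_ifs <;> simp_all)
    (by
      rw [Submodule.eq_bot_iff]
      intro k hk
      rw [Submodule.mem_orthogonal] at hk
      -- The two bases are removed one at a time: completeness of `c` gives orthogonality to all `v
      -- ⊗ e n`, then completeness of `e` gives orthogonality to all `v ⊗ u`.
      have h1 : ∀ n, partialInner (e n) k = 0 := fun n => eq_zero_of_basis c fun m => by
        rw [inner_partialInner, hk _ (Submodule.subset_span ⟨(m, n), rfl⟩)]
      have h2 : ∀ v, (tmulB v).adjoint k = 0 := fun v => eq_zero_of_basis e fun n => by
        rw [ContinuousLinearMap.adjoint_inner_right, tmulB_apply, ← inner_partialInner, h1,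
          inner_zero_right]
      refine tmul_total fun v u => ?_
      rw [← tmulB_apply, ← ContinuousLinearMap.adjoint_inner_right, h2, inner_zero_right])

lemma tensorBasis_apply {ι κ : Type*} (c : HilbertBasis ι ℂ (Lp ℂ 2 μ))
    (e : HilbertBasis κ ℂ (Lp ℂ 2 ν)) (p : ι × κ) :
    tensorBasis c e p = tmul (c p.1) (e p.2) := by
  simp [tensorBasis]

/-! #### Integral operators -/

/-- The integral operator with kernel `k`. -/
def kerOp (k : Lp ℂ 2 (μ.prod ν)) : Lp ℂ 2 ν →L[ℂ] Lp ℂ 2 μ :=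
  LinearMap.mkContinuous
    { toFun := fun u => partialInner (star u) k
      map_add' := fun u u' => by
        refine ext_inner_left ℂ fun v => ?_
        rw [inner_add_right, inner_partialInner, inner_partialInner, inner_partialInner,
          star_add_L2, ← tmulB_apply, map_add, inner_add_left]
        rfl
      map_smul' := fun c u => by
        refine ext_inner_left ℂ fun v => ?_
        rw [inner_smul_right, inner_partialInner, inner_partialInner,
          star_smul_L2, ← tmulB_apply, map_smul, inner_smul_left]
        simp }
    ‖k‖ (by
      intro u
      -- The image is paired with itself; cancelling one factor of its norm leaves the operator
      -- bound `‖k‖ ‖u‖`.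
      have h : ‖inner ℂ (partialInner (star u) k) (partialInner (star u) k)‖ ≤
          ‖partialInner (star u) k‖ * (‖k‖ * ‖u‖) := by
        rw [inner_partialInner]
        refine (norm_inner_le_norm _ _).trans_eq ?_
        rw [norm_tmul, norm_star_L2]
        ring
      rw [inner_self_eq_norm_sq_to_K] at h
      simp only [LinearMap.coe_mk, AddHom.coe_mk]
      rcases (norm_nonneg (partialInner (star u) k)).eq_or_lt with h0 | h0
      · rw [← h0]; positivity
      · refine le_of_mul_le_mul_left ?_ h0
        simpa [sq] using h)

lemma kerOp_apply (k : Lp ℂ 2 (μ.prod ν)) (u : Lp ℂ 2 ν) :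
    kerOp k u = partialInner (star u) k := rfl

lemma inner_kerOp (k : Lp ℂ 2 (μ.prod ν)) (v : Lp ℂ 2 μ) (u : Lp ℂ 2 ν) :
    inner ℂ v (kerOp k u) = inner ℂ (tmul v (star u)) k := by
  rw [kerOp_apply, inner_partialInner]

lemma inner_kerOp_eq_integral (k : Lp ℂ 2 (μ.prod ν)) (v : Lp ℂ 2 μ) (u : Lp ℂ 2 ν) :
    inner ℂ v (kerOp k u) = ∫ p, conj (v p.1) * u p.2 * k p ∂(μ.prod ν) := by
  rw [inner_kerOp, inner_tmul_eq]
  refine integral_congr_ae ?_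
  filter_upwards [ae_snd (μ := μ) (Lp.coeFn_star u)] with p hp
  rw [hp]
  simp

lemma coeFn_kerOp (k : Lp ℂ 2 (μ.prod ν)) (u : Lp ℂ 2 ν) :
    kerOp k u =ᵐ[μ] fun x => ∫ y, k (x, y) * u y ∂ν := by
  filter_upwards [coeFn_partialInner (star u) k, ae_coeFn_slice (Lp.memLp k)] with x h1 h2
  rw [kerOp_apply, h1, inner_eq_integral]
  refine integral_congr_ae ?_
  filter_upwards [h2, Lp.coeFn_star u] with y h3 h4
  rw [h3, h4]
  simp [mul_comm]

lemma kerOp_smul (c : ℂ) (k : Lp ℂ 2 (μ.prod ν)) : kerOp (c • k) = c • kerOp k := by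
  ext1 u
  refine ext_inner_left ℂ fun v => ?_
  rw [_root_.smul_apply, inner_smul_right, inner_kerOp, inner_kerOp, inner_smul_right]

/-- The matrix entries `⟨c m, kerOp k (e n)⟩` are the coordinates of `k` in the basis `c m ⊗ conj (e
n)`, so this is Parseval. -/
lemma hsNorm2_kerOp (k : Lp ℂ 2 (μ.prod ν)) : hsNorm2 (kerOp k) = ‖k‖ₑ ^ 2 := by
  set c := chosenBasis (Lp ℂ 2 μ)
  set e := chosenBasis (Lp ℂ 2 ν)
  rw [hsNorm2, ← tsum_enorm_inner_sq (tensorBasis c (starBasis e)) k,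
    ENNReal.tsum_prod (f := fun m n => ‖inner ℂ (tensorBasis c (starBasis e) (m, n)) k‖ₑ ^ 2),
    ENNReal.tsum_comm]
  refine tsum_congr fun n => ?_
  rw [← tsum_enorm_inner_sq c]
  refine tsum_congr fun m => ?_
  rw [inner_kerOp, tensorBasis_apply, starBasis_apply]

lemma hsNorm2_kerOp_lt_top (k : Lp ℂ 2 (μ.prod ν)) : hsNorm2 (kerOp k) < ∞ := by
  rw [hsNorm2_kerOp]; simp

/-- The polarized form of `hsNorm2_kerOp`: Parseval for `k` and `l`, summed first over the basis of
the target. It identifies the Hilbert–Schmidt pairing of operators with the `L²` pairing of kernels.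
-/
lemma hasSum_inner_kerOp {κ : Type*} (k l : Lp ℂ 2 (μ.prod ν))
    (e : HilbertBasis κ ℂ (Lp ℂ 2 ν)) :
    HasSum (fun n => inner ℂ (kerOp k (e n)) (kerOp l (e n))) (inner ℂ k l) := by
  set c := chosenBasis (Lp ℂ 2 μ) with hc
  have h := (tensorBasis c (starBasis e)).hasSum_inner_mul_inner k l
  have h' : HasSum (fun q : κ × basisIndex (Lp ℂ 2 μ) => inner ℂ (kerOp k (e q.1)) (c q.2) *
      inner ℂ (c q.2) (kerOp l (e q.1))) (inner ℂ k l) := by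
    refine ((Equiv.prodComm κ (basisIndex (Lp ℂ 2 μ))).hasSum_iff.2 h).congr_fun fun q => ?_
    simp only [Function.comp_apply, Equiv.prodComm_apply, tensorBasis_apply, starBasis_apply,
      Prod.fst_swap, Prod.snd_swap]
    rw [inner_kerOp, ← inner_conj_symm, inner_kerOp, inner_conj_symm]
  exact h'.prod_fiberwise fun n => c.hasSum_inner_mul_inner (kerOp k (e n)) (kerOp l (e n))

/-- Every Hilbert–Schmidt operator between `L²` spaces is an integral operator. -/
lemma exists_kerOp_eq {A : Lp ℂ 2 ν →L[ℂ] Lp ℂ 2 μ} (hA : hsNorm2 A < ∞) :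
    ∃ k : Lp ℂ 2 (μ.prod ν), kerOp k = A := by
  set c := chosenBasis (Lp ℂ 2 μ) with hc
  set e := chosenBasis (Lp ℂ 2 ν) with he
  have hs : Memℓp (fun p : basisIndex (Lp ℂ 2 μ) × basisIndex (Lp ℂ 2 ν) =>
      inner ℂ (c p.1) (A (e p.2))) 2 := by
    refine memℓp_gen ?_
    have := (Equiv.prodComm _ _).summable_iff.2 (summable_inner_sq hA e c)
    simpa [Function.comp_def] using this
  -- The matrix entries of `A` are square summable, hence they are the coordinates of a kernel.
  set k := (tensorBasis c (starBasis e)).repr.symm ⟨_, hs⟩ with hk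
  refine ⟨k, ?_⟩
  have hd : Dense (Submodule.span ℂ (Set.range e) : Set (Lp ℂ 2 ν)) := by
    rw [Submodule.dense_iff_topologicalClosure_eq_top]
    exact e.dense_span
  refine ContinuousLinearMap.ext_on hd ?_
  rintro _ ⟨n, rfl⟩
  refine sub_eq_zero.1 (eq_zero_of_basis c fun m => ?_)
  have h1 := (tensorBasis c (starBasis e)).repr_apply_apply k (m, n)
  rw [hk, LinearIsometryEquiv.apply_symm_apply, ← hk, tensorBasis_apply, starBasis_apply] at h1
  rw [inner_sub_right, inner_kerOp, ← h1, sub_self]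

end Kernels

/-! ### Exchange of variables, adjoints of integral operators, and the unitary operators `1 ⊗ M`. -/

section Kernels

variable {X Y : Type} [MeasurableSpace X] [MeasurableSpace Y] {μ : Measure X} {ν : Measure Y}
  [SFinite μ] [SFinite ν]

/-- Exchange of the two variables. -/
def swapL2 (k : Lp ℂ 2 (μ.prod ν)) : Lp ℂ 2 (ν.prod μ) :=
  Lp.compMeasurePreserving Prod.swap Measure.measurePreserving_swap k

lemma coeFn_swapL2 (k : Lp ℂ 2 (μ.prod ν)) : swapL2 k =ᵐ[ν.prod μ] fun q => k q.swap :=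
  Lp.coeFn_compMeasurePreserving k Measure.measurePreserving_swap

lemma swapL2_swapL2 (k : Lp ℂ 2 (μ.prod ν)) : swapL2 (swapL2 k) = k := by
  apply Lp.ext
  filter_upwards [coeFn_swapL2 (swapL2 k),
    Measure.measurePreserving_swap.quasiMeasurePreserving.ae (coeFn_swapL2 k)] with p h1 h2
  rw [h1, h2, Prod.swap_swap]

lemma inner_swapL2 (k l : Lp ℂ 2 (μ.prod ν)) : inner ℂ (swapL2 k) (swapL2 l) = inner ℂ k l := by
  rw [inner_eq_integral, inner_eq_integral k, ← integral_prod_swap (fun p => conj (k p) * l p)]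
  refine integral_congr_ae ?_
  filter_upwards [coeFn_swapL2 k, coeFn_swapL2 l] with q h1 h2
  rw [h1, h2]

lemma inner_swapL2_left (k : Lp ℂ 2 (μ.prod ν)) (l : Lp ℂ 2 (ν.prod μ)) :
    inner ℂ (swapL2 k) l = inner ℂ k (swapL2 l) := by
  rw [← inner_swapL2 k, swapL2_swapL2]

lemma kerOp_adjoint [MeasurableSpace.CountablyGenerated X] [MeasurableSpace.CountablyGenerated Y]
    (k : Lp ℂ 2 (μ.prod ν)) : (kerOp k).adjoint = kerOp (star (swapL2 k)) := by
  ext1 v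
  refine ext_inner_left ℂ fun u => ?_
  rw [ContinuousLinearMap.adjoint_inner_right, ← inner_conj_symm, inner_kerOp_eq_integral,
    inner_kerOp_eq_integral, ← integral_prod_swap, ← integral_conj]
  refine integral_congr_ae ?_
  filter_upwards [Lp.coeFn_star (swapL2 k), coeFn_swapL2 k] with q h1 h2
  rw [h1, Pi.star_apply, h2]
  simp [mul_comm]

variable [MeasurableSpace.CountablyGenerated Y]

/-- The image of a Hilbert basis under a unitary operator. -/
def mapBasis {ι : Type*} (b : HilbertBasis ι ℂ (Lp ℂ 2 ν)) (M : Lp ℂ 2 ν ≃ₗᵢ[ℂ] Lp ℂ 2 ν) :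
    HilbertBasis ι ℂ (Lp ℂ 2 ν) :=
  HilbertBasis.ofRepr (M.symm.trans b.repr)

lemma mapBasis_apply {ι : Type*} (b : HilbertBasis ι ℂ (Lp ℂ 2 ν))
    (M : Lp ℂ 2 ν ≃ₗᵢ[ℂ] Lp ℂ 2 ν) (i : ι) : mapBasis b M i = M (b i) := by
  classical
  rw [← HilbertBasis.repr_symm_single, ← b.repr_symm_single]
  rfl

/-- The unitary operator `1 ⊗ M` on `L²` of a product, acting by `M` in the second variable. -/
def ampli (μ : Measure X) [SFinite μ] (M : Lp ℂ 2 ν ≃ₗᵢ[ℂ] Lp ℂ 2 ν) :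
    Lp ℂ 2 (μ.prod ν) ≃ₗᵢ[ℂ] Lp ℂ 2 (μ.prod ν) :=
  (tensorBasis (chosenBasis (Lp ℂ 2 μ)) (chosenBasis (Lp ℂ 2 ν))).repr.trans
    (tensorBasis (chosenBasis (Lp ℂ 2 μ)) (mapBasis (chosenBasis (Lp ℂ 2 ν)) M)).repr.symm

/-- `ampli` is defined by sending one chosen basis to another. Comparing coordinates shows that it
acts as `1 ⊗ M` on every tensor. -/
lemma ampli_tmul (M : Lp ℂ 2 ν ≃ₗᵢ[ℂ] Lp ℂ 2 ν) (v : Lp ℂ 2 μ) (u : Lp ℂ 2 ν) :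
    ampli μ M (tmul v u) = tmul v (M u) := by
  set c := chosenBasis (Lp ℂ 2 μ) with hc
  set e := chosenBasis (Lp ℂ 2 ν) with he
  apply (tensorBasis c (mapBasis e M)).repr.injective
  rw [ampli, LinearIsometryEquiv.trans_apply, LinearIsometryEquiv.apply_symm_apply]
  ext p
  rw [HilbertBasis.repr_apply_apply, HilbertBasis.repr_apply_apply, tensorBasis_apply,
    tensorBasis_apply, inner_tmul_tmul, inner_tmul_tmul, mapBasis_apply, M.inner_map_map]

lemma partialInner_ampli (M : Lp ℂ 2 ν ≃ₗᵢ[ℂ] Lp ℂ 2 ν) (u : Lp ℂ 2 ν) (k : Lp ℂ 2 (μ.prod ν)) :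
    partialInner u (ampli μ M k) = partialInner (M.symm u) k := by
  refine ext_inner_left ℂ fun v => ?_
  rw [inner_partialInner, inner_partialInner, ← (ampli μ M).inner_map_map _ k, ampli_tmul,
    M.apply_symm_apply]

/-- Inner products of sections are partial inner products, on which `1 ⊗ M` acts by moving `M` to
the other side. This makes `1 ⊗ M` a fibrewise operator, the form in which the partial Fourier
transform is given. -/
lemma slice_ampli (M : Lp ℂ 2 ν ≃ₗᵢ[ℂ] Lp ℂ 2 ν) (k : Lp ℂ 2 (μ.prod ν)) :
    ∀ᵐ x ∂μ, slice ν (ampli μ M k) x = M (slice ν k x) := by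
  refine eq_of_ae_forall_inner fun u => ?_
  filter_upwards [coeFn_partialInner u (ampli μ M k), coeFn_partialInner (M.symm u) k] with x h1 h2
  rw [← h1, partialInner_ampli, h2, ← M.inner_map_map, M.apply_symm_apply]

/-- `1 ⊗ M` is characterized by its action on sections. -/
lemma ae_eq_ampli (M : Lp ℂ 2 ν ≃ₗᵢ[ℂ] Lp ℂ 2 ν) {k : X × Y → ℂ} (hk : MemLp k 2 (μ.prod ν))
    {F : X × Y → ℂ} (hF : AEStronglyMeasurable F (μ.prod ν))
    (h : ∀ᵐ x ∂μ, (fun y => F (x, y)) =ᵐ[ν] M (slice ν k x)) :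
    F =ᵐ[μ.prod ν] ampli μ M (hk.toLp k) := by
  refine ae_eq_prod_of_ae_ae hF (Lp.aestronglyMeasurable _) ?_
  filter_upwards [h, slice_ampli M (hk.toLp k), ae_coeFn_slice (Lp.memLp (ampli μ M (hk.toLp k))),
    ae_slice_congr hk.coeFn_toLp] with x h1 h2 h3 h4
  rw [h2, h4] at h3
  exact h1.trans h3

end Kernels

/-! ### Weighted composition operators -/

section Weighted

variable {Z X : Type} [MeasurableSpace Z] [MeasurableSpace X] {ρ : Measure Z} {W : Measure X}

/-- `Ψ : Z → X` is invertible almost everywhere with inverse `Φ`, and maps the measure `w² ρ`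
to `W`. -/
structure IsWeighted (ρ : Measure Z) (W : Measure X) (Ψ : Z → X) (Φ : X → Z) (w : Z → ℝ) : Prop where
  measurable_map : Measurable Ψ
  measurable_inv : Measurable Φ
  measurable_weight : Measurable w
  pos : ∀ᵐ z ∂ρ, 0 < w z
  map_eq : Measure.map Ψ (ρ.withDensity fun z => ENNReal.ofReal (w z) ^ 2) = W
  left_inv : ∀ᵐ z ∂ρ, Φ (Ψ z) = z
  right_inv : ∀ᵐ x ∂W, Ψ (Φ x) = x

namespace IsWeighted

variable {Ψ : Z → X} {Φ : X → Z} {w : Z → ℝ} (h : IsWeighted ρ W Ψ Φ w)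
include h

lemma measurable_sq : Measurable fun z => ENNReal.ofReal (w z) ^ 2 :=
  h.measurable_weight.ennreal_ofReal.pow_const 2

lemma quasi : Measure.QuasiMeasurePreserving Ψ ρ W := by
  refine ⟨h.measurable_map, ?_⟩
  rw [← h.map_eq]
  refine Measure.AbsolutelyContinuous.map (withDensity_absolutelyContinuous'
    h.measurable_sq.aemeasurable ?_) h.measurable_map
  filter_upwards [h.pos] with z hz
  simpa using hz

lemma quasi_inv : Measure.QuasiMeasurePreserving Φ W ρ := by
  refine ⟨h.measurable_inv, ?_⟩
  have e : Measure.map Φ W = ρ.withDensity fun z => ENNReal.ofReal (w z) ^ 2 := by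
    rw [← h.map_eq, Measure.map_map h.measurable_inv h.measurable_map]
    refine (Measure.map_congr ?_).trans Measure.map_id
    exact withDensity_absolutelyContinuous ρ _ h.left_inv
  rw [e]
  exact withDensity_absolutelyContinuous ρ _

lemma eLpNorm_comp {G : X → ℂ} (hG : AEStronglyMeasurable G W) :
    eLpNorm (fun z => (w z : ℂ) * G (Ψ z)) 2 ρ = eLpNorm G 2 W := by
  refine (ENNReal.pow_right_strictMono two_ne_zero).injective ?_
  have hm : AEMeasurable (fun x => ‖G x‖ₑ ^ 2) W := hG.enorm.pow_const 2
  simp only [eLpNorm_two_sq_eq]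
  rw [← h.map_eq] at hm
  rw [← h.map_eq, lintegral_map' hm h.measurable_map.aemeasurable,
    lintegral_withDensity_eq_lintegral_mul₀ h.measurable_sq.aemeasurable]
  · refine lintegral_congr_ae ?_
    filter_upwards [h.pos] with z hz
    rw [enorm_mul, mul_pow, Pi.mul_apply, ← ofReal_norm (w z : ℂ), Complex.norm_real,
      Real.norm_of_nonneg hz.le]
  · exact ((hG.comp_quasiMeasurePreserving h.quasi).enorm).pow_const 2

lemma memLp_comp {G : X → ℂ} (hG : MemLp G 2 W) : MemLp (fun z => (w z : ℂ) * G (Ψ z)) 2 ρ :=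
  ⟨(Complex.measurable_ofReal.comp h.measurable_weight).aestronglyMeasurable.mul
    (hG.1.comp_quasiMeasurePreserving h.quasi), by rw [h.eLpNorm_comp hG.1]; exact hG.2⟩

lemma memLp_inv {F : Z → ℂ} (hF : MemLp F 2 ρ) :
    MemLp (fun x => (w (Φ x) : ℂ)⁻¹ * F (Φ x)) 2 W := by
  have hm : AEStronglyMeasurable (fun x => (w (Φ x) : ℂ)⁻¹ * F (Φ x)) W :=
    (Complex.measurable_ofReal.comp
      (h.measurable_weight.comp h.measurable_inv)).inv.aestronglyMeasurable.mul
      (hF.1.comp_quasiMeasurePreserving h.quasi_inv)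
  refine ⟨hm, ?_⟩
  rw [← h.eLpNorm_comp hm]
  refine (eLpNorm_congr_ae ?_).trans_lt hF.2
  filter_upwards [h.left_inv, h.pos] with z h1 h2
  rw [h1, mul_inv_cancel_left₀ (by exact_mod_cast h2.ne')]

/-- The function `w · G ∘ Ψ` in `L²`. -/
def comp (G : Lp ℂ 2 W) : Lp ℂ 2 ρ :=
  (h.memLp_comp (Lp.memLp G)).toLp fun z => (w z : ℂ) * G (Ψ z)

/-- The function `(w⁻¹ F) ∘ Φ` in `L²`. -/
def inv (F : Lp ℂ 2 ρ) : Lp ℂ 2 W :=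
  (h.memLp_inv (Lp.memLp F)).toLp fun x => (w (Φ x) : ℂ)⁻¹ * F (Φ x)

lemma coeFn_comp (G : Lp ℂ 2 W) : h.comp G =ᵐ[ρ] fun z => (w z : ℂ) * G (Ψ z) :=
  MemLp.coeFn_toLp _

lemma coeFn_inv (F : Lp ℂ 2 ρ) : h.inv F =ᵐ[W] fun x => (w (Φ x) : ℂ)⁻¹ * F (Φ x) :=
  MemLp.coeFn_toLp _

/-- The unitary operator `G ↦ w · G ∘ Ψ`. -/
def equiv : Lp ℂ 2 W ≃ₗᵢ[ℂ] Lp ℂ 2 ρ where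
  toFun G := h.comp G
  invFun F := h.inv F
  map_add' G G' := by
    refine Eq.trans ?_ (MemLp.toLp_add (h.memLp_comp (Lp.memLp G)) (h.memLp_comp (Lp.memLp G')))
    refine (MemLp.toLp_eq_toLp_iff _ _).2 ?_
    filter_upwards [h.quasi.ae (Lp.coeFn_add G G')] with z hz
    simp only [hz, Pi.add_apply]
    ring
  map_smul' c G := by
    refine Eq.trans ?_ (MemLp.toLp_const_smul c (h.memLp_comp (Lp.memLp G)))
    refine (MemLp.toLp_eq_toLp_iff _ _).2 ?_
    filter_upwards [h.quasi.ae (Lp.coeFn_smul c G)] with z hz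
    simp only [hz, Pi.smul_apply, smul_eq_mul]
    ring
  left_inv G := by
    apply Lp.ext
    filter_upwards [h.coeFn_inv (h.comp G),
      h.quasi_inv.ae (h.coeFn_comp G), h.right_inv, h.quasi_inv.ae h.pos]
      with x h1 h2 h3 h4
    rw [h1, h2, h3, inv_mul_cancel_left₀ (by exact_mod_cast h4.ne')]
  right_inv F := by
    apply Lp.ext
    filter_upwards [h.coeFn_comp (h.inv F),
      h.quasi.ae (h.coeFn_inv F), h.left_inv, h.pos] with z h1 h2 h3 h4
    rw [h1, h2, h3, mul_inv_cancel_left₀ (by exact_mod_cast h4.ne')]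
  norm_map' G := by
    change ‖h.comp G‖ = ‖G‖
    rw [comp, Lp.norm_toLp, h.eLpNorm_comp (Lp.aestronglyMeasurable G), Lp.norm_def]

lemma coeFn_equiv (G : Lp ℂ 2 W) : h.equiv G =ᵐ[ρ] fun z => (w z : ℂ) * G (Ψ z) :=
  h.coeFn_comp G

lemma coeFn_equiv_symm (F : Lp ℂ 2 ρ) :
    h.equiv.symm F =ᵐ[W] fun x => (w (Φ x) : ℂ)⁻¹ * F (Φ x) :=
  h.coeFn_inv F

end IsWeighted

end Weighted

/-! ### The Fourier transform on `L²` of the plane -/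

section Fourier

/-- On `L¹ ∩ L²` the Fourier transform is given by the Fourier integral. -/
lemma coeFn_fourier_toLp {f : Plane → ℂ} (hf : Integrable f) (hf2 : MemLp f 2 volume) :
    (𝓕 (hf2.toLp f) : L2Plane) =ᵐ[volume] 𝓕 f := by
  have hc : Continuous (𝓕 f) := VectorFourier.fourierIntegral_continuous
    Real.continuous_fourierChar continuous_inner hf
  -- Both functions are tested against compactly supported smooth `g`, regarded as Schwartz
  -- functions. The `L²` transform agrees with the distributional one, and the Fourier integral
  -- moves from `f` to `g` by Fubini.
  refine ae_eq_of_integral_contDiff_smul_eq ((Lp.memLp _).locallyIntegrable (by simp))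
    hc.locallyIntegrable fun g hg hgc => ?_
  have hg₁ : HasCompactSupport (Complex.ofRealCLM ∘ g) := hgc.comp_left rfl
  have hg₂ : ContDiff ℝ ((⊤ : ℕ∞) : WithTop ℕ∞) (Complex.ofRealCLM ∘ g) := by fun_prop
  set φ := hg₁.toSchwartzMap hg₂ with hφ
  have hφa : ∀ x, φ x = (g x : ℂ) := fun x => by simp [hφ]
  have h1 := congrArg (fun T => T φ) (Lp.fourier_toTemperedDistribution_eq (hf2.toLp f))
  simp only [TemperedDistribution.fourier_apply, Lp.toTemperedDistribution_apply] at h1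
  have h2 : ∫ x, 𝓕 (φ : Plane → ℂ) x • f x = ∫ x, φ x • 𝓕 f x := by
    simpa using! VectorFourier.integral_fourierIntegral_smul_eq_flip (L := innerₗ Plane)
      Real.continuous_fourierChar continuous_inner φ.integrable hf
  have h3 : ∫ x, (𝓕 φ) x • (hf2.toLp f) x = ∫ x, φ x • 𝓕 f x := by
    rw [← h2, ← SchwartzMap.fourier_coe]
    refine integral_congr_ae ?_
    filter_upwards [hf2.coeFn_toLp] with x hx
    rw [hx]
  rw [h1] at h3
  simpa [hφa] using h3

/-- The linear map `(x₁, x₂) ↦ (s x₁, t x₂)`. -/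
def scaleMap (s t : ℝ) : Plane →ₗ[ℝ] Plane := Matrix.toEuclideanLin !![s, 0; 0, t]

lemma scaleMap_apply (s t : ℝ) (x : Plane) : scaleMap s t x = !₂[s * x 0, t * x 1] := by
  ext k
  fin_cases k <;> simp [scaleMap, Matrix.toLpLin_apply, dotProduct, Fin.sum_univ_two]

lemma det_scaleMap (s t : ℝ) : LinearMap.det (scaleMap s t) = s * t := by
  rw [scaleMap, Matrix.toEuclideanLin, Matrix.toLpLin_eq_toLin, LinearMap.det_toLin,
    Matrix.det_fin_two_of]
  ring

lemma measurable_scaleMap (s t : ℝ) : Measurable (scaleMap s t) :=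
  (LinearMap.continuous_of_finiteDimensional _).measurable

lemma isWeighted_scaleMap {s t c : ℝ} (hc : 0 < c) (hst : |s * t| = c ^ 2) :
    IsWeighted (volume : Measure Plane) volume (scaleMap s t) (scaleMap s⁻¹ t⁻¹) fun _ => c := by
  have h0 : s * t ≠ 0 := by rw [← abs_pos, hst]; positivity
  have hs : s ≠ 0 := left_ne_zero_of_mul h0
  have ht : t ≠ 0 := right_ne_zero_of_mul h0
  refine ⟨measurable_scaleMap _ _, measurable_scaleMap _ _, measurable_const,
    .of_forall fun _ => hc, ?_, .of_forall fun x => ?_, .of_forall fun x => ?_⟩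
  · rw [withDensity_const, Measure.map_smul,
      Measure.map_linearMap_addHaar_eq_smul_addHaar _ (by rwa [det_scaleMap]), det_scaleMap,
      smul_smul, abs_inv, hst, ← ENNReal.ofReal_pow hc.le, ← ENNReal.ofReal_mul (by positivity),
      mul_inv_cancel₀ (by positivity), ENNReal.ofReal_one, one_smul]
  · ext k; fin_cases k <;> simp [scaleMap_apply, hs, ht]
  · ext k; fin_cases k <;> simp [scaleMap_apply, hs, ht]

lemma abs_two_pi_inv_sq : |(2 * Real.pi)⁻¹ * -(2 * Real.pi)⁻¹| = ((2 * Real.pi)⁻¹) ^ 2 := by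
  rw [mul_neg, abs_neg, abs_of_nonneg (by positivity), sq]

/-- The inverse Minkowski–Fourier transform as a unitary operator. -/
def minkU : L2Plane ≃ₗᵢ[ℂ] L2Plane :=
  (Lp.fourierTransformₗᵢ Plane ℂ).trans
    (isWeighted_scaleMap (by positivity) abs_two_pi_inv_sq).equiv

/-- The map `(x₁, x₂) ↦ (x₁/2π, -x₂/2π)` has Jacobian of modulus `(2π)⁻²`, so the weight that makes
composition with it unitary is exactly the prefactor `(2π)⁻¹`. -/
lemma coeFn_minkU (φ : L2Plane) : minkU φ =ᵐ[volume] minkFourierInv φ := by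
  filter_upwards [(isWeighted_scaleMap (by positivity) abs_two_pi_inv_sq).coeFn_equiv
    (𝓕 φ : L2Plane)] with x hx
  refine hx.trans ?_
  rw [minkFourierInv, scaleMap_apply]
  push_cast
  congr 3
  ext k
  fin_cases k <;> simp <;> ring

/-- The inverse Minkowski–Fourier integral. -/
def minkInt (u : Plane → ℂ) (x : Plane) : ℂ :=
  (2 * Real.pi : ℂ)⁻¹ * ∫ ξ : Plane, Complex.exp (-(Complex.I * (mink ξ x : ℂ))) * u ξ

lemma coeFn_minkU_toLp {u : Plane → ℂ} (hu : Integrable u) (hu2 : MemLp u 2 volume) :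
    minkU (hu2.toLp u) =ᵐ[volume] minkInt u := by
  have hq := (isWeighted_scaleMap (by positivity) abs_two_pi_inv_sq).quasi
  filter_upwards [(isWeighted_scaleMap (by positivity) abs_two_pi_inv_sq).coeFn_equiv
    (𝓕 (hu2.toLp u) : L2Plane), hq.ae (coeFn_fourier_toLp hu hu2)] with x h1 h2
  refine h1.trans ?_
  rw [h2, Real.fourier_eq', minkInt]
  push_cast
  congr 1
  refine integral_congr_ae (.of_forall fun ξ => ?_)
  have e : -2 * Real.pi * inner ℝ ξ (scaleMap (2 * Real.pi)⁻¹ (-(2 * Real.pi)⁻¹) x) =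
      -mink ξ x := by
    have hp : Real.pi ≠ 0 := Real.pi_ne_zero
    simp [scaleMap_apply, PiLp.inner_apply, Fin.sum_univ_two, mink]
    field_simp
    ring
  have e' := congrArg (fun r : ℝ => (r : ℂ)) e
  push_cast at e'
  simp only [smul_eq_mul]
  rw [e', neg_mul, mul_comm Complex.I]

/-- The bilinear Minkowski form. -/
def minkB : Plane →ₗ[ℝ] Plane →ₗ[ℝ] ℝ :=
  LinearMap.mk₂ ℝ (fun x y => (2 * Real.pi)⁻¹ * mink x y)
    (fun x x' y => by simp [mink]; ring) (fun c x y => by simp [mink]; ring)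
    (fun x y y' => by simp [mink]; ring) (fun c x y => by simp [mink]; ring)

/-- The factor `(2π)⁻¹` inside `minkB` compensates for the `2π` in the character `Real.fourierChar`.
-/
lemma minkInt_eq (u : Plane → ℂ) (x : Plane) : minkInt u x =
    (2 * Real.pi : ℂ)⁻¹ * VectorFourier.fourierIntegral Real.fourierChar volume minkB u x := by
  rw [minkInt, VectorFourier.fourierIntegral]
  congr 1
  refine integral_congr_ae (.of_forall fun ξ => ?_)
  have hp : (Real.pi : ℂ) ≠ 0 := by exact_mod_cast Real.pi_ne_zero
  simp only [Circle.smul_def, Real.fourierChar_apply, smul_eq_mul, minkB, LinearMap.mk₂_apply]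
  congr 2
  push_cast
  field_simp

lemma continuous_minkB : Continuous fun p : Plane × Plane => minkB p.1 p.2 := by
  simp only [minkB, LinearMap.mk₂_apply, mink]
  fun_prop

/-- The kernel `e^{-i⟨ξ; x⟩}` is symmetric in `x` and `ξ`, so the transform is symmetric for the
bilinear pairing `∫ f g`. -/
lemma minkU_schwartz_symm (f g : SchwartzMap Plane ℂ) :
    inner ℂ (star (f.toLp 2 volume)) (minkU (g.toLp 2 volume)) =
      inner ℂ (star (minkU (f.toLp 2 volume))) (g.toLp 2 volume) := by
  have key : ∫ x, minkInt f x * g x = ∫ x, f x * minkInt g x := by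
    simp only [minkInt_eq]
    have h := VectorFourier.integral_fourierIntegral_smul_eq_flip (L := minkB)
      Real.continuous_fourierChar continuous_minkB f.integrable (μ := volume) (ν := volume)
      g.integrable
    have hflip : minkB.flip = minkB := by
      ext x y
      simp [minkB, mink, mul_comm]
    rw [hflip] at h
    simp only [smul_eq_mul] at h
    simp only [mul_assoc, mul_left_comm (f _)]
    rw [integral_const_mul, integral_const_mul, h]
  rw [inner_eq_integral, inner_eq_integral]
  refine Eq.trans ?_ (key.symm.trans ?_)
  · refine integral_congr_ae ?_
    filter_upwards [Lp.coeFn_star (f.toLp 2 volume), f.coeFn_toLp 2 volume,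
      coeFn_minkU_toLp g.integrable (g.memLp 2 volume)] with x h1 h2 h3
    rw [h1, Pi.star_apply, h2, ← h3]
    simp [SchwartzMap.toLp]
  · refine integral_congr_ae ?_
    filter_upwards [Lp.coeFn_star (minkU (f.toLp 2 volume)), g.coeFn_toLp 2 volume,
      coeFn_minkU_toLp f.integrable (f.memLp 2 volume)] with x h1 h2 h3
    rw [h1, Pi.star_apply, h2, ← h3]
    simp [SchwartzMap.toLp]

lemma inner_star_minkU (u v : L2Plane) :
    inner ℂ (star u) (minkU v) = inner ℂ (star (minkU u)) v := by
  have hd : DenseRange fun f : SchwartzMap Plane ℂ => f.toLp 2 (volume : Measure Plane) :=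
    SchwartzMap.denseRange_toLpCLM (F := ℂ) (E := Plane) (p := 2) (μ := volume) (by simp)
  have hs : Continuous (star : L2Plane → L2Plane) := continuous_star_L2
  have hM : Continuous (minkU : L2Plane → L2Plane) := minkU.continuous
  refine hd.induction_on₂ (p := fun u v => inner ℂ (star u) (minkU v) = inner ℂ (star (minkU u)) v)
    ?_ minkU_schwartz_symm u v
  exact isClosed_eq ((hs.comp continuous_fst).inner (hM.comp continuous_snd))
    ((hs.comp (hM.comp continuous_fst)).inner continuous_snd)

/-- A unitary that is symmetric for the bilinear pairing has as inverse its conjugate by complex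
conjugation. This relates the forward and inverse transforms, and it is why `star` accompanies `α`
from here on. -/
lemma minkU_symm_star (u : L2Plane) : minkU.symm (star u) = star (minkU u) := by
  refine ext_inner_right ℂ fun v => ?_
  rw [← inner_star_minkU, ← minkU.inner_map_map, minkU.apply_symm_apply]

end Fourier

/-! ### Hyperbolic polar coordinates on the cones -/

section Polar

instance sigmaFinite_comap_Ioi :
    SigmaFinite ((volume : Measure ℝ).comap (Subtype.val : Set.Ioi (0 : ℝ) → ℝ)) := by
  refine SigmaFinite.of_map _ measurable_subtype_coe.aemeasurable ?_
  rw [(MeasurableEmbedding.subtype_coe measurableSet_Ioi).map_comap]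
  infer_instance

instance sFinite_haarA : SFinite haarA := by
  unfold haarA; infer_instance

instance sFinite_haarL : SFinite haarL := by
  unfold haarL; infer_instance

/-- Hyperbolic polar coordinates `(a, ϑ) ↦ a Λ_{-ϑ} x`. -/
def hypPolar (x p : Plane) : Plane :=
  !₂[p 0 * (Real.cosh (p 1) * x 0 - Real.sinh (p 1) * x 1),
    p 0 * (Real.cosh (p 1) * x 1 - Real.sinh (p 1) * x 0)]

lemma hypPolar_eq_act (x : Plane) (g : Grp) :
    hypPolar x !₂[dilPar g, g.2.2] = act g x := by
  ext k
  fin_cases k <;> simp [hypPolar, act_zero_apply, act_one_apply]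

/-- The Jacobian matrix of `hypPolar`. -/
def hypPolarMat (x p : Plane) : Matrix (Fin 2) (Fin 2) ℝ :=
  !![Real.cosh (p 1) * x 0 - Real.sinh (p 1) * x 1,
      p 0 * (Real.sinh (p 1) * x 0 - Real.cosh (p 1) * x 1);
    Real.cosh (p 1) * x 1 - Real.sinh (p 1) * x 0,
      p 0 * (Real.sinh (p 1) * x 1 - Real.cosh (p 1) * x 0)]

/-- The derivative of `hypPolar`. -/
def hypPolarDeriv (x p : Plane) : Plane →L[ℝ] Plane :=
  LinearMap.toContinuousLinearMap (Matrix.toEuclideanLin (hypPolarMat x p))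

lemma hasFDerivAt_hypPolar (x p : Plane) :
    HasFDerivAt (hypPolar x) (hypPolarDeriv x p) p := by
  rw [← hasFDerivWithinAt_univ, hasFDerivWithinAt_euclidean]
  have h0 : HasFDerivAt (fun p : Plane => p 0) (EuclideanSpace.proj (𝕜 := ℝ) (0 : Fin 2)) p :=
    (EuclideanSpace.proj (𝕜 := ℝ) (0 : Fin 2)).hasFDerivAt
  have h1 : HasFDerivAt (fun p : Plane => p 1) (EuclideanSpace.proj (𝕜 := ℝ) (1 : Fin 2)) p :=
    (EuclideanSpace.proj (𝕜 := ℝ) (1 : Fin 2)).hasFDerivAt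
  have key : ∀ r s : ℝ, HasFDerivAt
      (fun p : Plane => p 0 * (Real.cosh (p 1) * r - Real.sinh (p 1) * s)) _ p := fun r s =>
    h0.mul ((h1.cosh.mul_const r).sub (h1.sinh.mul_const s))
  intro i
  rw [hasFDerivWithinAt_univ]
  fin_cases i
  · refine (key (x 0) (x 1)).congr_fderiv ?_
    ext v
    simp [hypPolarDeriv, hypPolarMat, Matrix.toLpLin_apply, dotProduct, Fin.sum_univ_two]
    ring
  · refine (key (x 1) (x 0)).congr_fderiv ?_
    ext v
    simp [hypPolarDeriv, hypPolarMat, Matrix.toLpLin_apply, dotProduct, Fin.sum_univ_two]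
    ring

lemma det_hypPolarDeriv (x p : Plane) : (hypPolarDeriv x p).det = -(p 0 * mink x x) := by
  have h : LinearMap.det (Matrix.toEuclideanLin (hypPolarMat x p)) = (hypPolarMat x p).det := by
    rw [Matrix.toEuclideanLin, Matrix.toLpLin_eq_toLin, LinearMap.det_toLin]
  refine Eq.trans h ?_
  rw [hypPolarMat, Matrix.det_fin_two_of]
  have := Real.cosh_sq (p 1)
  unfold mink
  linear_combination (-(p 0 * (x 0 ^ 2 - x 1 ^ 2))) * this

lemma mink_act (g : Grp) (x : Plane) : mink (act g x) (act g x) = dilPar g ^ 2 * mink x x := by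
  have := Real.cosh_sq g.2.2
  simp only [mink, act_zero_apply, act_one_apply]
  linear_combination (dilPar g ^ 2 * (x 0 ^ 2 - x 1 ^ 2)) * this

lemma mink_self_ne_zero {i j : Fin 2} {x : Plane} (hx : x ∈ cone i j) : mink x x ≠ 0 := by
  obtain ⟨h1, -⟩ := hx
  fin_cases j <;> simp at h1 <;> unfold mink <;> nlinarith

lemma dilOf_act (g : Grp) {x : Plane} (hx : mink x x ≠ 0) : dilOf x (act g x) = dilPar g := by
  rw [dilOf, mink_act, mul_div_assoc, div_self hx, mul_one, Real.sqrt_sq (dilPar_pos g).le]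

lemma angleOf_act (g : Grp) {x : Plane} (hx : mink x x ≠ 0) : angleOf x (act g x) = g.2.2 := by
  have ha := (dilPar_pos g).ne'
  rw [angleOf, dilOf_act g hx]
  have e : (x 1 * act g x 0 - x 0 * act g x 1) / (dilPar g * mink x x) = Real.sinh g.2.2 := by
    rw [act_zero_apply, act_one_apply, div_eq_iff (mul_ne_zero ha hx)]
    unfold mink
    ring
  rw [e, Real.arsinh_sinh]

/-- The group element `(0, q)`. -/
def ofA (q : Set.Ioi (0 : ℝ) × ℝ) : Grp := (0, q)

lemma image_hypPolar {i j : Fin 2} {x : Plane} (hx : x ∈ cone i j) :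
    hypPolar x '' {p | 0 < p 0} = cone i j := by
  ext y
  constructor
  · rintro ⟨p, hp, rfl⟩
    have h := act_mem_cone (0, ⟨p 0, hp⟩, p 1) i j hx
    rw [← hypPolar_eq_act] at h
    convert h using 2
    ext k
    fin_cases k <;> simp [dilPar]
  · intro hy
    have h : SameCone x y := ⟨i, j, hx, hy⟩
    refine ⟨!₂[dilPar (transport h), (transport h).2.2], ?_, ?_⟩
    · simpa using dilPar_pos (transport h)
    · rw [hypPolar_eq_act, act_transport]

/-- The functions `dilOf x` and `angleOf x` recover both coordinates from the image point. -/
lemma injOn_hypPolar {x : Plane} (hx : mink x x ≠ 0) :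
    Set.InjOn (hypPolar x) {p | 0 < p 0} := by
  have key : ∀ p : Plane, 0 < p 0 → dilOf x (hypPolar x p) = p 0 ∧
      angleOf x (hypPolar x p) = p 1 := by
    intro p hp
    have e : hypPolar x p = act (0, ⟨p 0, hp⟩, p 1) x := by
      rw [← hypPolar_eq_act]
      congr 1
      ext k
      fin_cases k <;> simp [dilPar]
    rw [e, dilOf_act _ hx, angleOf_act _ hx]
    exact ⟨rfl, rfl⟩
  intro p hp q hq h
  ext k
  fin_cases k
  · exact (key p hp).1.symm.trans ((congrArg (dilOf x) h).trans (key q hq).1)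
  · exact (key p hp).2.symm.trans ((congrArg (angleOf x) h).trans (key q hq).2)

lemma measurePreserving_mkPlane :
    MeasurePreserving (fun p : ℝ × ℝ => (!₂[p.1, p.2] : Plane)) volume volume := by
  have h := ((EuclideanSpace.volume_preserving_symm_measurableEquiv_toLp (Fin 2)).symm).comp
    ((volume_preserving_finTwoArrow ℝ).symm)
  have e : (fun p : ℝ × ℝ => (!₂[p.1, p.2] : Plane)) =
      (MeasurableEquiv.toLp 2 (Fin 2 → ℝ)).symm.symm ∘ MeasurableEquiv.finTwoArrow.symm := by
    funext p
    ext k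
    fin_cases k <;> rfl
  rw [e]
  exact h

/-- Integration over a cone in hyperbolic polar coordinates. -/
lemma lintegral_cone {i j : Fin 2} {x : Plane} (hx : x ∈ cone i j) {H : Plane → ℝ≥0∞}
    (hH : Measurable H) :
    ∫⁻ q, ENNReal.ofReal ((q.1 : ℝ) ^ 2 * √|mink x x|) ^ 2 * H (act (ofA q) x) ∂haarA =
      ∫⁻ ξ in cone i j, H ξ := by
  have hcont : Continuous (hypPolar x) :=
    continuous_iff_continuousAt.2 fun p => (hasFDerivAt_hypPolar x p).continuousAt
  have hpos : MeasurableSet {p : Plane | 0 < p 0} :=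
    (isOpen_lt continuous_const (by fun_prop)).measurableSet
  -- The Jacobian `a |⟨x; x⟩|` of the polar map equals the squared weight `a⁴ |⟨x; x⟩|` times the
  -- density `a⁻³` of `haarA`.
  set G : Plane → ℝ≥0∞ := fun p => ENNReal.ofReal (p 0 * |mink x x|) * H (hypPolar x p) with hG
  have hGm : Measurable G := by
    refine Measurable.mul ?_ (hH.comp hcont.measurable)
    exact Measurable.ennreal_ofReal (by fun_prop)
  have e1 : ∫⁻ ξ in cone i j, H ξ = ∫⁻ p in {p : Plane | 0 < p 0}, G p := by
    rw [← image_hypPolar hx, lintegral_image_eq_lintegral_abs_det_fderiv_mul volume hpos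
      (fun p _ => (hasFDerivAt_hypPolar x p).hasFDerivWithinAt) (injOn_hypPolar
        (mink_self_ne_zero hx))]
    refine setLIntegral_congr_fun hpos fun p hp => ?_
    simp only [hG]
    rw [det_hypPolarDeriv, abs_neg, abs_mul, abs_of_pos (show 0 < p 0 from hp)]
  have e2 : ∫⁻ p in {p : Plane | 0 < p 0}, G p =
      ∫⁻ a in Set.Ioi (0 : ℝ), ∫⁻ t : ℝ, G !₂[a, t] := by
    have hind : Measurable ({p : Plane | 0 < p 0}.indicator G) := hGm.indicator hpos
    rw [← lintegral_indicator hpos, ← measurePreserving_mkPlane.lintegral_comp hind,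
      Measure.volume_eq_prod,
      lintegral_prod (fun p : ℝ × ℝ => {p : Plane | 0 < p 0}.indicator G !₂[p.1, p.2])
        (hind.comp measurePreserving_mkPlane.measurable).aemeasurable,
      ← lintegral_indicator measurableSet_Ioi]
    refine lintegral_congr fun a => ?_
    by_cases ha : 0 < a
    · simp [Set.indicator, ha]
    · simp [Set.indicator, ha]
  have hm1 : Measurable fun q : Set.Ioi (0 : ℝ) × ℝ =>
      ENNReal.ofReal ((q.1 : ℝ) ^ 2 * √|mink x x|) ^ 2 * H (act (ofA q) x) := by
    refine Measurable.mul (Measurable.pow_const (Measurable.ennreal_ofReal (by fun_prop)) 2)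
      (hH.comp ?_)
    have e : (fun q : Set.Ioi (0 : ℝ) × ℝ => act (ofA q) x) =
        fun q : Set.Ioi (0 : ℝ) × ℝ => hypPolar x !₂[(q.1 : ℝ), q.2] := by
      funext q
      exact (hypPolar_eq_act x (ofA q)).symm
    rw [e]
    exact hcont.measurable.comp (measurePreserving_mkPlane.measurable.comp
      ((measurable_subtype_coe.comp measurable_fst).prodMk measurable_snd))
  have hm2 : Measurable fun q : Set.Ioi (0 : ℝ) × ℝ => ENNReal.ofReal (1 / (q.1 : ℝ) ^ 3) :=
    Measurable.ennreal_ofReal (by fun_prop)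
  have hm3 : Measurable fun p : ℝ × ℝ => G !₂[p.1, p.2] :=
    hGm.comp measurePreserving_mkPlane.measurable
  rw [e1, e2, haarA, lintegral_withDensity_eq_lintegral_mul _ hm2 hm1,
    lintegral_prod _ (hm2.mul hm1).aemeasurable, ← lintegral_subtype_comap measurableSet_Ioi]
  refine lintegral_congr fun a => lintegral_congr fun t => ?_
  have ha : (0 : ℝ) < a := a.2
  have e3 : act (ofA (a, t)) x = hypPolar x !₂[(a : ℝ), t] :=
    (hypPolar_eq_act x (ofA (a, t))).symm
  simp only [hG, Pi.mul_apply, e3]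
  rw [← mul_assoc, ← ENNReal.ofReal_pow (by positivity), ← ENNReal.ofReal_mul (by positivity)]
  congr 2
  rw [mul_pow, Real.sq_sqrt (abs_nonneg _)]
  simp
  field_simp

end Polar

/-! ### Restriction and extension by zero -/

section ExtendRestrict

variable {X : Type} [MeasurableSpace X] {μ μ' : Measure X} {s : Set X}

/-- Restriction of functions to a subset. -/
def resL2 (h : μ' = μ.restrict s) (f : Lp ℂ 2 μ) : Lp ℂ 2 μ' :=
  (show MemLp f 2 μ' from h ▸ (Lp.memLp f).restrict s).toLp f

lemma ae_of_eq_restrict (h : μ' = μ.restrict s) {p : X → Prop} (hp : ∀ᵐ x ∂μ, p x) :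
    ∀ᵐ x ∂μ', p x := by
  rw [h]; exact ae_restrict_of_ae hp

lemma coeFn_resL2 (h : μ' = μ.restrict s) (f : Lp ℂ 2 μ) : resL2 h f =ᵐ[μ'] f :=
  MemLp.coeFn_toLp _

/-- Extension of functions by zero. -/
def extL2 (hs : MeasurableSet s) (h : μ' = μ.restrict s) (f : Lp ℂ 2 μ') : Lp ℂ 2 μ :=
  ((memLp_indicator_iff_restrict hs).2 (show MemLp f 2 (μ.restrict s) from h ▸ Lp.memLp f)).toLp
    (s.indicator f)

lemma coeFn_extL2 (hs : MeasurableSet s) (h : μ' = μ.restrict s) (f : Lp ℂ 2 μ') :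
    extL2 hs h f =ᵐ[μ] s.indicator f :=
  MemLp.coeFn_toLp _

lemma inner_extL2 (hs : MeasurableSet s) (h : μ' = μ.restrict s) (f : Lp ℂ 2 μ') (g : Lp ℂ 2 μ) :
    inner ℂ (extL2 hs h f) g = inner ℂ f (resL2 h g) := by
  have e : inner ℂ f (resL2 h g) = ∫ x, conj (f x) * g x ∂μ' := by
    rw [inner_eq_integral]
    refine integral_congr_ae ?_
    filter_upwards [coeFn_resL2 h g] with x hx
    rw [hx]
  have e' : ∀ F : X → ℂ, ∫ x, F x ∂μ' = ∫ x in s, F x ∂μ := fun F => by rw [h]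
  rw [e, inner_eq_integral, e', ← integral_indicator hs]
  refine integral_congr_ae ?_
  filter_upwards [coeFn_extL2 hs h f] with x hx
  rw [hx]
  by_cases hxs : x ∈ s <;> simp [hxs]

end ExtendRestrict

/-! ### Kernels on the cones -/

section Cones

/-- Outside the cones lie only the two light lines `x₁ = ± x₂`, which are proper subspaces and hence
null. -/
lemma ae_exists_mem_cone : ∀ᵐ x : Plane, ∃ p : Fin 2 × Fin 2, x ∈ cone p.1 p.2 := by
  have key : ∀ c : ℝ, ∀ᵐ x : Plane, x 0 - c * x 1 ≠ 0 := by
    intro c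
    let l : Plane →ₗ[ℝ] ℝ :=
      (EuclideanSpace.proj (𝕜 := ℝ) (0 : Fin 2) : Plane →ₗ[ℝ] ℝ) -
        c • (EuclideanSpace.proj (𝕜 := ℝ) (1 : Fin 2) : Plane →ₗ[ℝ] ℝ)
    have hl : ∀ x, l x = x 0 - c * x 1 := fun x => by simp [l]
    have hn : LinearMap.ker l ≠ ⊤ := by
      intro h
      have : (!₂[1, 0] : Plane) ∈ LinearMap.ker l := h ▸ Submodule.mem_top
      rw [LinearMap.mem_ker, hl] at this
      simp at this
    have h0 := Measure.addHaar_submodule (volume : Measure Plane) _ hn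
    rw [ae_iff]
    refine measure_mono_null (fun x hx => ?_) h0
    simp only [ne_eq, not_not, Set.mem_ofPred_eq] at hx
    simpa [LinearMap.mem_ker, hl] using hx
  filter_upwards [key 1, key (-1)] with x h1 h2
  have h3 : x 0 ^ 2 ≠ x 1 ^ 2 := by
    intro h
    have : (x 0 - 1 * x 1) * (x 0 - -1 * x 1) = 0 := by linear_combination h
    exact mul_ne_zero h1 h2 this
  rcases lt_or_gt_of_ne h3 with h | h
  · have h5 : x 1 ≠ 0 := by
      rintro h5
      rw [h5] at h
      nlinarith [sq_nonneg (x 0)]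
    rcases lt_or_gt_of_ne h5 with h6 | h6
    · exact ⟨(1, 1), by simpa [cone] using ⟨h, h6⟩⟩
    · exact ⟨(0, 1), by simpa [cone] using ⟨h, h6⟩⟩
  · have h5 : x 0 ≠ 0 := by
      rintro h5
      rw [h5] at h
      nlinarith [sq_nonneg (x 1)]
    rcases lt_or_gt_of_ne h5 with h6 | h6
    · exact ⟨(1, 0), by simpa [cone] using ⟨h, h6⟩⟩
    · exact ⟨(0, 0), by simpa [cone] using ⟨h, h6⟩⟩

lemma cone_unique {i j i' j' : Fin 2} {x : Plane} (h : x ∈ cone i j) (h' : x ∈ cone i' j') :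
    i = i' ∧ j = j' := by
  obtain ⟨h1, h2⟩ := h
  obtain ⟨h3, h4⟩ := h'
  fin_cases i <;> fin_cases j <;> fin_cases i' <;> fin_cases j' <;> simp at h1 h2 h3 h4 ⊢ <;>
    linarith

lemma pairwise_disjoint_cone :
    Pairwise (Function.onFun Disjoint fun p : Fin 2 × Fin 2 => cone p.1 p.2) := by
  intro p q hpq
  refine Set.disjoint_left.2 fun x hp hq => hpq ?_
  obtain ⟨h1, h2⟩ := cone_unique hp hq
  exact Prod.ext h1 h2

/-- Lebesgue measure on a cone. -/
abbrev coneVol (i j : Fin 2) : Measure Plane := (volume : Measure Plane).restrict (cone i j)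

/-- The map `(a, ϑ, x) ↦ (x, a Λ_{-ϑ} x)`. -/
def coneMap (p : (Set.Ioi (0 : ℝ) × ℝ) × Plane) : Plane × Plane := (p.2, act (ofA p.1) p.2)

/-- The pair `(a, ϑ)` with `y = a Λ_{-ϑ} x`. -/
def coneParam (x y : Plane) : Set.Ioi (0 : ℝ) × ℝ :=
  -- The value 1 is a filler that keeps the dilation parameter positive where `dilOf` vanishes. For
  -- two points of one cone `dilOf` is positive.
  (⟨if 0 < dilOf x y then dilOf x y else 1, by
    split_ifs with h
    · exact h
    · exact Set.mem_Ioi.2 one_pos⟩, angleOf x y)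

/-- The inverse of `coneMap`. -/
def coneInv (p : Plane × Plane) : (Set.Ioi (0 : ℝ) × ℝ) × Plane := (coneParam p.1 p.2, p.1)

/-- The weight `a² |⟨x; x⟩|^{1/2}`. -/
def coneWeight (p : (Set.Ioi (0 : ℝ) × ℝ) × Plane) : ℝ := (p.1.1 : ℝ) ^ 2 * √|mink p.2 p.2|

lemma measurable_act_uncurry :
    Measurable fun p : (Set.Ioi (0 : ℝ) × ℝ) × Plane => act (ofA p.1) p.2 := by
  have e : (fun p : (Set.Ioi (0 : ℝ) × ℝ) × Plane => act (ofA p.1) p.2) =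
      fun p => (!₂[(p.1.1 : ℝ) * (Real.cosh p.1.2 * p.2 0 - Real.sinh p.1.2 * p.2 1),
        (p.1.1 : ℝ) * (Real.cosh p.1.2 * p.2 1 - Real.sinh p.1.2 * p.2 0)] : Plane) := by
    funext p
    ext k
    fin_cases k
    · exact act_zero_apply _ _
    · exact act_one_apply _ _
  rw [e]
  refine Continuous.measurable ?_
  have h0 : Continuous fun p : (Set.Ioi (0 : ℝ) × ℝ) × Plane => (p.1.1 : ℝ) :=
    continuous_subtype_val.comp (continuous_fst.comp continuous_fst)
  fun_prop

lemma measurable_mink_self : Measurable fun x : Plane => mink x x := by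
  unfold mink; fun_prop

lemma measurable_dilOf : Measurable fun p : Plane × Plane => dilOf p.1 p.2 := by
  unfold dilOf mink; fun_prop

lemma measurable_angleOf : Measurable fun p : Plane × Plane => angleOf p.1 p.2 := by
  unfold angleOf
  refine Real.continuous_arsinh.measurable.comp ?_
  have h1 := measurable_dilOf
  have h2 : Measurable fun p : Plane × Plane => mink p.1 p.1 :=
    measurable_mink_self.comp measurable_fst
  exact Measurable.div (by fun_prop) (h1.mul h2)

lemma measurable_coneInv : Measurable coneInv := by
  refine Measurable.prodMk (Measurable.prodMk (Measurable.subtype_mk ?_) measurable_angleOf)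
    measurable_fst
  exact Measurable.ite (measurableSet_lt measurable_const measurable_dilOf) measurable_dilOf
    measurable_const

lemma coneParam_of_sameCone {x y : Plane} (h : SameCone x y) : coneParam x y = (transport h).2 := by
  have := h.dilOf_pos
  simp [coneParam, transport, this]

/-- For each fixed `x` in the cone this is integration in hyperbolic polar coordinates
(`lintegral_cone`), with `act_transport` providing the inverse. It identifies square integrable
functions of `(a, ϑ, x)` with Hilbert–Schmidt kernels on the cone. -/
lemma isWeighted_cone (i j : Fin 2) :
    IsWeighted (haarA.prod (coneVol i j)) ((coneVol i j).prod (coneVol i j))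
      coneMap coneInv coneWeight := by
  have hmap : Measurable coneMap := measurable_snd.prodMk measurable_act_uncurry
  have hw : Measurable coneWeight := by
    unfold coneWeight mink
    fun_prop
  have hae : ∀ᵐ p ∂(haarA.prod (coneVol i j)), p.2 ∈ cone i j :=
    ae_snd (ae_restrict_mem (measurableSet_cone i j))
  refine ⟨hmap, measurable_coneInv, hw, ?_, ?_, ?_, ?_⟩
  · filter_upwards [hae] with p hp
    have h1 := abs_pos.2 (mink_self_ne_zero hp)
    have h2 : (0 : ℝ) < p.1.1 := p.1.1.2
    unfold coneWeight
    positivity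
  · refine Measure.ext_of_lintegral _ fun H hH => ?_
    have hw2 : Measurable fun p => ENNReal.ofReal (coneWeight p) ^ 2 :=
      hw.ennreal_ofReal.pow_const 2
    have hH2 : Measurable fun p => H (coneMap p) := hH.comp hmap
    rw [lintegral_map hH hmap, lintegral_withDensity_eq_lintegral_mul _ hw2 hH2,
      lintegral_prod_symm _ (hw2.mul hH2).aemeasurable, lintegral_prod _ hH.aemeasurable]
    refine setLIntegral_congr_fun (measurableSet_cone i j) fun x hx => ?_
    exact lintegral_cone hx (hH.comp measurable_prodMk_left)
  · filter_upwards [hae] with p hp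
    have hq := mink_self_ne_zero hp
    have hs : SameCone p.2 (act (ofA p.1) p.2) := ⟨i, j, hp, act_mem_cone _ i j hp⟩
    rw [coneMap, coneInv]
    simp only
    rw [coneParam_of_sameCone hs]
    refine Prod.ext (Prod.ext (Subtype.ext ?_) ?_) rfl
    · exact dilOf_act (ofA p.1) hq
    · exact angleOf_act (ofA p.1) hq
  · filter_upwards [ae_fst (ν := coneVol i j) (ae_restrict_mem (measurableSet_cone i j)),
      ae_snd (μ := coneVol i j) (ae_restrict_mem (measurableSet_cone i j))] with p h1 h2
    have hs : SameCone p.1 p.2 := ⟨i, j, h1, h2⟩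
    rw [coneMap, coneInv]
    simp only
    rw [coneParam_of_sameCone hs]
    exact Prod.ext rfl (act_transport hs)

lemma prod_coneVol (i j : Fin 2) : haarA.prod (coneVol i j) =
    (haarA.prod (volume : Measure Plane)).restrict (Set.univ ×ˢ cone i j) := by
  rw [← Measure.prod_restrict, Measure.restrict_univ]

lemma measurableSet_univ_cone (i j : Fin 2) :
    MeasurableSet ((Set.univ : Set (Set.Ioi (0 : ℝ) × ℝ)) ×ˢ cone i j) :=
  MeasurableSet.univ.prod (measurableSet_cone i j)

/-- `L²` of the group after exchange of the translation variable with `(a, ϑ)`. -/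
abbrev L2AP : Type := Lp ℂ 2 (haarA.prod (volume : Measure Plane))

/-- The partial inverse Minkowski–Fourier transform in the translation variable. -/
def partialMink : L2AP ≃ₗᵢ[ℂ] L2AP := ampli haarA minkU

/-- Exchange of the translation variable with `(a, ϑ)`. -/
def grpSwap (f : L2Grp) : L2AP := swapL2 (μ := (volume : Measure Plane)) (ν := haarA) f

/-- The inverse of `grpSwap`. -/
def grpUnswap (f : L2AP) : L2Grp := swapL2 (μ := haarA) (ν := (volume : Measure Plane)) f

lemma inner_grpUnswap (k : L2AP) (f : L2Grp) :
    inner ℂ (grpUnswap k) f = inner ℂ k (grpSwap f) :=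
  inner_swapL2_left (μ := haarA) (ν := (volume : Measure Plane)) k f

lemma grpSwap_grpUnswap (k : L2AP) : grpSwap (grpUnswap k) = k :=
  swapL2_swapL2 (μ := haarA) (ν := (volume : Measure Plane)) k

lemma inner_grpSwap (k f : L2Grp) : inner ℂ (grpSwap k) (grpSwap f) = inner ℂ k f :=
  inner_swapL2 (μ := (volume : Measure Plane)) (ν := haarA) k f

/-- Restriction to a cone in the plane variable. -/
def coneRes (i j : Fin 2) (F : L2AP) : Lp ℂ 2 (haarA.prod (coneVol i j)) :=
  resL2 (prod_coneVol i j) F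

/-- Extension by zero from a cone in the plane variable. -/
def coneExt (i j : Fin 2) (F : Lp ℂ 2 (haarA.prod (coneVol i j))) : L2AP :=
  extL2 (measurableSet_univ_cone i j) (prod_coneVol i j) F

lemma inner_coneExt (i j : Fin 2) (F : Lp ℂ 2 (haarA.prod (coneVol i j))) (G : L2AP) :
    inner ℂ (coneExt i j F) G = inner ℂ F (coneRes i j G) :=
  inner_extL2 _ _ _ _

/-- The cones are disjoint and cover the plane up to a null set, so the integrals over them add up.
-/
lemma sum_inner_coneRes (F G : L2AP) :
    ∑ i, ∑ j, inner ℂ (coneRes i j F) (coneRes i j G) = inner ℂ F G := by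
  have h1 : ∀ i j, inner ℂ (coneRes i j F) (coneRes i j G) =
      ∫ p in Set.univ ×ˢ cone i j, conj (F p) * G p ∂(haarA.prod volume) := by
    intro i j
    rw [inner_eq_integral, ← prod_coneVol]
    refine integral_congr_ae ?_
    filter_upwards [coeFn_resL2 (prod_coneVol i j) F, coeFn_resL2 (prod_coneVol i j) G]
      with p hp hq
    rw [coneRes, coneRes, hp, hq]
  have hint : Integrable (fun p => conj (F p) * G p) (haarA.prod volume) :=
    integrable_conj_mul (Lp.memLp F) (Lp.memLp G)
  simp only [h1]
  rw [← Fintype.sum_prod_type' (f := fun i j =>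
      ∫ p in Set.univ ×ˢ cone i j, conj (F p) * G p ∂(haarA.prod volume)),
    ← integral_iUnion_fintype (s := fun p : Fin 2 × Fin 2 =>
      (Set.univ : Set (Set.Ioi (0 : ℝ) × ℝ)) ×ˢ cone p.1 p.2), inner_eq_integral]
  · rw [Measure.restrict_eq_self_of_ae_mem]
    filter_upwards [ae_snd (μ := haarA) ae_exists_mem_cone] with p hp
    simpa using hp
  · exact fun p => measurableSet_univ_cone _ _
  · intro p q hpq
    exact Set.disjoint_prod.2 (Or.inr (pairwise_disjoint_cone hpq))
  · exact fun p => hint.integrableOn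

lemma coneRes_sum_coneExt (F : ∀ i j : Fin 2, Lp ℂ 2 (haarA.prod (coneVol i j))) (i j : Fin 2) :
    coneRes i j (∑ p : Fin 2 × Fin 2, coneExt p.1 p.2 (F p.1 p.2)) = F i j := by
  apply Lp.ext
  have h1 : ∀ᵐ z ∂(haarA.prod (coneVol i j)), ∀ p : Fin 2 × Fin 2,
      coneExt p.1 p.2 (F p.1 p.2) z = (Set.univ ×ˢ cone p.1 p.2).indicator (F p.1 p.2) z := by
    rw [ae_all_iff]
    intro p
    exact ae_of_eq_restrict (prod_coneVol i j) (coeFn_extL2 _ _ _)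
  have h2 : ∀ᵐ z ∂(haarA.prod (coneVol i j)),
      (∑ p : Fin 2 × Fin 2, coneExt p.1 p.2 (F p.1 p.2) : L2AP) z =
        ∑ p : Fin 2 × Fin 2, coneExt p.1 p.2 (F p.1 p.2) z := by
    exact ae_of_eq_restrict (prod_coneVol i j) (Lp.coeFn_fun_finsetSum _ _)
  filter_upwards [coeFn_resL2 (prod_coneVol i j)
    (∑ p : Fin 2 × Fin 2, coneExt p.1 p.2 (F p.1 p.2)), h1, h2,
    ae_snd (μ := haarA) (ae_restrict_mem (measurableSet_cone i j))] with z h3 h4 h5 h6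
  rw [coneRes, h3, h5, Finset.sum_eq_single (i, j)]
  · rw [h4 (i, j), Set.indicator_of_mem]
    exact ⟨trivial, h6⟩
  · intro p _ hp
    rw [h4 p, Set.indicator_of_notMem]
    rintro ⟨-, h7⟩
    obtain ⟨h8, h9⟩ := cone_unique h7 h6
    exact hp (Prod.ext h8 h9)
  · simp

/-- The integral kernel of the group Fourier transform of `f`. -/
def fourierKer (i j : Fin 2) (f : L2Grp) : Lp ℂ 2 ((coneVol i j).prod (coneVol i j)) :=
  (isWeighted_cone i j).equiv.symm (coneRes i j (partialMink.symm (grpSwap f)))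

/-- Plancherel's theorem on the group. -/
lemma sum_inner_fourierKer (f g : L2Grp) :
    ∑ i, ∑ j, inner ℂ (fourierKer i j f) (fourierKer i j g) = inner ℂ f g := by
  simp only [fourierKer, LinearIsometryEquiv.inner_map_map]
  rw [sum_inner_coneRes, LinearIsometryEquiv.inner_map_map, inner_grpSwap]

/-- Surjectivity in Plancherel's theorem: kernels prescribed on the four cones are glued, and each
unitary in `fourierKer` is inverted. -/
lemma exists_fourierKer_eq (k : ∀ i j : Fin 2, Lp ℂ 2 ((coneVol i j).prod (coneVol i j))) :
    ∃ f : L2Grp, ∀ i j, fourierKer i j f = k i j := by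
  refine ⟨grpUnswap (partialMink (∑ p : Fin 2 × Fin 2, coneExt p.1 p.2
    ((isWeighted_cone p.1 p.2).equiv (k p.1 p.2)))), fun i j => ?_⟩
  rw [fourierKer, grpSwap_grpUnswap, LinearIsometryEquiv.symm_apply_apply,
    coneRes_sum_coneExt fun i j => (isWeighted_cone i j).equiv (k i j),
    LinearIsometryEquiv.symm_apply_apply]

end Cones

/-! ### Unitarity of the representations -/

section Rep

lemma coeFn_rep {i j : Fin 2} (g : Grp) (φ : L2Cone i j) :
    rep i j g φ =ᵐ[coneVol i j] repFun g φ :=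
  MemLp.coeFn_toLp (memLp_repFun g φ)

lemma norm_rep {i j : Fin 2} (g : Grp) (φ : L2Cone i j) : ‖rep i j g φ‖ = ‖φ‖ := by
  change ‖(memLp_repFun g φ).toLp (repFun g φ)‖ = ‖φ‖
  rw [Lp.norm_toLp, eLpNorm_repFun, Lp.norm_def]

/-- A group element acting as the inverse of `g`. -/
def invElt (g : Grp) : Grp := (0, ⟨(dilPar g)⁻¹, inv_pos.2 (dilPar_pos g)⟩, -g.2.2)

lemma dilPar_invElt (g : Grp) : dilPar (invElt g) = (dilPar g)⁻¹ := rfl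

lemma act_invElt_act (g : Grp) (x : Plane) : act (invElt g) (act g x) = x := by
  have ha := (dilPar_pos g).ne'
  have hc := Real.cosh_sq g.2.2
  ext k
  fin_cases k <;> simp only [Fin.zero_eta, Fin.mk_one, act_zero_apply, act_one_apply,
    dilPar_invElt] <;> simp only [invElt, Real.cosh_neg, Real.sinh_neg] <;> field_simp <;>
    ring_nf <;> rw [hc] <;> ring

lemma act_act_invElt (g : Grp) (x : Plane) : act g (act (invElt g) x) = x := by
  have ha := (dilPar_pos g).ne'
  have hc := Real.cosh_sq g.2.2
  ext k
  fin_cases k <;> simp only [Fin.zero_eta, Fin.mk_one, act_zero_apply, act_one_apply,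
    dilPar_invElt] <;> simp only [invElt, Real.cosh_neg, Real.sinh_neg] <;> field_simp <;>
    ring_nf <;> rw [hc] <;> ring

lemma measurable_act (g : Grp) : Measurable (act g) :=
  (LinearMap.continuous_of_finiteDimensional _).measurable

lemma isWeighted_act (g : Grp) (i j : Fin 2) :
    IsWeighted (coneVol i j) (coneVol i j) (act g) (act (invElt g)) fun _ => dilPar g := by
  have ha := dilPar_pos g
  refine ⟨measurable_act g, measurable_act _, measurable_const, .of_forall fun _ => ha, ?_,
    .of_forall (act_invElt_act g), .of_forall (act_act_invElt g)⟩
  rw [withDensity_const, Measure.map_smul, map_act, smul_smul, ← ENNReal.ofReal_pow ha.le,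
    ← ENNReal.ofReal_mul (by positivity), mul_inv_cancel₀ (by positivity), ENNReal.ofReal_one,
    one_smul]

lemma rep_surjective {i j : Fin 2} (g : Grp) : Function.Surjective (rep i j g) := by
  intro ψ
  have hph : ∀ x, ‖Complex.exp (-(Complex.I * (mink x g.1 : ℂ)))‖ = 1 := fun x => by
    rw [← mul_neg, mul_comm, ← Complex.ofReal_neg, Complex.norm_exp_ofReal_mul_I]
  have hc : Continuous fun x : Plane => Complex.exp (-(Complex.I * (mink x g.1 : ℂ))) := by
    unfold mink; fun_prop
  have hmem : MemLp (fun x => Complex.exp (-(Complex.I * (mink x g.1 : ℂ))) * ψ x) 2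
      (coneVol i j) := by
    refine (Lp.memLp ψ).of_le (hc.aestronglyMeasurable.mul (Lp.aestronglyMeasurable ψ))
      (.of_forall fun x => ?_)
    rw [norm_mul, hph, one_mul]
  refine ⟨(isWeighted_act g i j).equiv.symm (hmem.toLp _), ?_⟩
  apply Lp.ext
  have h1 := (isWeighted_act g i j).coeFn_equiv ((isWeighted_act g i j).equiv.symm (hmem.toLp _))
  rw [LinearIsometryEquiv.apply_symm_apply] at h1
  filter_upwards [coeFn_rep g ((isWeighted_act g i j).equiv.symm (hmem.toLp _)), h1,
    hmem.coeFn_toLp] with x h2 h3 h4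
  rw [h2, repFun, mul_right_comm, ← h3, h4, mul_right_comm, ← Complex.exp_add, neg_add_cancel,
    Complex.exp_zero, one_mul]

/-- The unitary operator `π(g)`. -/
def repU (i j : Fin 2) (g : Grp) : L2Cone i j ≃ₗᵢ[ℂ] L2Cone i j :=
  LinearIsometryEquiv.ofSurjective ⟨(rep i j g : L2Cone i j →ₗ[ℂ] L2Cone i j), norm_rep g⟩
    (rep_surjective g)

lemma repU_apply {i j : Fin 2} (g : Grp) (φ : L2Cone i j) : repU i j g φ = rep i j g φ := rfl

lemma rep_adjoint_apply {i j : Fin 2} (g : Grp) (φ : L2Cone i j) :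
    (rep i j g).adjoint φ = (repU i j g).symm φ := by
  refine ext_inner_left ℂ fun ψ => ?_
  rw [ContinuousLinearMap.adjoint_inner_right, ← repU_apply, ← (repU i j g).inner_map_map ψ,
    LinearIsometryEquiv.apply_symm_apply]

lemma rep_rep_adjoint {i j : Fin 2} (g : Grp) (φ : L2Cone i j) :
    rep i j g ((rep i j g).adjoint φ) = φ := by
  rw [rep_adjoint_apply, ← repU_apply, LinearIsometryEquiv.apply_symm_apply]

end Rep

/-! ### The Fourier transform on the group -/

section GroupFourier

lemma mem_duflo_domain {i j : Fin 2} {φ : L2Cone i j} : φ ∈ (duflo i j).domain ↔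
    MemLp (fun x => ((√|mink x x| / (2 * Real.pi) : ℝ) : ℂ) * φ x) 2 (coneVol i j) := Iff.rfl

lemma coeFn_duflo {i j : Fin 2} (φ : (duflo i j).domain) :
    duflo i j φ =ᵐ[coneVol i j]
      fun x => ((√|mink x x| / (2 * Real.pi) : ℝ) : ℂ) * (φ : L2Cone i j) x :=
  MemLp.coeFn_toLp φ.2

lemma measurable_dufloWeight : Measurable fun x : Plane => √|mink x x| / (2 * Real.pi) := by
  unfold mink; fun_prop

/-- Let `m` be the multiplier of `D`. If `ψ` is orthogonal to the domain, then testing with `(1 +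
m)⁻¹ ψ`, which lies in the domain, gives `∫ (1 + m)⁻¹ |ψ|² = 0`. -/
lemma dense_duflo_domain (i j : Fin 2) :
    (duflo i j).domain.topologicalClosure = ⊤ := by
  rw [Submodule.topologicalClosure_eq_top_iff, Submodule.eq_bot_iff]
  intro ψ hψ
  rw [Submodule.mem_orthogonal] at hψ
  set m : Plane → ℝ := fun x => √|mink x x| / (2 * Real.pi) with hm
  have hm0 : ∀ x, 0 ≤ m x := fun x => by positivity
  have hmm : Measurable m := measurable_dufloWeight
  have h1 : MemLp (fun x => ((1 + m x : ℝ) : ℂ)⁻¹ * ψ x) 2 (coneVol i j) := by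
    refine (Lp.memLp ψ).of_le ((by fun_prop : Measurable fun x =>
      ((1 + m x : ℝ) : ℂ)⁻¹).aestronglyMeasurable.mul (Lp.aestronglyMeasurable ψ))
      (.of_forall fun x => ?_)
    rw [norm_mul, norm_inv, Complex.norm_real, Real.norm_of_nonneg (by linarith [hm0 x])]
    exact mul_le_of_le_one_left (norm_nonneg _) (inv_le_one_of_one_le₀ (by linarith [hm0 x]))
  have h2 : h1.toLp _ ∈ (duflo i j).domain := by
    rw [mem_duflo_domain]
    refine (Lp.memLp ψ).of_le ((Complex.measurable_ofReal.comp hmm).aestronglyMeasurable.mul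
      (Lp.aestronglyMeasurable _)) ?_
    filter_upwards [h1.coeFn_toLp] with x hx
    rw [hx, ← mul_assoc, norm_mul, norm_mul, norm_inv, Complex.norm_real, Complex.norm_real,
      Real.norm_of_nonneg (hm0 x), Real.norm_of_nonneg (by linarith [hm0 x]), ← div_eq_mul_inv]
    exact mul_le_of_le_one_left (norm_nonneg _)
      ((div_le_one (by linarith [hm0 x])).2 (by linarith))
  have h3 := hψ _ h2
  have h4 : ∫ x, (1 + m x)⁻¹ * ‖ψ x‖ ^ 2 ∂(coneVol i j) = 0 := by
    rw [inner_eq_integral] at h3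
    have : ∫ x, (1 + (m x : ℂ))⁻¹ * ((‖ψ x‖ : ℝ) : ℂ) ^ 2 ∂(coneVol i j) = 0 := by
      rw [← h3]
      refine integral_congr_ae ?_
      filter_upwards [h1.coeFn_toLp] with x hx
      rw [hx, map_mul, map_inv₀, Complex.conj_ofReal, mul_assoc, ← Complex.normSq_eq_conj_mul_self,
        Complex.normSq_eq_norm_sq]
      push_cast
      ring
    have h5 := integral_complex_ofReal (f := fun x => (1 + m x)⁻¹ * ‖ψ x‖ ^ 2) (μ := coneVol i j)
    push_cast at h5
    rw [this] at h5
    exact_mod_cast h5.symm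
  have hint : Integrable (fun x => (1 + m x)⁻¹ * ‖ψ x‖ ^ 2) (coneVol i j) := by
    refine ((memLp_two_iff_integrable_sq_norm (Lp.aestronglyMeasurable ψ)).1 (Lp.memLp ψ)).mono
      ((by fun_prop : Measurable fun x => (1 + m x)⁻¹).aestronglyMeasurable.mul
        ((Lp.aestronglyMeasurable ψ).norm.pow 2)) (.of_forall fun x => ?_)
    rw [norm_mul, norm_inv, Real.norm_of_nonneg (show 0 ≤ 1 + m x by linarith [hm0 x])]
    exact mul_le_of_le_one_left (norm_nonneg _) (inv_le_one_of_one_le₀ (by linarith [hm0 x]))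
  rw [integral_eq_zero_iff_of_nonneg (fun x => by have := hm0 x; positivity) hint] at h4
  apply Lp.ext
  filter_upwards [h4, Lp.coeFn_zero ℂ 2 (coneVol i j)] with x hx h0
  have := hm0 x
  have h6 : (1 + m x)⁻¹ ≠ 0 := by positivity
  rw [h0]
  simpa [h6] using hx

lemma ae_imp_of_eq_restrict {X : Type} [MeasurableSpace X] {μ μ' : Measure X} {s : Set X}
    (hs : MeasurableSet s) (h : μ' = μ.restrict s) {p : X → Prop} (hp : ∀ᵐ x ∂μ', p x) :
    ∀ᵐ x ∂μ, x ∈ s → p x := by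
  rw [h] at hp
  exact (ae_restrict_iff' hs).1 hp

/-- The function `(q, b) ↦ ⟨π(b, q) χ, ψ⟩`. -/
def repCoeff {i j : Fin 2} (ψ χ : L2Cone i j) (p : (Set.Ioi (0 : ℝ) × ℝ) × Plane) : ℂ :=
  conj (inner ℂ ψ (rep i j (p.2, p.1) χ))

lemma repCoeff_eq {i j : Fin 2} (ψ χ : L2Cone i j) (p : (Set.Ioi (0 : ℝ) × ℝ) × Plane) :
    repCoeff ψ χ p = ∫ x, ψ x * conj (repFun (p.2, p.1) χ x) ∂(coneVol i j) := by
  rw [repCoeff, inner_eq_integral, ← integral_conj]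
  refine integral_congr_ae ?_
  filter_upwards [coeFn_rep (p.2, p.1) χ] with x hx
  rw [hx]
  simp

lemma stronglyMeasurable_repCoeff {i j : Fin 2} (ψ χ : L2Cone i j) :
    StronglyMeasurable (repCoeff ψ χ) := by
  rw [funext (repCoeff_eq ψ χ)]
  refine StronglyMeasurable.integral_prod_right' (f := fun z :
    ((Set.Ioi (0 : ℝ) × ℝ) × Plane) × Plane => ψ z.2 * conj (repFun (z.1.2, z.1.1) χ z.2)) ?_
  refine StronglyMeasurable.mul
    ((Lp.stronglyMeasurable ψ).comp_measurable measurable_snd) ?_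
  have h1 : Measurable fun z : ((Set.Ioi (0 : ℝ) × ℝ) × Plane) × Plane =>
      χ (act (ofA z.1.1) z.2) :=
    (Lp.stronglyMeasurable χ).measurable.comp
      (measurable_act_uncurry.comp ((measurable_fst.comp measurable_fst).prodMk measurable_snd))
  have h2 : Measurable fun z : ((Set.Ioi (0 : ℝ) × ℝ) × Plane) × Plane =>
      (dilPar (z.1.2, z.1.1) : ℂ) * Complex.exp (Complex.I * (mink z.2 z.1.2 : ℂ)) := by
    unfold dilPar mink
    have : Measurable fun z : ((Set.Ioi (0 : ℝ) × ℝ) × Plane) × Plane => (z.1.1.1 : ℝ) :=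
      measurable_subtype_coe.comp (measurable_fst.comp (measurable_fst.comp measurable_fst))
    fun_prop
  have h3 : Measurable fun z : ((Set.Ioi (0 : ℝ) × ℝ) × Plane) × Plane =>
      repFun (z.1.2, z.1.1) χ z.2 := h2.mul h1
  exact (Complex.continuous_conj.measurable.comp h3).stronglyMeasurable

/-- The coefficient functions of the representations in terms of the unitary operators of the
Plancherel decomposition. -/
lemma repCoeff_ae_eq {i j : Fin 2} (φ : (duflo i j).domain) (ψ : L2Cone i j) :
    repCoeff ψ (duflo i j φ) =ᵐ[haarA.prod volume]
      partialMink (coneExt i j ((isWeighted_cone i j).equiv (tmul ψ (star (φ : L2Cone i j))))) := by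
  set χ : L2Cone i j := duflo i j φ with hχ
  set V := (isWeighted_cone i j).equiv (tmul ψ (star (φ : L2Cone i j))) with hV
  -- The factor `a` of the representation and the factor `a |⟨x; x⟩|^{1/2} / (2π)` of `D` at the
  -- point `a Λ_{-ϑ} x` multiply to `coneWeight / (2π)`. Thus `D` supplies what makes the change of
  -- variables isometric.
  have hsec : ∀ᵐ q ∂haarA, (fun x => coneExt i j V (q, x)) =ᵐ[volume]
      (cone i j).indicator fun x => (2 * Real.pi : ℂ) * (ψ x * conj (repFun (0, q) χ x)) := by
    have h1 : ∀ᵐ p ∂(haarA.prod (coneVol i j)), V p =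
        (2 * Real.pi : ℂ) * (ψ p.2 * conj (repFun (0, p.1) χ p.2)) := by
      have hstar := (isWeighted_cone i j).quasi.ae (coeFn_tmul ψ (star (φ : L2Cone i j)))
      have hs2 := (isWeighted_cone i j).quasi.ae
        (ae_snd (μ := coneVol i j) (Lp.coeFn_star (φ : L2Cone i j)))
      have hd := (isWeighted_cone i j).quasi.ae (ae_snd (μ := coneVol i j) (coeFn_duflo φ))
      filter_upwards [(isWeighted_cone i j).coeFn_equiv (tmul ψ (star (φ : L2Cone i j))),
        hstar, hs2, hd] with p h1 h2 h3 h4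
      rw [hV, h1, h2, h3, repFun]
      simp only [coneMap] at h4 ⊢
      have e : act (0, p.1) p.2 = act (ofA p.1) p.2 := rfl
      have hp : (Real.pi : ℂ) ≠ 0 := by exact_mod_cast Real.pi_ne_zero
      have hdp : dilPar (ofA p.1) = (p.1.1 : ℝ) := rfl
      have ha : (0 : ℝ) < p.1.1 := p.1.1.2
      have hdp2 : dilPar (0, p.1) = (p.1.1 : ℝ) := rfl
      rw [e, hχ, h4, mink_act, abs_mul, Real.sqrt_mul (abs_nonneg _), abs_of_nonneg (sq_nonneg _),
        Real.sqrt_sq (dilPar_pos _).le, hdp, hdp2, coneWeight]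
      simp only [mink, map_mul, Complex.conj_ofReal, ← Complex.exp_conj]
      simp only [PiLp.zero_apply, mul_zero, sub_zero, Complex.ofReal_zero,
        Complex.exp_zero, Pi.star_apply, RCLike.star_def]
      push_cast
      field_simp
    have h2 : ∀ᵐ p ∂(haarA.prod (volume : Measure Plane)), coneExt i j V p =
        (cone i j).indicator
          (fun x => (2 * Real.pi : ℂ) * (ψ x * conj (repFun (0, p.1) χ x))) p.2 := by
      have h3 : ∀ᵐ p ∂(haarA.prod (volume : Measure Plane)), p ∈ Set.univ ×ˢ cone i j →
          V p = (2 * Real.pi : ℂ) * (ψ p.2 * conj (repFun (0, p.1) χ p.2)) := by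
        exact ae_imp_of_eq_restrict (measurableSet_univ_cone i j) (prod_coneVol i j) h1
      filter_upwards [h3, coeFn_extL2 (measurableSet_univ_cone i j) (prod_coneVol i j) V]
        with p h4 h5
      rw [coneExt, h5]
      by_cases hp : p.2 ∈ cone i j
      · rw [Set.indicator_of_mem hp, Set.indicator_of_mem (by exact ⟨trivial, hp⟩), h4 ⟨trivial, hp⟩]
      · rw [Set.indicator_of_notMem hp, Set.indicator_of_notMem fun h => hp h.2]
    exact Measure.ae_ae_of_ae_prod h2
  -- Passing from `b = 0` to general `b` only inserts the phase `e^{-i⟨x; b⟩}`, so in `b` the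
  -- coefficient is an inverse Minkowski–Fourier integral. The section is integrable as a product of
  -- two `L²` functions.
  have key := ae_eq_ampli minkU (Lp.memLp (coneExt i j V))
    (stronglyMeasurable_repCoeff ψ χ).aestronglyMeasurable ?_
  · rwa [Lp.toLp_coeFn] at key
  filter_upwards [hsec, ae_memLp_section (Lp.memLp (coneExt i j V))] with q h1 h2
  have h3 : Integrable (fun x => coneExt i j V (q, x)) := by
    refine Integrable.congr ?_ h1.symm
    rw [integrable_indicator_iff (measurableSet_cone i j)]
    exact ((Lp.memLp ψ).integrable_mul (memLp_repFun (0, q) χ).star).const_mul _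
  rw [slice_of_memLp h2]
  refine Filter.EventuallyEq.trans (.of_forall fun b => ?_) (coeFn_minkU_toLp h3 h2).symm
  change repCoeff ψ χ (q, b) = minkInt (fun x => coneExt i j V (q, x)) b
  have h4 : ∫ x, Complex.exp (-(Complex.I * (mink x b : ℂ))) * coneExt i j V (q, x) =
      ∫ x in cone i j, Complex.exp (-(Complex.I * (mink x b : ℂ))) *
        ((2 * Real.pi : ℂ) * (ψ x * conj (repFun (0, q) χ x))) := by
    rw [← integral_indicator (measurableSet_cone i j)]
    refine integral_congr_ae ?_
    filter_upwards [h1] with x hx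
    rw [hx]
    by_cases hxc : x ∈ cone i j <;> simp [hxc]
  rw [minkInt, h4, repCoeff_eq, ← integral_const_mul]
  refine integral_congr_ae (.of_forall fun x => ?_)
  have hp : (Real.pi : ℂ) ≠ 0 := by exact_mod_cast Real.pi_ne_zero
  have e1 : act (b, q) x = act (0, q) x := rfl
  have e2 : dilPar (b, q) = dilPar (0, q) := rfl
  have e3 : mink x 0 = 0 := by simp [mink]
  simp only [repFun, e1, e2, e3, map_mul, ← Complex.exp_conj, Complex.conj_I, Complex.conj_ofReal]
  simp only [Complex.ofReal_zero, mul_zero, Complex.exp_zero, neg_mul]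
  field_simp

/-- By `repCoeff_ae_eq` the coefficient is the image of `ψ ⊗ conj φ` under the unitaries of the
Plancherel decomposition and extension by zero. Moving these to the side of `f` produces
`fourierKer`. -/
lemma isGroupFourier_kerOp {i j : Fin 2} (f : L2Grp) :
    IsGroupFourier f (kerOp (fourierKer i j f)) := by
  intro φ ψ
  set C : L2AP := partialMink
    (coneExt i j ((isWeighted_cone i j).equiv (tmul ψ (star (φ : L2Cone i j))))) with hC
  have h1 : ∀ᵐ g ∂haarL, conj (grpUnswap C g) = inner ℂ ψ (rep i j g (duflo i j φ)) := by
    have h2 : ∀ᵐ g ∂haarL, C (Prod.swap g) = repCoeff ψ (duflo i j φ) (Prod.swap g) :=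
      (Measure.measurePreserving_swap (μ := (volume : Measure Plane))
        (ν := haarA)).quasiMeasurePreserving.ae (repCoeff_ae_eq φ ψ).symm
    have h3 : ∀ᵐ g ∂haarL, grpUnswap C g = C (Prod.swap g) :=
      coeFn_swapL2 (μ := haarA) (ν := (volume : Measure Plane)) C
    filter_upwards [h2, h3] with g h4 h5
    rw [h5, h4, repCoeff, Complex.conj_conj]
    rfl
  constructor
  · refine (integrable_conj_mul (Lp.memLp (grpUnswap C)) (Lp.memLp f)).congr ?_
    filter_upwards [h1] with g hg
    rw [hg, mul_comm]
  · rw [inner_kerOp, fourierKer, ← (isWeighted_cone i j).equiv.inner_map_map,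
      LinearIsometryEquiv.apply_symm_apply, ← inner_coneExt, ← partialMink.inner_map_map,
      LinearIsometryEquiv.apply_symm_apply, ← inner_grpUnswap, inner_eq_integral]
    refine integral_congr_ae ?_
    filter_upwards [h1] with g hg
    rw [hg, mul_comm]

/-- The group Fourier transform is the integral operator with kernel `fourierKer`. -/
lemma groupFourier_eq (i j : Fin 2) (f : L2Grp) :
    groupFourier i j f = kerOp (fourierKer i j f) := by
  have hex : ∃ A : L2Cone i j →L[ℂ] L2Cone i j, IsGroupFourier f A :=
    ⟨_, isGroupFourier_kerOp f⟩
  have h1 : IsGroupFourier f (groupFourier i j f) := by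
    rw [groupFourier, dif_pos hex]
    exact Classical.choose_spec hex
  have hd : Dense ((duflo i j).domain : Set (L2Cone i j)) := by
    rw [Submodule.dense_iff_topologicalClosure_eq_top]
    exact dense_duflo_domain i j
  refine ContinuousLinearMap.ext fun φ => ?_
  refine congrFun (Continuous.ext_on hd (groupFourier i j f).continuous
    (kerOp (fourierKer i j f)).continuous fun φ hφ => ?_) φ
  refine ext_inner_left ℂ fun ψ => ?_
  rw [(h1 ⟨φ, hφ⟩ ψ).2, (isGroupFourier_kerOp f ⟨φ, hφ⟩ ψ).2]

end GroupFourier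

/-! ### The partial Fourier transform -/

section PartialInv

variable {Y : Type} [MeasurableSpace Y] {ν : Measure Y} [SFinite ν] {h : Y → Plane → ℂ}

lemma IsPartialInv.ae_eq {F : Y → Plane → ℂ} (hF : IsPartialInv ν h F)
    (hh : MemLp (Function.uncurry h) 2 (ν.prod volume)) :
    Function.uncurry F =ᵐ[ν.prod volume] ampli ν minkU (hh.toLp _) := by
  refine ae_eq_ampli minkU hh hF.1.1 ?_
  filter_upwards [hF.2] with y hy
  obtain ⟨hm, hy⟩ := hy
  rw [slice_of_memLp (k := Function.uncurry h) hm]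
  exact hy.trans (coeFn_minkU _).symm

lemma isPartialInv_ampli (hh : MemLp (Function.uncurry h) 2 (ν.prod volume)) :
    IsPartialInv ν h fun y x => ampli ν minkU (hh.toLp _) (y, x) := by
  refine ⟨Lp.memLp _, ?_⟩
  filter_upwards [slice_ampli minkU (hh.toLp _), ae_memLp_section hh,
    ae_coeFn_slice (Lp.memLp (ampli ν minkU (hh.toLp _))), ae_slice_congr hh.coeFn_toLp]
    with y h1 h2 h3 h4
  refine ⟨h2, ?_⟩
  rw [h1, h4, slice_of_memLp h2] at h3
  exact h3.symm.trans (coeFn_minkU _)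

/-- For square integrable data a partial inverse exists, so the default value in `partialInv` is not
taken, and the choice is immaterial up to null sets. -/
lemma partialInv_ae_eq (hh : MemLp (Function.uncurry h) 2 (ν.prod volume)) :
    Function.uncurry (partialInv ν h) =ᵐ[ν.prod volume] ampli ν minkU (hh.toLp _) := by
  have hex : ∃ F, IsPartialInv ν h F := ⟨_, isPartialInv_ampli hh⟩
  have h1 : IsPartialInv ν h (partialInv ν h) := by
    rw [partialInv, dif_pos hex]
    exact Classical.choose_spec hex
  exact h1.ae_eq hh

end PartialInv

/-! ### Weyl operators -/

section Weyl

/-- The map `(x, t) ↦ (x + t/2, x - t/2)`. -/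
def shearMap (p : Plane × Plane) : Plane × Plane :=
  (p.1 + (1 / 2 : ℝ) • p.2, p.1 - (1 / 2 : ℝ) • p.2)

/-- The map is a composition of shears: with `z = x + t/2` the second coordinate is `z - t`. -/
lemma measurePreserving_shearMap :
    MeasurePreserving shearMap (volume : Measure (Plane × Plane)) volume := by
  have h1 : MeasurePreserving (fun p : Plane × Plane => (p.1, p.2 + (1 / 2 : ℝ) • p.1))
      (volume : Measure (Plane × Plane)) volume :=
    MeasurePreserving.skew_product (g := fun t x => x + (1 / 2 : ℝ) • t)
      (MeasurePreserving.id (volume : Measure Plane)) (by fun_prop)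
      (.of_forall fun t => (measurePreserving_add_right volume _).map_eq)
  have h2 : MeasurePreserving (fun p : Plane × Plane => (p.1, p.1 - p.2))
      (volume : Measure (Plane × Plane)) volume :=
    MeasurePreserving.skew_product (g := fun z t => z - t)
      (MeasurePreserving.id (volume : Measure Plane)) (by fun_prop)
      (.of_forall fun z => (Measure.measurePreserving_sub_left volume z).map_eq)
  have hs : MeasurePreserving (Prod.swap : Plane × Plane → Plane × Plane)
      (volume : Measure (Plane × Plane)) volume := Measure.measurePreserving_swap
  have h3 := h2.comp (hs.comp (h1.comp hs))
  refine (congrArg (fun f => MeasurePreserving f (volume : Measure (Plane × Plane)) volume)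
    (funext fun p => ?_)).mp h3
  refine Prod.ext rfl ?_
  simp only [Function.comp, Prod.swap, shearMap]
  module

lemma memLp_twist {K : Plane → Plane → ℂ}
    (hK : MemLp (Function.uncurry K) 2 (volume : Measure (Plane × Plane))) :
    MemLp (Function.uncurry (twist K)) 2 (volume : Measure (Plane × Plane)) :=
  hK.comp_measurePreserving measurePreserving_shearMap

lemma memLp_comp_affine (u : L2Plane) (x : Plane) {r : ℝ} (hr : r ≠ 0) :
    MemLp (fun q => u (x + r • q)) 2 volume := by
  have h : Measure.map (fun q : Plane => x + r • q) volume =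
      ENNReal.ofReal |(r ^ Module.finrank ℝ Plane)⁻¹| • (volume : Measure Plane) := by
    rw [← Function.comp_def (fun y => x + y) (fun q => r • q),
      ← Measure.map_map (by fun_prop) (by fun_prop), Measure.map_addHaar_smul _ hr,
      Measure.map_smul, (measurePreserving_add_left volume x).map_eq]
  refine MemLp.comp_of_map (f := fun q : Plane => x + r • q) (g := u) ?_ (by fun_prop)
  rw [h]
  exact (Lp.memLp u).smul_measure (by simp)

/-- The function `(x, q) ↦ conj (u(x + q/2)) v(x - q/2)`. -/
def correl (u v : L2Plane) (p : Plane × Plane) : ℂ :=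
  conj (u (p.1 + (1 / 2 : ℝ) • p.2)) * v (p.1 - (1 / 2 : ℝ) • p.2)

lemma memLp_correl (u v : L2Plane) : MemLp (correl u v) 2 (volume : Measure (Plane × Plane)) := by
  have h : MemLp (fun p : Plane × Plane => conj (u p.1) * v p.2) 2
      (volume : Measure (Plane × Plane)) :=
    memLp_mul_prod (show MemLp (fun x => conj (u x)) 2 volume from (Lp.memLp u).star) (Lp.memLp v)
  have h2 := h.comp_measurePreserving measurePreserving_shearMap
  rw [show correl u v = (fun p : Plane × Plane => conj (u p.1) * v p.2) ∘ shearMap from rfl]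
  exact h2

lemma integrable_correl (u v : L2Plane) (x : Plane) : Integrable fun q => correl u v (x, q) := by
  refine integrable_conj_mul (memLp_comp_affine u x (by norm_num)) ?_
  have := memLp_comp_affine v x (r := -(1 / 2)) (by norm_num)
  simpa only [neg_smul, ← sub_eq_add_neg] using this

lemma stronglyMeasurable_minkInt_correl (u v : L2Plane) :
    StronglyMeasurable fun p : Plane × Plane => minkInt (fun q => correl u v (p.1, q)) p.2 := by
  unfold minkInt
  refine StronglyMeasurable.const_mul ?_ _
  refine StronglyMeasurable.integral_prod_right' (f := fun z : (Plane × Plane) × Plane =>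
    Complex.exp (-(Complex.I * (mink z.2 z.1.2 : ℂ))) * correl u v (z.1.1, z.2)) ?_
  have hu := (Lp.stronglyMeasurable u).measurable
  have hv := (Lp.stronglyMeasurable v).measurable
  refine Measurable.stronglyMeasurable ?_
  unfold correl mink
  fun_prop

lemma minkInt_correl_ae_eq (u v : L2Plane) :
    (fun p : Plane × Plane => minkInt (fun q => correl u v (p.1, q)) p.2) =ᵐ[volume]
      ampli volume minkU ((memLp_correl u v).toLp _) := by
  refine ae_eq_ampli minkU (memLp_correl u v)
    (stronglyMeasurable_minkInt_correl u v).aestronglyMeasurable ?_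
  filter_upwards [ae_memLp_section (memLp_correl u v)] with x hx
  rw [slice_of_memLp hx]
  exact (coeFn_minkU_toLp (integrable_correl u v x) hx).symm

/-- The reflection `(ξ₁, ξ₂) ↦ (-ξ₁, ξ₂)`. -/
def reflMap (ξ : Plane) : Plane := !₂[-(ξ 0), ξ 1]

lemma measurePreserving_reflMap : MeasurePreserving reflMap volume volume := by
  have h := isWeighted_scaleMap (s := -1) (t := 1) (c := 1) one_pos (by norm_num)
  have e : reflMap = scaleMap (-1) 1 := by
    funext x
    rw [scaleMap_apply, reflMap]
    simp
  refine ⟨e ▸ h.measurable_map, ?_⟩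
  simpa [e] using h.map_eq

lemma measurePreserving_id_reflMap :
    MeasurePreserving (Prod.map id reflMap) (volume : Measure (Plane × Plane)) volume :=
  (MeasurePreserving.id volume).prod measurePreserving_reflMap

/-- Since `⟨q; (-ξ₁, ξ₂)⟩ = -ξ·q`, the reflection turns the Minkowski phase into the Euclidean one.
This accounts for the argument `(-ξ₁, ξ₂)` in the Weyl symbol. -/
lemma wigner_eq (u v : L2Plane) (x ξ : Plane) :
    wigner u v x ξ = conj (minkInt (fun q => correl u v (x, q)) (reflMap ξ)) := by
  rw [wigner, minkInt, map_mul, ← integral_conj]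
  congr 1
  · simp only [map_inv₀, map_mul, map_ofNat, Complex.conj_ofReal]
  · refine integral_congr_ae (.of_forall fun q => ?_)
    have e : mink q (reflMap ξ) = -inner ℝ ξ q := by
      simp [mink, reflMap, PiLp.inner_apply, Fin.sum_univ_two]
      ring
    simp only [e, correl, map_mul, Complex.conj_conj, ← Complex.exp_conj, map_neg, Complex.conj_I,
      Complex.conj_ofReal]
    push_cast
    ring_nf

/-- Both factors are partial Minkowski–Fourier transforms, up to the common reflection. Unitarity
removes the transforms, and the measure preserving shear undoes the twist. The function `u` ends in
the first variable of `K`, so the Weyl operator has the transposed kernel. -/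
lemma integral_mul_wigner {K : Plane → Plane → ℂ}
    (hK : MemLp (Function.uncurry K) 2 (volume : Measure (Plane × Plane))) (u v : L2Plane) :
    ∫ p : Plane × Plane, partialInv volume (twist K) p.1 (reflMap p.2) * wigner u v p.1 p.2 =
      ∫ p : Plane × Plane, u p.1 * conj (v p.2) * K p.1 p.2 := by
  have hT := memLp_twist hK
  have hq := measurePreserving_id_reflMap.quasiMeasurePreserving
  have h1 : ∀ᵐ p : Plane × Plane,
      partialInv volume (twist K) p.1 (reflMap p.2) * wigner u v p.1 p.2 =
        (fun p => conj (ampli volume minkU ((memLp_correl u v).toLp _) p) *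
          ampli volume minkU (hT.toLp _) p) (Prod.map id reflMap p) := by
    filter_upwards [hq.ae (partialInv_ae_eq hT), hq.ae (minkInt_correl_ae_eq u v)] with p h2 h3
    rw [wigner_eq, mul_comm]
    exact congrArg₂ (· * ·) (congrArg conj h3) h2
  have hm : MeasurableEmbedding (Prod.map (id : Plane → Plane) reflMap) := by
    have hi : Function.Involutive (Prod.map (id : Plane → Plane) reflMap) := by
      intro p
      refine Prod.ext rfl ?_
      simp only [Prod.map, reflMap]
      ext k
      fin_cases k <;> simp
    exact (MeasurableEquiv.ofInvolutive _ hi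
      measurePreserving_id_reflMap.measurable).measurableEmbedding
  rw [integral_congr_ae h1, measurePreserving_id_reflMap.integral_comp hm
    (g := fun p => conj (ampli volume minkU ((memLp_correl u v).toLp _) p) *
          ampli volume minkU (hT.toLp _) p)]
  have h4 := inner_eq_integral (ampli volume minkU ((memLp_correl u v).toLp _))
    (ampli volume minkU (hT.toLp _))
  rw [LinearIsometryEquiv.inner_map_map, inner_toLp] at h4
  refine h4.symm.trans ?_
  have hs : AEStronglyMeasurable (fun p : Plane × Plane => u p.1 * conj (v p.2) * K p.1 p.2)
      (Measure.map shearMap (volume : Measure (Plane × Plane))) := by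
    rw [measurePreserving_shearMap.map_eq]
    exact ((Lp.aestronglyMeasurable u).comp_fst.mul
      (Lp.aestronglyMeasurable v).star.comp_snd).mul hK.1
  have h5 := integral_map measurePreserving_shearMap.aemeasurable hs
  rw [measurePreserving_shearMap.map_eq] at h5
  rw [h5]
  refine integral_congr_ae (.of_forall fun p => ?_)
  simp [correl, shearMap, Function.uncurry, twist]

/-- Weyl operators as integral operators. -/
lemma isWeyl_kerOp {K : Plane → Plane → ℂ}
    (hK : MemLp (Function.uncurry K) 2 (volume : Measure (Plane × Plane))) :
    IsWeyl (fun x ξ => partialInv volume (twist K) x (reflMap ξ))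
      ((2 * Real.pi : ℂ)⁻¹ • kerOp (swapL2 (hK.toLp _))) := by
  constructor
  · have h : MemLp (Function.uncurry (partialInv volume (twist K))) 2
        (volume : Measure (Plane × Plane)) :=
      (memLp_congr_ae (partialInv_ae_eq (memLp_twist hK))).2 (Lp.memLp _)
    exact h.comp_measurePreserving measurePreserving_id_reflMap
  · intro u v
    rw [integral_mul_wigner hK, _root_.smul_apply, inner_smul_right, inner_kerOp_eq_integral,
      ← integral_prod_swap]
    congr 1
    refine integral_congr_ae ?_
    filter_upwards [Measure.measurePreserving_swap.quasiMeasurePreserving.ae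
      (coeFn_swapL2 (hK.toLp _)), hK.coeFn_toLp] with p h1 h2
    rw [h1, Prod.swap_swap, h2]
    simp [Function.uncurry, mul_comm]

lemma IsWeyl.unique {τ : Plane → Plane → ℂ} {W W' : L2Plane →L[ℂ] L2Plane} (h : IsWeyl τ W)
    (h' : IsWeyl τ W') : W = W' := by
  ext1 u
  refine ext_inner_left ℂ fun v => ?_
  rw [h.2, h'.2]

end Weyl

/-! ### Complex conjugation -/

section Star

variable {X Y : Type} [MeasurableSpace X] [MeasurableSpace Y] {μ : Measure X} {ν : Measure Y}
  [SFinite μ] [SFinite ν]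

lemma star_tmul (u : Lp ℂ 2 μ) (v : Lp ℂ 2 ν) : star (tmul u v) = tmul (star u) (star v) := by
  apply Lp.ext
  filter_upwards [Lp.coeFn_star (tmul u v), coeFn_tmul u v, coeFn_tmul (star u) (star v),
    ae_fst (ν := ν) (Lp.coeFn_star u), ae_snd (μ := μ) (Lp.coeFn_star v)] with p h1 h2 h3 h4 h5
  rw [h1, h3, h4, h5, Pi.star_apply, h2, Pi.star_apply, Pi.star_apply, star_mul']

lemma inner_star_left_L2 (f g : Lp ℂ 2 μ) : inner ℂ (star f) g = inner ℂ (star g) f := by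
  rw [← inner_star_star, star_star]

lemma swapL2_star (k : Lp ℂ 2 (μ.prod ν)) : swapL2 (star k) = star (swapL2 k) := by
  apply Lp.ext
  filter_upwards [coeFn_swapL2 (star k), Lp.coeFn_star (swapL2 k), coeFn_swapL2 k,
    Measure.measurePreserving_swap.quasiMeasurePreserving.ae (Lp.coeFn_star k)] with p h1 h2 h3 h4
  rw [h1, h4, h2, Pi.star_apply, Pi.star_apply, h3]

lemma resL2_star {μ' : Measure X} {s : Set X} (h : μ' = μ.restrict s) (f : Lp ℂ 2 μ) :
    resL2 h (star f) = star (resL2 h f) := by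
  apply Lp.ext
  filter_upwards [coeFn_resL2 h (star f), Lp.coeFn_star (resL2 h f), coeFn_resL2 h f,
    ae_of_eq_restrict h (Lp.coeFn_star f)] with x h1 h2 h3 h4
  rw [h1, h2, h4, Pi.star_apply, Pi.star_apply, h3]

lemma IsWeighted.equiv_symm_star {ρ : Measure X} {W : Measure Y} {Ψ : X → Y} {Φ : Y → X}
    {w : X → ℝ} (h : IsWeighted ρ W Ψ Φ w) (F : Lp ℂ 2 ρ) :
    h.equiv.symm (star F) = star (h.equiv.symm F) := by
  apply Lp.ext
  filter_upwards [h.coeFn_equiv_symm (star F), Lp.coeFn_star (h.equiv.symm F),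
    h.coeFn_equiv_symm F, h.quasi_inv.ae (Lp.coeFn_star F)] with x h1 h2 h3 h4
  rw [h1, h2, h4, Pi.star_apply, Pi.star_apply, h3]
  simp

variable [MeasurableSpace.CountablyGenerated Y]

/-- The relation between `M`, its inverse and conjugation passes to `1 ⊗ M`, since it can be tested
on tensors. -/
lemma ampli_symm_star {M : Lp ℂ 2 ν ≃ₗᵢ[ℂ] Lp ℂ 2 ν}
    (hM : ∀ u, M.symm (star u) = star (M u)) (F : Lp ℂ 2 (μ.prod ν)) :
    (ampli μ M).symm (star F) = star (ampli μ M F) := by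
  refine sub_eq_zero.1 (tmul_total fun v u => ?_)
  have h : (ampli μ M).symm (tmul (star v) (star u)) = star (tmul v (M u)) := by
    rw [LinearIsometryEquiv.symm_apply_eq, star_tmul, ampli_tmul, ← hM,
      LinearIsometryEquiv.apply_symm_apply]
  rw [inner_sub_right, ← (ampli μ M).inner_map_map, LinearIsometryEquiv.apply_symm_apply,
    ampli_tmul, ← star_star (tmul v u), inner_star_star, star_tmul,
    ← (ampli μ M).symm.inner_map_map (ampli μ M F), h, LinearIsometryEquiv.symm_apply_apply,
    ← inner_star_star (star (tmul v (M u))) F, star_star, sub_self]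

end Star

/-! ### The Weyl form -/

section WeylForm

lemma grpSwap_star (f : L2Grp) : grpSwap (star f) = star (grpSwap f) :=
  swapL2_star (μ := (volume : Measure Plane)) (ν := haarA) f

/-- Conjugation exchanges `partialMink.symm`, used in the group Fourier transform, with
`partialMink`, used in the Weyl symbol. -/
lemma fourierKer_star (i j : Fin 2) (f : L2Grp) : fourierKer i j (star f) =
    star ((isWeighted_cone i j).equiv.symm (coneRes i j (partialMink (grpSwap f)))) := by
  rw [fourierKer, grpSwap_star, partialMink, ampli_symm_star minkU_symm_star, coneRes, resL2_star,
    IsWeighted.equiv_symm_star, coneRes]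

lemma prod_coneVol_self (i j : Fin 2) : (coneVol i j).prod (coneVol i j) =
    (volume : Measure (Plane × Plane)).restrict (cone i j ×ˢ cone i j) :=
  Measure.prod_restrict _ _

lemma partialInvGrp_ae_eq {β : Grp → ℂ} (hβ : MemLp β 2 haarL) :
    (fun p => partialInvGrp β (p.2, p.1)) =ᵐ[haarA.prod volume]
      partialMink (grpSwap (hβ.toLp β)) := by
  have h1 : MemLp (Function.uncurry fun q b => β (b, q)) 2 (haarA.prod volume) :=
    hβ.comp_measurePreserving
      (Measure.measurePreserving_swap (μ := haarA) (ν := (volume : Measure Plane)))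
  have h2 : h1.toLp _ = grpSwap (hβ.toLp β) := by
    apply Lp.ext
    have h3 : ∀ᵐ p ∂(haarA.prod (volume : Measure Plane)), hβ.toLp β p.swap = β p.swap :=
      (Measure.measurePreserving_swap (μ := haarA)
        (ν := (volume : Measure Plane))).quasiMeasurePreserving.ae hβ.coeFn_toLp
    have h4 : ∀ᵐ p ∂(haarA.prod (volume : Measure Plane)),
        grpSwap (hβ.toLp β) p = hβ.toLp β p.swap :=
      coeFn_swapL2 (μ := (volume : Measure Plane)) (ν := haarA) (hβ.toLp β)
    filter_upwards [h1.coeFn_toLp, h3, h4] with p h5 h6 h7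
    rw [h5, h7, h6]
    rfl
  rw [partialMink, ← h2]
  exact partialInv_ae_eq h1

/-- From `a'² = |⟨ξ; ξ⟩| / |⟨x; x⟩|` it follows that `coneWeight = |⟨ξ; ξ⟩| / |⟨x; x⟩|^{1/2}`, and
its reciprocal is the weight in `symKernel`. -/
lemma symKernel_ae_eq (g : Grp) {β : Grp → ℂ} (hβ : MemLp β 2 haarL) (i j : Fin 2) :
    ∀ᵐ p ∂((coneVol i j).prod (coneVol i j)), symKernel g β p.1 p.2 =
      (2 * Real.pi * (dilPar g)⁻¹ : ℂ) * star (fourierKer i j (star (hβ.toLp β))) p := by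
  rw [fourierKer_star, star_star]
  have h1 : ∀ᵐ q ∂(haarA.prod (coneVol i j)),
      coneRes i j (partialMink (grpSwap (hβ.toLp β))) q = partialInvGrp β (q.2, q.1) := by
    filter_upwards [coeFn_resL2 (prod_coneVol i j) (partialMink (grpSwap (hβ.toLp β))),
      ae_of_eq_restrict (prod_coneVol i j) (partialInvGrp_ae_eq hβ)] with q h1 h2
    rw [coneRes, h1, h2]
  filter_upwards [(isWeighted_cone i j).coeFn_equiv_symm
      (coneRes i j (partialMink (grpSwap (hβ.toLp β)))), (isWeighted_cone i j).quasi_inv.ae h1,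
    ae_fst (ν := coneVol i j) (ae_restrict_mem (measurableSet_cone i j)),
    ae_snd (μ := coneVol i j) (ae_restrict_mem (measurableSet_cone i j))] with p h2 h3 h4 h5
  have hs : SameCone p.1 p.2 := ⟨i, j, h4, h5⟩
  have hx := mink_self_ne_zero h4
  have hy := mink_self_ne_zero h5
  have ha := (dilPar_pos g).ne'
  rw [h2, h3, symKernel, dif_pos hs]
  simp only [coneInv, coneParam_of_sameCone hs]
  rw [← mul_assoc]
  refine congrArg₂ (· * ·) ?_ rfl
  have hd : dilOf p.1 p.2 ^ 2 = |mink p.2 p.2| / |mink p.1 p.1| := by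
    rw [dilOf, Real.sq_sqrt hs.ratio_pos.le, ← abs_div, abs_of_pos hs.ratio_pos]
  have h6 : coneWeight ((transport hs).2, p.1) =
      |mink p.2 p.2| / |mink p.1 p.1| * √|mink p.1 p.1| := by
    rw [coneWeight, ← hd]
    rfl
  have hx' := abs_pos.2 hx
  have hy' := abs_pos.2 hy
  have h7 : 2 * Real.pi / dilPar g * (√|mink p.1 p.1| / |mink p.2 p.2|) =
      2 * Real.pi * (dilPar g)⁻¹ * (|mink p.2 p.2| / |mink p.1 p.1| * √|mink p.1 p.1|)⁻¹ := by
    have h8 := Real.sq_sqrt hx'.le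
    have h9 := Real.sqrt_pos.2 hx'
    field_simp
    exact h8
  rw [h6, h7]
  push_cast
  rfl

/-- The blocks of the kernel `symKernel`. -/
def blockKer (g : Grp) (β : L2Grp) (i j : Fin 2) : Lp ℂ 2 ((coneVol i j).prod (coneVol i j)) :=
  (2 * Real.pi * (dilPar g)⁻¹ : ℂ) • star (fourierKer i j (star β))

/-- The kernel vanishes unless both points lie in one cone, so it is a sum of four diagonal blocks,
each square integrable by `symKernel_ae_eq`. -/
lemma memLp_symKernel (g : Grp) {β : Grp → ℂ} (hβ : MemLp β 2 haarL) :
    MemLp (Function.uncurry (symKernel g β)) 2 (volume : Measure (Plane × Plane)) := by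
  have hms : ∀ p : Fin 2 × Fin 2, MeasurableSet (cone p.1 p.2 ×ˢ cone p.1 p.2) := fun p =>
    (measurableSet_cone _ _).prod (measurableSet_cone _ _)
  set F : Fin 2 × Fin 2 → Plane × Plane → ℂ := fun p =>
    (cone p.1 p.2 ×ˢ cone p.1 p.2).indicator (blockKer g (hβ.toLp β) p.1 p.2)
  have hF : ∀ p, MemLp (F p) 2 (volume : Measure (Plane × Plane)) := fun p =>
    (memLp_indicator_iff_restrict (hms p)).2 (by
      rw [← prod_coneVol_self]; exact Lp.memLp _)
  refine (memLp_congr_ae ?_).2 (memLp_finsetSum' Finset.univ fun p _ => hF p)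
  have h1 : ∀ᵐ z : Plane × Plane, ∀ p : Fin 2 × Fin 2, z ∈ cone p.1 p.2 ×ˢ cone p.1 p.2 →
      symKernel g β z.1 z.2 = blockKer g (hβ.toLp β) p.1 p.2 z := by
    rw [ae_all_iff]
    intro p
    refine ae_imp_of_eq_restrict (hms p) (prod_coneVol_self p.1 p.2) ?_
    filter_upwards [symKernel_ae_eq g hβ p.1 p.2, Lp.coeFn_smul (2 * Real.pi * (dilPar g)⁻¹ : ℂ)
      (star (fourierKer p.1 p.2 (star (hβ.toLp β))))] with z h1 h2
    rw [h1, blockKer, h2]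
    rfl
  filter_upwards [h1] with z hz
  rw [Finset.sum_apply]
  by_cases hs : SameCone z.1 z.2
  · obtain ⟨i, j, h2, h3⟩ := hs
    have hz2 : z ∈ cone i j ×ˢ cone i j := ⟨h2, h3⟩
    rw [Finset.sum_eq_single (i, j)]
    · exact (hz (i, j) hz2).trans (Set.indicator_of_mem (by exact hz2) _).symm
    · intro p _ hp
      refine Set.indicator_of_notMem (fun h => hp ?_) _
      obtain ⟨h4, h5⟩ := cone_unique h.1 h2
      exact Prod.ext h4 h5
    · simp
  · rw [Function.uncurry, symKernel, dif_neg hs, Finset.sum_eq_zero]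
    exact fun p _ => Set.indicator_of_notMem (fun h => hs ⟨p.1, p.2, h.1, h.2⟩) _

lemma extendZero_eq {i j : Fin 2} (φ : L2Cone i j) :
    extendZero φ = extL2 (measurableSet_cone i j) rfl φ := rfl

lemma extendZero_injective {i j : Fin 2} :
    Function.Injective (extendZero : L2Cone i j → L2Plane) := by
  intro φ ψ h
  apply Lp.ext
  have h1 := coeFn_extL2 (measurableSet_cone i j) rfl φ
  rw [← extendZero_eq, h, extendZero_eq] at h1
  filter_upwards [ae_restrict_of_ae h1,
    ae_restrict_of_ae (coeFn_extL2 (measurableSet_cone i j) rfl ψ),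
    ae_restrict_mem (measurableSet_cone i j)] with x h2 h3 h4
  rw [h2, Set.indicator_of_mem h4, Set.indicator_of_mem h4] at h3
  exact h3

lemma integral_cone_prod (i j : Fin 2) (F : Plane × Plane → ℂ) :
    ∫ p, F p ∂((coneVol i j).prod (coneVol i j)) =
      ∫ p : Plane × Plane, (cone i j ×ˢ cone i j).indicator (fun p => F p.swap) p := by
  rw [integral_indicator ((measurableSet_cone _ _).prod (measurableSet_cone _ _)),
    ← prod_coneVol_self, integral_prod_swap]

/-- The transposition in the Weyl operator and the conjugation in `symKernel_ae_eq` together form an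
adjoint. The two factors `2π` cancel and leave `a⁻¹`; the block structure keeps the image in the
same cone. -/
lemma kerOp_symKernel_extendZero (g : Grp) {β : Grp → ℂ} (hβ : MemLp β 2 haarL) {i j : Fin 2}
    (φ : L2Cone i j) :
    ((2 * Real.pi : ℂ)⁻¹ • kerOp (swapL2 ((memLp_symKernel g hβ).toLp _))) (extendZero φ) =
      extendZero (((dilPar g)⁻¹ : ℂ) • (kerOp (fourierKer i j (star (hβ.toLp β)))).adjoint φ) := by
  have hp : (Real.pi : ℂ) ≠ 0 := by exact_mod_cast Real.pi_ne_zero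
  have hms : MeasurableSet (cone i j ×ˢ cone i j) :=
    (measurableSet_cone _ _).prod (measurableSet_cone _ _)
  refine ext_inner_left ℂ fun v => ?_
  set k := fourierKer i j (star (hβ.toLp β)) with hk
  rw [kerOp_adjoint, extendZero_eq (((dilPar g)⁻¹ : ℂ) • _), ← inner_conj_symm v (extL2 _ _ _),
    inner_extL2, inner_conj_symm, inner_smul_right, inner_kerOp_eq_integral,
    _root_.smul_apply, inner_smul_right, inner_kerOp_eq_integral,
    integral_cone_prod, ← integral_prod_swap, ← integral_const_mul, ← integral_const_mul]
  refine integral_congr_ae ?_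
  have h1 : ∀ᵐ p : Plane × Plane, p ∈ cone i j ×ˢ cone i j → star (swapL2 k) p.swap = star k p ∧
      symKernel g β p.1 p.2 = (2 * Real.pi * (dilPar g)⁻¹ : ℂ) * star k p ∧
      resL2 (μ' := coneVol i j) (rfl : _ = volume.restrict (cone i j)) v p.2 = v p.2 := by
    refine ae_imp_of_eq_restrict hms (prod_coneVol_self i j) ?_
    filter_upwards [symKernel_ae_eq g hβ i j, Measure.measurePreserving_swap.quasiMeasurePreserving.ae
      (coeFn_swapL2 (star k)), ae_snd (μ := coneVol i j) (coeFn_resL2 rfl v)] with p h1 h2 h3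
    refine ⟨?_, h1, h3⟩
    rw [← swapL2_star, h2, Prod.swap_swap]
  filter_upwards [h1, Measure.measurePreserving_swap.quasiMeasurePreserving.ae
    (coeFn_swapL2 ((memLp_symKernel g hβ).toLp _)), (memLp_symKernel g hβ).coeFn_toLp,
    ae_fst (ν := (volume : Measure Plane)) (coeFn_extL2 (measurableSet_cone i j) rfl φ)]
    with p h2 h3 h4 h5
  rw [h3, Prod.swap_swap, h4, Prod.fst_swap, Prod.snd_swap, extendZero_eq, h5, Function.uncurry]
  by_cases hpc : p ∈ cone i j ×ˢ cone i j
  · obtain ⟨h6, h7, h8⟩ := h2 hpc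
    rw [Set.indicator_of_mem hpc, Set.indicator_of_mem hpc.1, h7, h6, Prod.fst_swap, Prod.snd_swap, h8]
    push_cast
    field_simp
  · rw [Set.indicator_of_notMem hpc, mul_zero]
    by_cases h6 : p.1 ∈ cone i j
    · have : ¬ SameCone p.1 p.2 := by
        rintro ⟨i', j', h7, h8⟩
        obtain ⟨rfl, rfl⟩ := cone_unique h6 h7
        exact hpc ⟨h6, h8⟩
      rw [symKernel, dif_neg this, mul_zero, mul_zero]
    · rw [Set.indicator_of_notMem h6, mul_zero, zero_mul, mul_zero]

/-- The Weyl form in terms of the group Fourier transform. -/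
lemma hasWeylForm_iff {σ : OpSymbol} {α : Grp → Grp → ℂ} (hα : ∀ g, MemLp (α g) 2 haarL) :
    HasWeylForm σ α ↔ ∀ g i j, twisted σ g i j =
      ((dilPar g)⁻¹ : ℂ) • (groupFourier i j (star ((hα g).toLp (α g)))).adjoint := by
  have hW := fun g => isWeyl_kerOp (memLp_symKernel g (hα g))
  constructor
  · intro h g i j
    obtain ⟨W, hW1, hW2⟩ := h g
    obtain rfl := hW1.unique (hW g)
    ext1 φ
    apply extendZero_injective
    rw [← hW2, kerOp_symKernel_extendZero g (hα g), groupFourier_eq, _root_.smul_apply]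
  · intro h g
    refine ⟨_, hW g, fun i j φ => ?_⟩
    rw [kerOp_symKernel_extendZero g (hα g), h, groupFourier_eq, _root_.smul_apply]

end WeylForm

/-! ### Products of integral operators -/

section Products

variable {X Y : Type} [MeasurableSpace X] [MeasurableSpace Y] {μ : Measure X} {ν : Measure Y}
  [SFinite μ] [SFinite ν] [MeasurableSpace.CountablyGenerated X]
  [MeasurableSpace.CountablyGenerated Y]

lemma coeFn_kerOp_slice {k : X × Y → ℂ} (hk : MemLp k 2 (μ.prod ν)) (u : Lp ℂ 2 ν) :
    kerOp (hk.toLp k) u =ᵐ[μ] fun x => inner ℂ (star (slice ν k x)) u := by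
  filter_upwards [coeFn_partialInner (star u) (hk.toLp k), ae_slice_congr hk.coeFn_toLp]
    with x h1 h2
  rw [kerOp_apply, h1, h2, inner_star_left_L2]

lemma coeFn_star_kerOp_adjoint {k : X × Y → ℂ} (hk : MemLp k 2 (μ.prod ν)) (u : Lp ℂ 2 μ) :
    (star ((kerOp (hk.toLp k)).adjoint (star u)) : Lp ℂ 2 ν) =ᵐ[ν] fun y => ∫ x, u x * k (x, y) ∂μ := by
  have h1 : ∀ᵐ q ∂(ν.prod μ), star (swapL2 (hk.toLp k)) q = conj (k q.swap) := by
    filter_upwards [Lp.coeFn_star (swapL2 (hk.toLp k)), coeFn_swapL2 (hk.toLp k),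
      Measure.measurePreserving_swap.quasiMeasurePreserving.ae hk.coeFn_toLp] with q h1 h2 h3
    rw [h1, Pi.star_apply, h2, h3]
    rfl
  rw [kerOp_adjoint]
  filter_upwards [Lp.coeFn_star (kerOp (star (swapL2 (hk.toLp k))) (star u)),
    coeFn_kerOp (star (swapL2 (hk.toLp k))) (star u), Measure.ae_ae_of_ae_prod h1] with y h2 h3 h4
  rw [h2, Pi.star_apply, h3, RCLike.star_def, ← integral_conj]
  refine integral_congr_ae ?_
  filter_upwards [h4, Lp.coeFn_star u] with x h5 h6
  rw [h5, h6]
  simp [mul_comm]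

/-- The section of the kernel of a product of integral operators. -/
def compKer (k : X × Y → ℂ) (B : Lp ℂ 2 μ →L[ℂ] Lp ℂ 2 ν) (x : X) : Lp ℂ 2 μ :=
  star (B.adjoint (star (slice ν k x)))

/-- The integral of `k(x, ·)` against `B f` is an inner product, and `B` is moved to the other side.
-/
lemma coeFn_kerOp_comp {k : X × Y → ℂ} (hk : MemLp k 2 (μ.prod ν))
    (B : Lp ℂ 2 μ →L[ℂ] Lp ℂ 2 ν) (f : Lp ℂ 2 μ) :
    (kerOp (hk.toLp k) ∘L B) f =ᵐ[μ] fun x => inner ℂ (star (compKer k B x)) f := by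
  filter_upwards [coeFn_kerOp_slice hk (B f)] with x h1
  rw [ContinuousLinearMap.comp_apply, h1, compKer, star_star,
    ContinuousLinearMap.adjoint_inner_left]

/-- The formula holds at each `x` with square integrable section, not only at almost every `x`. -/
lemma coeFn_compKer {k : X × Y → ℂ} {l : Y × X → ℂ} (hl : MemLp l 2 (ν.prod μ)) {x : X}
    (hx : MemLp (fun y => k (x, y)) 2 ν) :
    compKer k (kerOp (hl.toLp l)) x =ᵐ[μ] fun z => ∫ y, k (x, y) * l (y, z) ∂ν := by
  filter_upwards [coeFn_star_kerOp_adjoint hl (slice ν k x)] with z h1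
  rw [compKer, h1]
  refine integral_congr_ae ?_
  rw [slice_of_memLp hx]
  filter_upwards [hx.coeFn_toLp] with y h2
  rw [h2]

/-- The trace of a product of two integral operators. -/
lemma hasSum_inner_kerOp_comp {ι : Type*} {k : X × Y → ℂ} {l : Y × X → ℂ}
    (hk : MemLp k 2 (μ.prod ν)) (hl : MemLp l 2 (ν.prod μ)) (b : HilbertBasis ι ℂ (Lp ℂ 2 μ)) :
    Integrable (fun x => ∫ y, k (x, y) * l (y, x) ∂ν) μ ∧
    HasSum (fun n => inner ℂ (b n) ((kerOp (hk.toLp k) ∘L kerOp (hl.toLp l)) (b n)))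
      (∫ x, ∫ y, k (x, y) * l (y, x) ∂ν ∂μ) := by
  have hl' : MemLp (fun p : X × Y => l p.swap) 2 (μ.prod ν) :=
    hl.comp_measurePreserving Measure.measurePreserving_swap
  have hi : Integrable (fun p : X × Y => k p * l p.swap) (μ.prod ν) := hk.integrable_mul hl'
  refine ⟨hi.integral_prod_left, ?_⟩
  -- The trace of `A B` is the Hilbert–Schmidt pairing of `A*` with `B`, and `A*` has the conjugate
  -- transposed kernel.
  have h1 := hasSum_inner_kerOp (star (swapL2 (hk.toLp k))) (hl.toLp l) b
  have h2 : inner ℂ (star (swapL2 (hk.toLp k))) (hl.toLp l) =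
      ∫ x, ∫ y, k (x, y) * l (y, x) ∂ν ∂μ := by
    refine Eq.trans ?_ (integral_prod _ hi)
    rw [inner_eq_integral, ← integral_prod_swap]
    refine integral_congr_ae ?_
    have h3 := (Measure.measurePreserving_swap (μ := μ) (ν := ν)).quasiMeasurePreserving.ae
      (((Lp.coeFn_star (swapL2 (hk.toLp k))).and (coeFn_swapL2 (hk.toLp k))).and hl.coeFn_toLp)
    filter_upwards [h3, hk.coeFn_toLp] with p h4 h5
    obtain ⟨⟨h6, h7⟩, h8⟩ := h4
    rw [h6, h8, Pi.star_apply, h7, Prod.swap_swap, h5]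
    simp
  rw [h2] at h1
  refine h1.congr_fun fun n => ?_
  rw [ContinuousLinearMap.comp_apply, ← kerOp_adjoint, ContinuousLinearMap.adjoint_inner_left]

end Products

/-! ### The kernel of a pseudo-differential operator -/

section Pdo

lemma modular_rpow (g : Grp) : modular g ^ (-(1 / 2) : ℝ) = dilPar g := by
  have ha := dilPar_pos g
  rw [modular, one_div, Real.inv_rpow (by positivity), Real.rpow_neg (by positivity), inv_inv,
    ← Real.sqrt_eq_rpow, Real.sqrt_sq ha.le]

lemma rep_comp_twisted (σ : OpSymbol) (g : Grp) (i j : Fin 2) :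
    dufloComp (σ g i j) = rep i j g ∘L twisted σ g i j := by
  ext1 φ
  rw [ContinuousLinearMap.comp_apply, twisted, ContinuousLinearMap.comp_apply, rep_rep_adjoint]

/-- The Weyl form of the symbol, for a map `α` into `L²` of the group. -/
def HasFourierForm (σ : OpSymbol) (α : Grp → L2Grp) : Prop :=
  ∀ g i j, twisted σ g i j = ((dilPar g)⁻¹ : ℂ) • (groupFourier i j (star (α g))).adjoint

/-- In the basis `π(g)* eₙ` the representation cancels, and each trace becomes `a⁻¹` times the
Hilbert–Schmidt pairing of the Fourier transforms of `conj (α g)` and `f`. Plancherel sums these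
over the cones, and `Δ^{-1/2} = a` removes `a⁻¹`. -/
lemma HasFourierForm.pdo_eq {σ : OpSymbol} {α : Grp → L2Grp} (h : HasFourierForm σ α)
    (f : L2Grp) (g : Grp) : pdo σ f g = inner ℂ (star (α g)) f := by
  have ha : (dilPar g : ℂ) ≠ 0 := by exact_mod_cast (dilPar_pos g).ne'
  have h1 : ∀ i j, opTrace (dufloComp (σ g i j) ∘L groupFourier i j f ∘L (rep i j g).adjoint) =
      ((dilPar g)⁻¹ : ℂ) * inner ℂ (fourierKer i j (star (α g))) (fourierKer i j f) := by
    intro i j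
    have h2 := (hasSum_inner_kerOp (fourierKer i j (star (α g))) (fourierKer i j f)
      (mapBasis (chosenBasis (L2Cone i j)) (repU i j g).symm)).mul_left ((dilPar g)⁻¹ : ℂ)
    rw [opTrace, ← h2.tsum_eq]
    refine tsum_congr fun n => ?_
    rw [rep_comp_twisted, h g i j, mapBasis_apply, ← rep_adjoint_apply, groupFourier_eq,
      groupFourier_eq]
    simp only [ContinuousLinearMap.comp_apply, _root_.smul_apply]
    rw [← ContinuousLinearMap.adjoint_inner_left, inner_smul_right,
      ContinuousLinearMap.adjoint_inner_right]
  rw [pdo, modular_rpow]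
  simp only [h1, ← Finset.mul_sum]
  rw [sum_inner_fourierKer, mul_inv_cancel_left₀ ha]

lemma IsPdo.unique {σ : OpSymbol} {S S' : L2Grp →L[ℂ] L2Grp} (h : IsPdo σ S) (h' : IsPdo σ S') :
    S = S' := by
  ext1 f
  exact Lp.ext ((h f).trans (h' f).symm)

lemma IsSqInt.memLp_uncurry {k : Grp → Grp → ℂ} (hk : IsSqInt k) :
    MemLp (Function.uncurry k) 2 (haarL.prod haarL) := by
  refine ⟨hk.aestronglyMeasurable, ?_⟩
  have h := hk.sqIntegrable
  have h2 : ∫⁻ g, eLpNorm (k g) 2 haarL ^ 2 ∂haarL =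
      eLpNorm (Function.uncurry k) 2 (haarL.prod haarL) ^ 2 :=
    lintegral_eLpNorm_sq (k := Function.uncurry k) hk.aestronglyMeasurable
  rw [h2] at h
  exact (ENNReal.pow_lt_top_iff.1 h).resolve_right two_ne_zero

/-- If the symbol is represented by `α`, `k₁`, `k₂`, then the product of the integral operators
with kernels `k₁` and `k₂` is `T_σ`. -/
lemma IsTraceRepr.isPdo {σ : OpSymbol} {α k₁ k₂ : Grp → Grp → ℂ} (h : IsTraceRepr σ α k₁ k₂) :
    IsPdo σ (kerOp (h.sqInt_left.memLp_uncurry.toLp _) ∘L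
      kerOp (h.sqInt_right.memLp_uncurry.toLp _)) := by
  intro f
  have hW := (hasWeylForm_iff h.weaklyContSqInt.memLp).1 h.weylForm
  filter_upwards [coeFn_kerOp_comp h.sqInt_left.memLp_uncurry
    (kerOp (h.sqInt_right.memLp_uncurry.toLp _)) f, h.factor] with g h1 h2
  rw [h1, HasFourierForm.pdo_eq hW]
  congr 2
  apply Lp.ext
  have h3 : MemLp (fun w => Function.uncurry k₁ (g, w)) 2 haarL := h.sqInt_left.memLp g
  filter_upwards [coeFn_compKer h.sqInt_right.memLp_uncurry h3,
    (h.weaklyContSqInt.memLp g).coeFn_toLp] with x h4 h5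
  rw [h4, h5, h2]
  rfl

/-- The diagonal is a null set of the product, but the factorization holds at every second argument.
So `α(g)(g)` is the diagonal value of the product kernel for almost every `g`. -/
lemma IsTraceRepr.trace {σ : OpSymbol} {α k₁ k₂ : Grp → Grp → ℂ} (h : IsTraceRepr σ α k₁ k₂)
    {S : L2Grp →L[ℂ] L2Grp} (hS : IsPdo σ S) {ι : Type*} (b : HilbertBasis ι ℂ L2Grp) :
    Integrable (fun g => α g g) haarL ∧
      HasSum (fun n => inner ℂ (b n) (S (b n))) (∫ g, α g g ∂haarL) := by
  obtain ⟨h1, h2⟩ := hasSum_inner_kerOp_comp h.sqInt_left.memLp_uncurry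
    h.sqInt_right.memLp_uncurry b
  have h3 : (fun g => α g g) =ᵐ[haarL] fun g =>
      ∫ w, Function.uncurry k₁ (g, w) * Function.uncurry k₂ (w, g) ∂haarL := by
    filter_upwards [h.factor] with g hg
    exact hg g
  refine ⟨h1.congr h3.symm, ?_⟩
  rw [hS.unique h.isPdo, integral_congr_ae h3]
  exact h2

end Pdo

/-! ### Existence of the representation -/

section Existence

open Classical in
/-- A representative of `k` all of whose sections are square integrable. -/
def secRep (k : Lp ℂ 2 (haarL.prod haarL)) (g w : Grp) : ℂ :=
  if MemLp (fun w => k (g, w)) 2 haarL then k (g, w) else 0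

lemma secRep_ae_eq (k : Lp ℂ 2 (haarL.prod haarL)) :
    Function.uncurry (secRep k) =ᵐ[haarL.prod haarL] k := by
  filter_upwards [ae_fst (ν := haarL) (ae_memLp_section (Lp.memLp k))] with p hp
  exact if_pos hp

lemma isSqInt_secRep (k : Lp ℂ 2 (haarL.prod haarL)) : IsSqInt (secRep k) := by
  have hm : AEStronglyMeasurable (Function.uncurry (secRep k)) (haarL.prod haarL) :=
    (Lp.aestronglyMeasurable k).congr (secRep_ae_eq k).symm
  refine ⟨hm, fun g => ?_, ?_⟩
  · by_cases h : MemLp (fun w => k (g, w)) 2 haarL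
    · have : secRep k g = fun w => k (g, w) := funext fun w => if_pos h
      rwa [this]
    · have : secRep k g = 0 := funext fun w => if_neg h
      rw [this]
      exact MemLp.zero
  · have h : ∫⁻ g, eLpNorm (secRep k g) 2 haarL ^ 2 ∂haarL =
        eLpNorm (Function.uncurry (secRep k)) 2 (haarL.prod haarL) ^ 2 :=
      lintegral_eLpNorm_sq (k := Function.uncurry (secRep k)) hm
    rw [h, eLpNorm_congr_ae (secRep_ae_eq k)]
    exact ENNReal.pow_lt_top (Lp.eLpNorm_lt_top k)

lemma toLp_secRep (k : Lp ℂ 2 (haarL.prod haarL)) :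
    (isSqInt_secRep k).memLp_uncurry.toLp _ = k :=
  Lp.ext ((MemLp.coeFn_toLp _).trans (secRep_ae_eq k))

lemma adjoint_smul_ofReal {H : Type} [NormedAddCommGroup H] [InnerProductSpace ℂ H]
    [CompleteSpace H] (a : ℝ) (T : H →L[ℂ] H) : ((a : ℂ) • T).adjoint = (a : ℂ) • T.adjoint := by
  rw [map_smulₛₗ, Complex.conj_ofReal]

lemma hsNorm2_twisted_adjoint {σ : OpSymbol} (hσ : IsAdmissible σ) (g : Grp) (i j : Fin 2) :
    hsNorm2 (twisted σ g i j).adjoint < ∞ := by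
  rw [hsNorm2_adjoint]
  exact hσ.twisted_hilbertSchmidt g i j

/-- The adjoint of the twisted symbol is Hilbert–Schmidt, so it has a kernel on each cone, and
surjectivity of the Plancherel map yields `γ`. -/
lemma exists_fourierForm {σ : OpSymbol} (hσ : IsAdmissible σ) (g : Grp) :
    ∃ γ : L2Grp, ∀ i j, groupFourier i j γ = (dilPar g : ℂ) • (twisted σ g i j).adjoint := by
  choose κ hκ using fun i j => exists_kerOp_eq (hsNorm2_twisted_adjoint hσ g i j)
  obtain ⟨γ, hγ⟩ := exists_fourierKer_eq fun i j => (dilPar g : ℂ) • κ i j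
  refine ⟨γ, fun i j => ?_⟩
  rw [groupFourier_eq, hγ, kerOp_smul, hκ]

lemma exists_hasFourierForm {σ : OpSymbol} (hσ : IsAdmissible σ) :
    ∃ α : Grp → L2Grp, HasFourierForm σ α ∧ ∀ ψ : L2Grp, Continuous fun g => inner ℂ ψ (α g) := by
  choose γ hγ using exists_fourierForm hσ
  refine ⟨fun g => star (γ g), fun g i j => ?_, fun ψ => ?_⟩
  · have ha : (dilPar g : ℂ) ≠ 0 := by exact_mod_cast (dilPar_pos g).ne'
    rw [star_star, hγ, adjoint_smul_ofReal, ContinuousLinearMap.adjoint_adjoint, smul_smul,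
      inv_mul_cancel₀ ha, one_smul]
  -- By Plancherel the pairing is `a` times a sum of `Tr(B* · twisted)` with fixed Hilbert–Schmidt
  -- `B`, namely the adjoint of the Fourier transform of `conj ψ`. The assumed weak continuity then
  -- applies.
  · have h1 : ∀ g, inner ℂ ψ (star (γ g)) = ∑ i, ∑ j, (dilPar g : ℂ) *
        opTrace (((kerOp (fourierKer i j (star ψ))).adjoint).adjoint ∘L twisted σ g i j) := by
      intro g
      rw [← star_star ψ, inner_star_star, star_star, ← sum_inner_fourierKer]
      refine Finset.sum_congr rfl fun i _ => Finset.sum_congr rfl fun j _ => ?_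
      set L := kerOp (fourierKer i j (star ψ)) with hL
      set b := chosenBasis (L2Cone i j) with hb
      obtain ⟨s, h2, h3⟩ := exists_hasSum_inner_adjoint
        (hsNorm2_twisted_adjoint hσ g i j) (hsNorm2_kerOp_lt_top (fourierKer i j (star ψ))) b b
      have h4 := hasSum_inner_kerOp (fourierKer i j (γ g)) (fourierKer i j (star ψ)) b
      rw [← groupFourier_eq, hγ] at h4
      have h5 : inner ℂ (fourierKer i j (γ g)) (fourierKer i j (star ψ)) = (dilPar g : ℂ) * s := by
        refine h4.unique ((h2.mul_left (dilPar g : ℂ)).congr_fun fun n => ?_)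
        rw [_root_.smul_apply, inner_smul_left, Complex.conj_ofReal]
      rw [h5, opTrace, ← h3.tsum_eq]
      congr 1
      refine tsum_congr fun n => ?_
      rw [ContinuousLinearMap.comp_apply, ContinuousLinearMap.adjoint_inner_left,
        ContinuousLinearMap.adjoint_adjoint, ContinuousLinearMap.adjoint_adjoint]
    simp only [h1]
    have hc : Continuous fun g : Grp => (dilPar g : ℂ) :=
      Complex.continuous_ofReal.comp (continuous_subtype_val.comp (continuous_fst.comp
        continuous_snd))
    refine continuous_finsetSum _ fun i _ => continuous_finsetSum _ fun j _ => hc.mul ?_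
    refine hσ.weaklyContinuous i j _ ?_
    rw [isHilbertSchmidt_iff, hsNorm2_adjoint]
    exact hsNorm2_kerOp_lt_top _

lemma exists_isTraceRepr {σ : OpSymbol} (hσ : IsAdmissible σ) {S : L2Grp →L[ℂ] L2Grp}
    (hS : IsPdo σ S) (hT : IsTraceClass S) : ∃ α k₁ k₂, IsTraceRepr σ α k₁ k₂ := by
  classical
  obtain ⟨A, B, hA, hB, rfl⟩ := hT.exists_comp
  obtain ⟨l₁, rfl⟩ := exists_kerOp_eq hA
  obtain ⟨l₂, rfl⟩ := exists_kerOp_eq hB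
  obtain ⟨α, hα, hαc⟩ := exists_hasFourierForm hσ
  have hk₁ := isSqInt_secRep l₁
  have hk₂ := isSqInt_secRep l₂
  set k₁ := secRep l₁
  set k₂ := secRep l₂
  -- Both sides are kernel sections of the same operator, so their pairings with each `u` agree
  -- almost everywhere.
  have hae : ∀ᵐ g ∂haarL, α g = compKer (Function.uncurry k₁) (kerOp l₂) g := by
    refine eq_of_ae_forall_inner fun u => ?_
    have h1 := coeFn_kerOp_comp hk₁.memLp_uncurry (kerOp l₂) (star u)
    rw [toLp_secRep] at h1
    filter_upwards [h1, hS (star u)] with g h2 h3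
    rw [h2, hα.pdo_eq] at h3
    rw [← inner_star_star, ← inner_star_star (compKer _ _ _), h3]
  have hker : ∀ g, compKer (Function.uncurry k₁) (kerOp l₂) g =ᵐ[haarL]
      fun h => ∫ w, k₁ g w * k₂ w h ∂haarL := by
    intro g
    have h1 : MemLp (fun w => Function.uncurry k₁ (g, w)) 2 haarL := hk₁.memLp g
    have h2 := coeFn_compKer hk₂.memLp_uncurry h1
    rw [toLp_secRep] at h2
    exact h2
  -- Where the two classes agree, the representative is the pointwise integral, so the factorization
  -- holds at all `h`. At the remaining `g`, a null set, `α g` is retained so that the Weyl form and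
  -- weak continuity hold everywhere.
  set α' : Grp → Grp → ℂ := fun g =>
    if α g = compKer (Function.uncurry k₁) (kerOp l₂) g then
      fun h => ∫ w, k₁ g w * k₂ w h ∂haarL else α g with hα'
  have h1 : ∀ g, α' g =ᵐ[haarL] α g := by
    intro g
    by_cases h : α g = compKer (Function.uncurry k₁) (kerOp l₂) g
    · rw [hα']
      simp only [if_pos h]
      rw [h]
      exact (hker g).symm
    · rw [hα']
      simp only [if_neg h]
      rfl
  have h2 : ∀ g, MemLp (α' g) 2 haarL := fun g => (memLp_congr_ae (h1 g)).2 (Lp.memLp (α g))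
  have h3 : ∀ g, (h2 g).toLp (α' g) = α g := fun g =>
    Lp.ext ((MemLp.coeFn_toLp _).trans (h1 g))
  refine ⟨α', k₁, k₂, ⟨h2, fun ψ => ?_, ?_⟩, ?_, hk₁, hk₂, ?_⟩
  · simp only [h3]
    exact hαc ψ
  -- For almost every `g`, `α(g)` is up to conjugation the image of `k₁(g)` under the adjoint of the
  -- second factor, hence `‖α(g)‖ ≤ ‖B*‖ ‖k₁(g)‖`.
  · have h4 : ∫⁻ g, eLpNorm (α' g) 2 haarL ^ 2 ∂haarL ≤
        ∫⁻ g, ‖(kerOp l₂).adjoint‖ₑ ^ 2 * eLpNorm (k₁ g) 2 haarL ^ 2 ∂haarL := by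
      refine lintegral_mono_ae ?_
      filter_upwards [hae] with g hg
      rw [eLpNorm_congr_ae (h1 g), ← Lp.enorm_def, hg, compKer, ← mul_pow]
      gcongr
      have h5 : slice haarL (Function.uncurry k₁) g = (hk₁.memLp g).toLp (k₁ g) :=
        slice_of_memLp (k := Function.uncurry k₁) (hk₁.memLp g)
      have h6 : ∀ F : L2Grp, ‖star F‖ₑ = ‖F‖ₑ := fun F => by
        rw [← ofReal_norm, ← ofReal_norm, norm_star_L2]
      rw [h6, ← Lp.enorm_toLp (hk₁.memLp g), ← h5, ← h6 (slice haarL (Function.uncurry k₁) g)]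
      exact ContinuousLinearMap.le_opENorm _ _
    refine h4.trans_lt ?_
    rw [lintegral_const_mul' _ _ (by simp)]
    exact ENNReal.mul_lt_top (by simp) hk₁.sqIntegrable
  · rw [hasWeylForm_iff h2]
    simp only [h3]
    exact hα
  · filter_upwards [hae] with g hg h
    rw [hα']
    simp only [if_pos hg]

end Existence

end AffinePoincare

end

theorem mainTheorem3 (σ : AffinePoincare.OpSymbol) (hσ : AffinePoincare.IsAdmissible σ) :
    ((∃ S : AffinePoincare.L2Grp →L[ℂ] AffinePoincare.L2Grp,
        AffinePoincare.IsPdo σ S ∧ AffinePoincare.IsTraceClass S) ↔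
      ∃ α k₁ k₂ : AffinePoincare.Grp → AffinePoincare.Grp → ℂ,
        AffinePoincare.IsTraceRepr σ α k₁ k₂) ∧
    ∀ S : AffinePoincare.L2Grp →L[ℂ] AffinePoincare.L2Grp,
      AffinePoincare.IsPdo σ S → AffinePoincare.IsTraceClass S →
      ∀ α k₁ k₂ : AffinePoincare.Grp → AffinePoincare.Grp → ℂ,
        AffinePoincare.IsTraceRepr σ α k₁ k₂ →
        Integrable (fun g => α g g) AffinePoincare.haarL ∧
        AffinePoincare.opTrace S = ∫ g, α g g ∂AffinePoincare.haarL ∧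
        ∀ (ι : Type) (b : HilbertBasis ι ℂ AffinePoincare.L2Grp),
          HasSum (fun n => inner ℂ (b n) (S (b n))) (∫ g, α g g ∂AffinePoincare.haarL) := by
  refine ⟨⟨fun ⟨S, hS, hT⟩ => AffinePoincare.exists_isTraceRepr hσ hS hT, ?_⟩, ?_⟩
  · rintro ⟨α, k₁, k₂, h⟩
    -- The witness is the product of the integral operators with kernels `k₁` and `k₂`.
    exact ⟨_, h.isPdo, AffinePoincare.isTraceClass_comp (AffinePoincare.hsNorm2_kerOp_lt_top _)
      (AffinePoincare.hsNorm2_kerOp_lt_top _)⟩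
  · intro S hS _ α k₁ k₂ h
    have hb := h.trace hS (AffinePoincare.chosenBasis AffinePoincare.L2Grp)
    exact ⟨hb.1, hb.2.tsum_eq, fun ι b => (h.trace hS b).2⟩
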